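/- Let $R>1$ and $0<\gamma<\pi$, and let $C_1'=(E_0,E_1)$ be the condenser in the extended complex plane with plates $E_0=\{e^{i\varphi}/R:\varphi\in[-\gamma,\gamma]\}$ and $E_1=\{Re^{i\varphi}:\varphi\in[-\gamma,\gamma]\}$. Its capacity is $\mathrm{Cap}(C_1')=\inf_u\int_{\mathbb C}|\nabla u|^2\,d\sigma$, where $\sigma$ is planar Lebesgue measure and $u$ runs over the continuous functions $\overline{\mathbb C}\to\mathbb R$ with $u=0$ on $E_0$ and $u=1$ on $E_1$ that are Lipschitz in a neighbourhood of every finite point of $\overline{\mathbb C}\setminus(E_0\cup E_1)$, possibly excluding a finite number of points. For $0<q<1$ and $w\in\mathbb C$ let $$\vartheta_1(w;q)=2\sum_{n\ge0}(-1)^nq^{(n+1/2)^2}\sin((2n+1)w),\qquad \vartheta_2(w;q)=2\sum_{n\ge0}q^{(n+1/2)^2}\cos((2n+1)w),$$ $$\vartheta_3(w;q)=1+2\sum_{n\ge1}q^{n^2}\cos(2nw),\qquad \vartheta_4(w;q)=1+2\sum_{n\ge1}(-1)^nq^{n^2}\cos(2nw),$$ and put $$K=\frac{\pi}{2}\vartheta_3(0;q)^2,\qquad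 k=\frac{\vartheta_2(0;q)^2}{\vartheta_3(0;q)^2},\qquad \theta_4(u)=\vartheta_4\Big(\frac{\pi u}{2K};q\Big),\qquad Z(u)=\frac{\theta_4'(u)}{\theta_4(u)}.$$ Let $\mathrm{sn},\mathrm{cn},\mathrm{dn}$ be the Jacobi elliptic functions of modulus $k$, that is, with $w=\pi u/2K$ and all theta functions taken at the nome $q$, $$\mathrm{sn}(u)=\frac{\vartheta_3(0)\,\vartheta_1(w)}{\vartheta_2(0)\,\vartheta_4(w)},\qquad \mathrm{cn}(u)=\frac{\vartheta_4(0)\,\vartheta_2(w)}{\vartheta_2(0)\,\vartheta_4(w)},\qquad \mathrm{dn}(u)=\frac{\vartheta_4(0)\,\vartheta_3(w)}{\vartheta_3(0)\,\vartheta_4(w)}.$$ Let $$F(x,k)=\int_0^x\frac{dt}{\sqrt{(1-t^2)(1-k^2t^2)}},\qquad \Pi(x,\nu,k)=\int_0^x\frac{dt}{(1+\nu t^2)\sqrt{(1-t^2)(1-k^2t^2)}}.$$ Then $0<\mathrm{Cap}(C_1')<\infty$, and with $$q=e^{-\pi/\mathrm{Cap}(C_1')},\qquad \alpha=\frac1\pi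 K\ln R,$$ there is a (unique) $\lambda\in(0,1)$ with $$\lambda^2=\frac{Z(i\alpha)}{k^2\,\mathrm{sn}(i\alpha)\,[\mathrm{cn}(i\alpha)\,\mathrm{dn}(i\alpha)+\mathrm{sn}(i\alpha)\,Z(i\alpha)]},$$ and the capacity satisfies the transcendental equation $$\gamma=2i\,\frac{\mathrm{cn}(i\alpha)\,\mathrm{dn}(i\alpha)}{\mathrm{sn}(i\alpha)}\Big[\Pi\big(\lambda,-k^2\mathrm{sn}^2(i\alpha),k\big)-F(\lambda,k)\Big]-2i\,F(\lambda,k)\,Z(i\alpha).$$ -/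

import Mathlib

open MeasureTheory Topology
open scoped ENNReal NNReal

noncomputable section

/-! ## Condensers in the extended complex plane and their capacity -/

/-- A condenser: a pair of closed, non-empty, disjoint subsets (the plates) of the extended
complex plane. -/
structure Condenser where
  E₀ : Set (OnePoint ℂ)
  E₁ : Set (OnePoint ℂ)
  isClosed₀ : IsClosed E₀
  isClosed₁ : IsClosed E₁
  nonempty₀ : E₀.Nonempty
  nonempty₁ : E₁.Nonempty
  disjoint : Disjoint E₀ E₁

namespace Condenser

/-- The field of the condenser: the complement of the two plates. -/
def field (C : Condenser) : Set (OnePoint ℂ) := (C.E₀ ∪ C.E₁)ᶜ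

/-- The admissible functions: continuous on the extended plane, equal to `i` on the plate `Eᵢ`,
and Lipschitz in a neighbourhood of every finite point of the field, possibly with finitely many
exceptional points. -/
def Admissible (C : Condenser) (u : OnePoint ℂ → ℝ) : Prop :=
  Continuous u ∧ (∀ z ∈ C.E₀, u z = 0) ∧ (∀ z ∈ C.E₁, u z = 1) ∧
    ∃ S : Finset ℂ, ∀ z : ℂ, (z : OnePoint ℂ) ∈ C.field → z ∉ S →
      ∃ c : ℝ≥0, ∃ t ∈ 𝓝 z, LipschitzOnWith c (fun w : ℂ => u (w : OnePoint ℂ)) t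

/-- The Dirichlet integral `∫ |∇u|² dσ` over the plane. The operator norm of the real Fréchet
derivative is the Euclidean norm of the gradient. -/
def dirichletIntegral (u : OnePoint ℂ → ℝ) : ℝ≥0∞ :=
  ∫⁻ z : ℂ, ‖fderiv ℝ (fun w : ℂ => u (w : OnePoint ℂ)) z‖ₑ ^ 2

/-- The capacity: the infimum of the Dirichlet integral over the admissible functions. -/
def capacity (C : Condenser) : ℝ≥0∞ :=
  ⨅ (u : OnePoint ℂ → ℝ) (_ : C.Admissible u), dirichletIntegral u

end Condenser

/-- The closed circular arc of radius `r` centred at the origin, with arguments in `[-γ, γ]`,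
as a subset of the extended plane. -/
def circArc (r γ : ℝ) : Set (OnePoint ℂ) :=
  (fun φ : ℝ => (((r : ℂ) * Complex.exp (Complex.I * φ) : ℂ) : OnePoint ℂ)) '' Set.Icc (-γ) γ

lemma isClosed_circArc (r γ : ℝ) : IsClosed (circArc r γ) := by
  refine (isCompact_Icc.image ?_).isClosed
  exact OnePoint.continuous_coe.comp (by fun_prop)

lemma circArc_nonempty (r : ℝ) {γ : ℝ} (hγ : 0 < γ) : (circArc r γ).Nonempty :=
  ⟨_, 0, ⟨by linarith, hγ.le⟩, rfl⟩

lemma disjoint_circArc {r s : ℝ} (γ : ℝ) (hr : 0 < r) (hs : 0 < s) (hrs : r ≠ s) :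
    Disjoint (circArc r γ) (circArc s γ) := by
  rw [Set.disjoint_left]
  rintro _ ⟨φ, -, rfl⟩ ⟨ψ, -, h⟩
  apply hrs
  have h' := congrArg norm (OnePoint.coe_injective h)
  simpa [Complex.norm_exp, abs_of_pos hr, abs_of_pos hs] using h'.symm

/-- The condenser whose plates are the arcs of the circles `|z| = 1/R` (plate `E₀`) and `|z| = R`
(plate `E₁`) with arguments in `[-γ, γ]`. -/
def arcCondenser (R γ : ℝ) (hR : 1 < R) (hγ : 0 < γ) : Condenser where
  E₀ := circArc (1 / R) γ
  E₁ := circArc R γ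
  isClosed₀ := isClosed_circArc _ _
  isClosed₁ := isClosed_circArc _ _
  nonempty₀ := circArc_nonempty _ hγ
  nonempty₁ := circArc_nonempty _ hγ
  disjoint := by
    have h0 : 0 < R := by linarith
    refine disjoint_circArc γ (by positivity) h0 (ne_of_lt ?_)
    rw [div_lt_iff₀ h0]
    nlinarith

/-! ## Theta functions of real nome `q ∈ (0, 1)` and complex argument -/

/-- `ϑ₁(w; q) = 2 ∑_{n ≥ 0} (-1)ⁿ q^{(n+1/2)²} sin((2n+1)w)` -/
def theta1 (q : ℝ) (w : ℂ) : ℂ :=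
  2 * ∑' n : ℕ, (-1) ^ n * ((q ^ (((n : ℝ) + 1 / 2) ^ 2) : ℝ) : ℂ) * Complex.sin ((2 * n + 1) * w)

/-- `ϑ₂(w; q) = 2 ∑_{n ≥ 0} q^{(n+1/2)²} cos((2n+1)w)` -/
def theta2 (q : ℝ) (w : ℂ) : ℂ :=
  2 * ∑' n : ℕ, ((q ^ (((n : ℝ) + 1 / 2) ^ 2) : ℝ) : ℂ) * Complex.cos ((2 * n + 1) * w)

/-- `ϑ₃(w; q) = 1 + 2 ∑_{n ≥ 1} q^{n²} cos(2nw)` (the summation index is shifted by one) -/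
def theta3 (q : ℝ) (w : ℂ) : ℂ :=
  1 + 2 * ∑' n : ℕ, (q : ℂ) ^ ((n + 1) ^ 2) * Complex.cos (2 * (n + 1) * w)

/-- `ϑ₄(w; q) = 1 + 2 ∑_{n ≥ 1} (-1)ⁿ q^{n²} cos(2nw)` (the summation index is shifted by one) -/
def theta4 (q : ℝ) (w : ℂ) : ℂ :=
  1 + 2 * ∑' n : ℕ, (-1) ^ (n + 1) * (q : ℂ) ^ ((n + 1) ^ 2) * Complex.cos (2 * (n + 1) * w)

/-- The real number `ϑ₂(0; q)`. -/
def thetaNull2 (q : ℝ) : ℝ := 2 * ∑' n : ℕ, q ^ (((n : ℝ) + 1 / 2) ^ 2)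

/-- The real number `ϑ₃(0; q)`. -/
def thetaNull3 (q : ℝ) : ℝ := 1 + 2 * ∑' n : ℕ, q ^ ((n + 1) ^ 2)

lemma theta2_zero (q : ℝ) : theta2 q 0 = thetaNull2 q := by
  simp only [theta2, thetaNull2, mul_zero, Complex.cos_zero, mul_one, Complex.ofReal_mul,
    Complex.ofReal_tsum, Complex.ofReal_ofNat]

lemma theta3_zero (q : ℝ) : theta3 q 0 = thetaNull3 q := by
  simp only [theta3, thetaNull3, mul_zero, Complex.cos_zero, mul_one, Complex.ofReal_mul,
    Complex.ofReal_tsum, Complex.ofReal_ofNat, Complex.ofReal_add, Complex.ofReal_one,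
    Complex.ofReal_pow]

/-! ## Elliptic functions and integrals -/

/-- The complete elliptic integral of the first kind as a function of the nome:
`2K = π ϑ₃(0; q)²`. -/
def ellipticK (q : ℝ) : ℝ := Real.pi / 2 * thetaNull3 q ^ 2

/-- The modulus as a function of the nome: the positive `k` with
`k² = ϑ₂(0; q)⁴ / ϑ₃(0; q)⁴`. -/
def modulus (q : ℝ) : ℝ := thetaNull2 q ^ 2 / thetaNull3 q ^ 2

/-- The Jacobi function `sn(u, k)`, `k = modulus q`, as a meromorphic function of `u`. -/
def jacobiSn (q : ℝ) (u : ℂ) : ℂ :=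
  theta3 q 0 / theta2 q 0 *
    (theta1 q (Real.pi * u / (2 * ellipticK q)) / theta4 q (Real.pi * u / (2 * ellipticK q)))

/-- The Jacobi function `cn(u, k)`, `k = modulus q`, as a meromorphic function of `u`. -/
def jacobiCn (q : ℝ) (u : ℂ) : ℂ :=
  theta4 q 0 / theta2 q 0 *
    (theta2 q (Real.pi * u / (2 * ellipticK q)) / theta4 q (Real.pi * u / (2 * ellipticK q)))

/-- The Jacobi function `dn(u, k)`, `k = modulus q`, as a meromorphic function of `u`. -/
def jacobiDn (q : ℝ) (u : ℂ) : ℂ :=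
  theta4 q 0 / theta3 q 0 *
    (theta3 q (Real.pi * u / (2 * ellipticK q)) / theta4 q (Real.pi * u / (2 * ellipticK q)))

/-- The Jacobi zeta function: the logarithmic derivative `θ₄'(u)/θ₄(u)` of
`θ₄(u) = ϑ₄(πu/2K; q)`. -/
def jacobiZ (q : ℝ) (u : ℂ) : ℂ :=
  logDeriv (fun w : ℂ => theta4 q (Real.pi * w / (2 * ellipticK q))) u

/-- The incomplete elliptic integral of the first kind
`F(x, k) = ∫₀ˣ dt / √((1-t²)(1-k²t²))`. -/
def ellipticF (x k : ℝ) : ℝ :=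
  ∫ t in (0 : ℝ)..x, 1 / Real.sqrt ((1 - t ^ 2) * (1 - k ^ 2 * t ^ 2))

/-- The incomplete elliptic integral of the third kind
`Π(x, ν, k) = ∫₀ˣ dt / ((1+νt²) √((1-t²)(1-k²t²)))`. -/
def ellipticPi (x : ℝ) (ν : ℂ) (k : ℝ) : ℂ :=
  ∫ t in (0 : ℝ)..x,
    1 / ((1 + ν * (t : ℂ) ^ 2) * (Real.sqrt ((1 - t ^ 2) * (1 - k ^ 2 * t ^ 2)) : ℂ))

end

noncomputable section

open Complex

/-! The field of the condenser is doubly connected, hence conformally a cylinder; the conformal map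
can be written down and everything is read off from it. Put R = e^{2a} and, for T > 2a, let G(w) =
e^{2a} ϑ₄(w − iT/2 + ia) / ϑ₄(w − iT/2 − ia) with nome e^{−T}, on the cylinder {|Im w| < T/2} / πℤ
(`condenserMap`).

On the two boundary lines |G| equals R and 1/R, and on both the argument of G is φ(x) = arg(ϑ₄(x +
ia) / ϑ₄(x − ia)) (`boundaryPhase`), an odd function of period π. Its maximum depends continuously
on the nome q, vanishes at q = 0 and exceeds any given number below π for a suitable q < 1/R. So
some T makes it equal to γ, attained at a point x₀ of (0, π/2) (`exists_nome_of_angle`), and the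
boundary lines are mapped onto the plates.

By the addition theorem for ϑ₄, two critical points of the quotient agree up to sign modulo the
zeros of ϑ₁ (`vth1_add_mul_vth1_sub_eq_zero`). As x₀ is one, G has no critical point inside the
cylinder. An open-closed argument over the connected complement of the plates, started from the
value 0, which G takes only once, makes G a bijection of the cylinder without its pole onto that
complement (`IsStripMap.image_eq`, `IsStripMap.sin_sub_eq_zero_of_map_eq`).

The Dirichlet integral is conformally invariant, so the capacity is that of a cylinder of
circumference π and height T, namely π/T: the function linear in Im w bounds it from above, and
Cauchy–Schwarz on vertical segments from below (`IsStripMap.capacity_eq`). Hence e^{−π/Cap} is the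
nome e^{−T} of the map itself. Since 2K = πϑ₃(0)², the point iα corresponds to ia in the theta
variable. With λ = sn at x₀, the equation φ'(x₀) = 0 is the formula for λ²
(`thetaSn_sq_eq_of_quotDerivNum_eq_zero`), and γ = ∫₀^{x₀} φ' becomes the transcendental equation
under t = sn (`ofReal_boundaryPhase_eq`).

The theta identities come from the series: Cauchy products give the addition theorems, the triple
product gives the zeros and a continuous logarithm, and Landen's transformation together with T → ∞
gives ϑ₁'(0) = ϑ₂ϑ₃ϑ₄, which normalises sn' = cn dn. -/

/-- The theta function `ϑ₃(w; e^{-T})`. -/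
def vth3 (T : ℝ) (w : ℂ) : ℂ := jacobiTheta₂ (w / Real.pi) (I * T / Real.pi)

/-- The theta function `ϑ₄(w; e^{-T})`. -/
def vth4 (T : ℝ) (w : ℂ) : ℂ := vth3 T (w + Real.pi / 2)

/-- The theta function `ϑ₂(w; e^{-T})`. -/
def vth2 (T : ℝ) (w : ℂ) : ℂ := exp (-T / 4 + I * w) * vth3 T (w + I * T / 2)

/-- The theta function `ϑ₁(w; e^{-T})`. -/
def vth1 (T : ℝ) (w : ℂ) : ℂ := vth2 T (w - Real.pi / 2)

/-! ### Series, symmetries and half-period shifts of the theta functions -/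

lemma im_thetaParameter_pos {T : ℝ} (hT : 0 < T) : 0 < (I * T / Real.pi : ℂ).im := by
  rw [div_ofReal_im]; simp; exact div_pos hT Real.pi_pos

lemma hasSum_vth3 {T : ℝ} (hT : 0 < T) (w : ℂ) :
    HasSum (fun n : ℤ => exp (-T * n ^ 2 + 2 * I * n * w)) (vth3 T w) := by
  have h := hasSum_jacobiTheta₂_term (w / Real.pi) (im_thetaParameter_pos hT)
  refine h.congr_fun fun n => ?_
  have hpi : (Real.pi : ℂ) ≠ 0 := by exact_mod_cast Real.pi_ne_zero
  rw [jacobiTheta₂_term]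
  congr 1
  field_simp
  linear_combination (-(n : ℂ) ^ 2 * T) * I_sq

lemma hasSum_vth2 {T : ℝ} (hT : 0 < T) (w : ℂ) :
    HasSum (fun n : ℤ => exp (-T * (n + 1 / 2) ^ 2 + 2 * I * (n + 1 / 2) * w)) (vth2 T w) := by
  refine ((hasSum_vth3 hT (w + I * T / 2)).mul_left _).congr_fun fun n => ?_
  rw [← exp_add]
  congr 1
  linear_combination (-(n : ℂ) * T) * I_sq

lemma differentiable_vth3 {T : ℝ} (hT : 0 < T) : Differentiable ℂ (vth3 T) := by
  have h : Differentiable ℂ fun z => jacobiTheta₂ z (I * T / Real.pi) := fun z =>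
    differentiableAt_jacobiTheta₂_fst z (im_thetaParameter_pos hT)
  exact h.comp (by fun_prop : Differentiable ℂ fun w : ℂ => w / Real.pi)

lemma differentiable_vth4 {T : ℝ} (hT : 0 < T) : Differentiable ℂ (vth4 T) :=
  (differentiable_vth3 hT).comp (by fun_prop : Differentiable ℂ fun w : ℂ => w + Real.pi / 2)

lemma differentiable_vth2 {T : ℝ} (hT : 0 < T) : Differentiable ℂ (vth2 T) :=
  (by fun_prop : Differentiable ℂ fun w : ℂ => exp (-T / 4 + I * w)).mul
    ((differentiable_vth3 hT).comp (by fun_prop : Differentiable ℂ fun w : ℂ => w + I * T / 2))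

lemma differentiable_vth1 {T : ℝ} (hT : 0 < T) : Differentiable ℂ (vth1 T) :=
  (differentiable_vth2 hT).comp (by fun_prop : Differentiable ℂ fun w : ℂ => w - Real.pi / 2)

lemma vth3_add_pi (T : ℝ) (w : ℂ) : vth3 T (w + Real.pi) = vth3 T w := by
  have hpi : (Real.pi : ℂ) ≠ 0 := by exact_mod_cast Real.pi_ne_zero
  rw [vth3, add_div, div_self hpi, jacobiTheta₂_add_left, vth3]

lemma vth3_neg (T : ℝ) (w : ℂ) : vth3 T (-w) = vth3 T w := by
  rw [vth3, neg_div, jacobiTheta₂_neg_left, vth3]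

lemma vth3_add_I_mul (T : ℝ) (w : ℂ) :
    vth3 T (w + I * T) = exp (T - 2 * I * w) * vth3 T w := by
  have hpi : (Real.pi : ℂ) ≠ 0 := by exact_mod_cast Real.pi_ne_zero
  rw [vth3, add_div, jacobiTheta₂_add_left', vth3]
  congr 2
  field_simp
  linear_combination (-(T : ℂ)) * I_sq

lemma vth3_sub_pi (T : ℝ) (w : ℂ) : vth3 T (w - Real.pi) = vth3 T w := by
  rw [← vth3_add_pi, sub_add_cancel]

lemma vth3_conj (T : ℝ) (w : ℂ) : vth3 T (starRingEnd ℂ w) = starRingEnd ℂ (vth3 T w) := by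
  rw [vth3, vth3, jacobiTheta₂_conj]
  simp [neg_div]

lemma exp_neg_I_pi_div_two : exp (-(I * (Real.pi / 2))) = -I := by
  rw [show -(I * ((Real.pi : ℂ) / 2)) = -(Real.pi / 2 : ℂ) * I by ring, exp_mul_I]
  simp

lemma exp_I_pi_div_two : exp (I * (Real.pi / 2)) = I := by
  rw [show I * ((Real.pi : ℂ) / 2) = (Real.pi / 2 : ℂ) * I by ring, exp_mul_I]
  simp

lemma exp_I_pi : exp (I * Real.pi) = -1 := by
  rw [mul_comm, exp_pi_mul_I]

lemma vth2_add_pi (T : ℝ) (w : ℂ) : vth2 T (w + Real.pi) = -vth2 T w := by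
  rw [vth2, show w + Real.pi + I * T / 2 = w + I * T / 2 + Real.pi by ring, vth3_add_pi, vth2,
    show -(T : ℂ) / 4 + I * (w + Real.pi) = -T / 4 + I * w + I * Real.pi by ring, exp_add _ (I * _),
    exp_I_pi]
  ring

lemma vth2_sub_pi (T : ℝ) (w : ℂ) : vth2 T (w - Real.pi) = -vth2 T w := by
  rw [← neg_eq_iff_eq_neg, ← vth2_add_pi, sub_add_cancel]

lemma vth2_neg (T : ℝ) (w : ℂ) : vth2 T (-w) = vth2 T w := by
  rw [vth2, vth2, show w + I * T / 2 = (w - I * T / 2) + I * T by ring, vth3_add_I_mul,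
    ← vth3_neg, ← mul_assoc, ← exp_add]
  congr 2
  · linear_combination (-(T : ℂ)) * I_sq
  · ring

lemma vth1_neg (T : ℝ) (w : ℂ) : vth1 T (-w) = -vth1 T w := by
  rw [vth1, vth1, ← vth2_neg, ← vth2_add_pi]
  congr 1; ring

lemma vth1_zero (T : ℝ) : vth1 T 0 = 0 := by
  have := vth1_neg T 0
  rw [neg_zero] at this
  exact self_eq_neg.mp this

lemma vth4_add_pi (T : ℝ) (w : ℂ) : vth4 T (w + Real.pi) = vth4 T w := by
  rw [vth4, vth4, ← vth3_add_pi T (w + _)]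
  congr 1; ring

lemma vth1_add_pi (T : ℝ) (w : ℂ) : vth1 T (w + Real.pi) = -vth1 T w := by
  rw [vth1, vth1, ← vth2_add_pi T (w - _)]
  congr 1; ring

lemma vth4_conj (T : ℝ) (w : ℂ) : vth4 T (starRingEnd ℂ w) = starRingEnd ℂ (vth4 T w) := by
  rw [vth4, vth4, ← vth3_conj]
  simp [map_ofNat (starRingEnd ℂ) 2]

lemma vth2_conj (T : ℝ) (w : ℂ) : vth2 T (starRingEnd ℂ w) = starRingEnd ℂ (vth2 T w) := by
  rw [← vth2_neg, vth2, vth2, map_mul, ← exp_conj, ← vth3_conj, ← vth3_neg]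
  simp only [map_add, map_mul, map_div₀, map_neg, conj_I, conj_ofReal, map_ofNat]
  ring_nf

lemma vth1_conj (T : ℝ) (w : ℂ) : vth1 T (starRingEnd ℂ w) = starRingEnd ℂ (vth1 T w) := by
  rw [vth1, vth1, ← vth2_conj]
  simp [map_ofNat (starRingEnd ℂ) 2]

/-- Half-period shift of `ϑ₁`. -/
lemma vth1_add_half (T : ℝ) (w : ℂ) :
    vth1 T (w + I * T / 2) = I * exp (T / 4 - I * w) * vth4 T w := by
  rw [vth1, vth2, vth4, show w + I * T / 2 - Real.pi / 2 + I * T / 2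
    = (w - Real.pi / 2) + I * T by ring, vth3_add_I_mul, ← vth3_add_pi, ← mul_assoc, ← exp_add,
    show w - (Real.pi : ℂ) / 2 + Real.pi = w + Real.pi / 2 by ring]
  rw [show -(T : ℂ) / 4 + I * (w + I * T / 2 - Real.pi / 2) + (T - 2 * I * (w - Real.pi / 2))
    = T / 4 - I * w + I * (Real.pi / 2) by linear_combination (T / 2 : ℂ) * I_sq,
    exp_add _ (I * _), exp_I_pi_div_two]
  ring

lemma vth3_add_half (T : ℝ) (w : ℂ) :
    vth3 T (w + I * T / 2) = exp (T / 4 - I * w) * vth2 T w := by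
  rw [vth2, ← mul_assoc, ← exp_add]
  ring_nf
  simp

lemma vth2_add_half (T : ℝ) (w : ℂ) :
    vth2 T (w + I * T / 2) = exp (T / 4 - I * w) * vth3 T w := by
  rw [vth2, show w + I * T / 2 + I * T / 2 = w + I * T by ring, vth3_add_I_mul, ← mul_assoc,
    ← exp_add]
  congr 2
  linear_combination (T / 2 : ℂ) * I_sq

/-! ### Products of theta series and the basic addition theorem -/

lemma hasSum_int_even_add_odd {f : ℤ → ℂ} {a b : ℂ} (he : HasSum (fun n => f (2 * n)) a)
    (ho : HasSum (fun n => f (2 * n + 1)) b) : HasSum f (a + b) := by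
  have h1 : Function.Injective (fun n : ℤ => 2 * n) := fun x y h => by simpa using h
  have h2 : Function.Injective (fun n : ℤ => 2 * n + 1) := fun x y h => by simpa using h
  have he' := h1.hasSum_range_iff.2 (show HasSum (f ∘ fun n => 2 * n) a from he)
  have ho' := h2.hasSum_range_iff.2 (show HasSum (f ∘ fun n => 2 * n + 1) b from ho)
  refine HasSum.add_isCompl ?_ he' ho'
  have e1 : Set.range (fun n : ℤ => 2 * n) = {n | Even n} := by
    ext n
    simp [even_iff_exists_two_mul]
  have e2 : Set.range (fun n : ℤ => 2 * n + 1) = {n | Odd n} := by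
    ext n
    simp [Odd]
  rw [e1, e2]
  exact Int.isCompl_even_odd

/-- Splitting `ϑ₃` into its even and odd parts. -/
lemma vth3_half_nome {T : ℝ} (hT : 0 < T) (w : ℂ) :
    vth3 (T / 2) w = vth3 (2 * T) (2 * w) + vth2 (2 * T) (2 * w) := by
  refine (hasSum_vth3 (half_pos hT) w).unique (hasSum_int_even_add_odd ?_ ?_)
  · refine (hasSum_vth3 (by positivity : 0 < 2 * T) (2 * w)).congr_fun fun n => ?_
    congr 1; push_cast; ring
  · refine (hasSum_vth2 (by positivity : 0 < 2 * T) (2 * w)).congr_fun fun n => ?_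
    congr 1; push_cast; ring

/-- The Cauchy product of two series over `ℤ`, summed along the diagonals. -/
lemma hasSum_mul_diagonal {f g : ℤ → ℂ} {a b : ℂ} (hf : HasSum f a) (hg : HasSum g b) :
    HasSum (fun s : ℤ => ∑' n : ℤ, f (n + s) * g n) (a * b) := by
  let e : ℤ × ℤ ≃ ℤ × ℤ :=
    { toFun := fun p => (p.2 + p.1, p.2)
      invFun := fun p => (p.1 - p.2, p.2)
      left_inv := fun p => by simp
      right_inv := fun p => by simp }
  have hs := summable_mul_of_summable_norm hf.summable.norm hg.summable.norm
  have hprod : HasSum (fun p : ℤ × ℤ => f p.1 * g p.2) (a * b) := hf.mul hg hs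
  have hshear : HasSum (fun p : ℤ × ℤ => f (p.2 + p.1) * g p.2) (a * b) :=
    (e.hasSum_iff (f := fun p : ℤ × ℤ => f p.1 * g p.2)).2 hprod
  exact hshear.prod_fiberwise fun s => (hshear.summable.prod_factor s).hasSum

/-- The addition theorem for `ϑ₃`, with theta functions of the doubled parameter. -/
lemma vth3_mul_vth3 {T : ℝ} (hT : 0 < T) (x y : ℂ) :
    vth3 T (x + y) * vth3 T (x - y) = vth3 (2 * T) (2 * x) * vth3 (2 * T) (2 * y)
      + vth2 (2 * T) (2 * x) * vth2 (2 * T) (2 * y) := by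
  have h2 : 0 < 2 * T := by positivity
  -- On the diagonal of index difference s the quadratic exponents combine by (n+s)² + n² =
  -- 2(n+s/2)² + 2(s/2)². Even s gives the two ϑ₃ series of parameter 2T, odd s the two ϑ₂ series.
  refine (hasSum_mul_diagonal (hasSum_vth3 hT (x + y)) (hasSum_vth3 hT (x - y))).unique
    (hasSum_int_even_add_odd ?_ ?_)
  · refine ((hasSum_vth3 h2 (2 * y)).mul_left (vth3 (2 * T) (2 * x))).congr_fun fun b => ?_
    have h := (((Equiv.addRight b).hasSum_iff.2 (hasSum_vth3 h2 (2 * x))).mul_right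
      (exp (-(2 * T : ℝ) * b ^ 2 + 2 * I * b * (2 * y))))
    rw [← h.tsum_eq]
    refine tsum_congr fun n => ?_
    simp only [← exp_add, Function.comp, Equiv.coe_addRight]
    congr 1; push_cast; ring
  · refine ((hasSum_vth2 h2 (2 * y)).mul_left (vth2 (2 * T) (2 * x))).congr_fun fun b => ?_
    have h := (((Equiv.addRight b).hasSum_iff.2 (hasSum_vth2 h2 (2 * x))).mul_right
      (exp (-(2 * T : ℝ) * (b + 1 / 2) ^ 2 + 2 * I * (b + 1 / 2) * (2 * y))))
    rw [← h.tsum_eq]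
    refine tsum_congr fun n => ?_
    simp only [← exp_add, Function.comp, Equiv.coe_addRight]
    congr 1; push_cast; ring


/-! ### Agreement with the theta series of the statement -/

lemma theta2_exp_neg {T : ℝ} (hT : 0 < T) (w : ℂ) : theta2 (Real.exp (-T)) w = vth2 T w := by
  -- The indices n and −n−1 have opposite half-integers n + 1/2, so each pair of exponentials makes
  -- a cosine.
  have h := (hasSum_vth2 hT w).nat_add_neg_add_one
  rw [theta2, ← h.tsum_eq, ← tsum_mul_left]
  refine tsum_congr fun n => ?_
  rw [← Real.exp_mul, ofReal_exp, cos]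
  push_cast
  rw [show (2 : ℂ) * (exp (-T * (n + 1 / 2) ^ 2) * ((exp ((2 * n + 1) * w * I)
    + exp (-((2 * n + 1) * w) * I)) / 2)) = exp (-T * (n + 1 / 2) ^ 2) * exp ((2 * n + 1) * w * I)
    + exp (-T * (n + 1 / 2) ^ 2) * exp (-((2 * n + 1) * w) * I) by ring, ← exp_add, ← exp_add]
  congr 2 <;> ring

lemma theta1_exp_neg {T : ℝ} (hT : 0 < T) (w : ℂ) : theta1 (Real.exp (-T)) w = vth1 T w := by
  rw [vth1, ← theta2_exp_neg hT, theta1, theta2]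
  congr 1
  refine tsum_congr fun n => ?_
  rw [mul_right_comm, mul_comm, mul_comm (_ ^ n)]
  congr 1
  rw [show (2 * n + 1) * (w - Real.pi / 2) = (2 * n + 1) * w - Real.pi / 2 - n * Real.pi by ring,
    cos_antiperiodic.sub_nat_mul_eq, cos_sub_pi_div_two]
  ring

lemma theta3_exp_neg {T : ℝ} (hT : 0 < T) (w : ℂ) : theta3 (Real.exp (-T)) w = vth3 T w := by
  have h := (hasSum_vth3 hT w).nat_add_neg
  have h' := h.tsum_eq
  rw [h.summable.tsum_eq_zero_add] at h'
  -- Folding the series over ℤ counts the term n = 0 twice, hence the extra 1 on both sides.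
  have h0 : theta3 (Real.exp (-T)) w + 1 = vth3 T w + 1 := by
    convert h' using 1
    · rw [theta3, ← tsum_mul_left]
      simp only [Int.cast_zero, Nat.cast_zero]
      rw [add_comm, ← add_assoc]
      congr 1
      · norm_num
      refine tsum_congr fun n => ?_
      rw [ofReal_exp, ← exp_nat_mul, cos]
      push_cast
      rw [show 2 * (exp (((n : ℂ) + 1) ^ 2 * -T) * ((exp (2 * (n + 1) * w * I)
        + exp (-(2 * (n + 1) * w) * I)) / 2)) = exp ((n + 1) ^ 2 * -T) * exp (2 * (n + 1) * w * I)
        + exp ((n + 1) ^ 2 * -T) * exp (-(2 * (n + 1) * w) * I) by ring, ← exp_add, ← exp_add]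
      congr 2 <;> ring
    · simp
  exact add_right_cancel h0

lemma theta4_exp_neg {T : ℝ} (hT : 0 < T) (w : ℂ) : theta4 (Real.exp (-T)) w = vth4 T w := by
  rw [vth4, ← theta3_exp_neg hT, theta4, theta3]
  congr 2
  refine tsum_congr fun n => ?_
  rw [show 2 * ((n : ℂ) + 1) * (w + Real.pi / 2) = 2 * (n + 1) * w + (n + 1 : ℕ) * Real.pi by
    push_cast; ring, cos_antiperiodic.add_nat_mul_eq]
  ring

/-! ### The Jacobi triple product -/

/-- The `q`-Pochhammer symbol `(p; p)_n`. -/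
def qPochhammer (p : ℝ) (n : ℕ) : ℝ := ∏ i ∈ Finset.range n, (1 - p ^ (i + 1))

/-- The Gaussian binomial coefficients with base `p`. -/
def gaussBinom (p : ℝ) : ℕ → ℕ → ℝ
  | _, 0 => 1
  | 0, _ + 1 => 0
  | n + 1, k + 1 => gaussBinom p n k + p ^ (k + 1) * gaussBinom p n (k + 1)

lemma gaussBinom_zero_right (p : ℝ) (n : ℕ) : gaussBinom p n 0 = 1 := by
  cases n <;> rfl

lemma gaussBinom_eq_zero (p : ℝ) {n k : ℕ} (h : n < k) : gaussBinom p n k = 0 := by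
  induction n generalizing k with
  | zero => obtain ⟨k, rfl⟩ := Nat.exists_eq_succ_of_ne_zero h.ne'; rfl
  | succ n ih =>
    obtain ⟨k, rfl⟩ := Nat.exists_eq_succ_of_ne_zero (Nat.ne_zero_of_lt h)
    rw [gaussBinom, ih (by omega), ih (by omega)]
    ring

lemma qPochhammer_succ (p : ℝ) (n : ℕ) :
    qPochhammer p (n + 1) = qPochhammer p n * (1 - p ^ (n + 1)) := Finset.prod_range_succ _ _

lemma gaussBinom_self (p : ℝ) (n : ℕ) : gaussBinom p n n = 1 := by
  induction n with
  | zero => rfl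
  | succ n ih => rw [gaussBinom, ih, gaussBinom_eq_zero p (Nat.lt_succ_self n)]; ring

/-- Pascal's rule reduces the induction to 1 − p^{n+1} = (1 − p^{k+1}) + p^{k+1}(1 − p^{m+1}) with n
+ 1 = (k+1) + (m+1). The form without division is valid for every `p`. -/
lemma gaussBinom_mul_qPochhammer (p : ℝ) (n k m : ℕ) (h : n = k + m) :
    gaussBinom p n k * qPochhammer p k * qPochhammer p m = qPochhammer p n := by
  induction n generalizing k m with
  | zero =>
    obtain ⟨rfl, rfl⟩ : k = 0 ∧ m = 0 := by omega
    simp [gaussBinom_zero_right, qPochhammer]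
  | succ n ih =>
    rcases k with _ | k
    · obtain rfl : m = n + 1 := by omega
      simp [gaussBinom_zero_right, qPochhammer]
    rcases m with _ | m
    · obtain rfl : n = k := by omega
      simp [gaussBinom_self, qPochhammer]
    have h1 := ih k (m + 1) (by omega)
    have h2 := ih (k + 1) m (by omega)
    rw [gaussBinom, qPochhammer_succ p n]
    have e : p ^ (n + 1) = p ^ (k + 1) * p ^ (m + 1) := by rw [← pow_add, h]
    rw [e]
    rw [qPochhammer_succ p m] at h1 ⊢
    rw [qPochhammer_succ p k] at h2 ⊢
    linear_combination (1 - p ^ (k + 1)) * h1 + p ^ (k + 1) * (1 - p ^ (m + 1)) * h2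

/-- The `q`-binomial theorem. -/
lemma prod_one_add_mul_pow (p : ℝ) (n : ℕ) (x : ℂ) :
    ∏ i ∈ Finset.range n, (1 + x * (p : ℂ) ^ i)
      = ∑ k ∈ Finset.range (n + 1), (p : ℂ) ^ (k.choose 2) * (gaussBinom p n k : ℂ) * x ^ k := by
  induction n generalizing x with
  | zero => simp [gaussBinom_zero_right]
  | succ n ih =>
    -- Once the factor i = 0 is split off, what remains is the product for `x * p`.
    have h1 : ∏ i ∈ Finset.range n, (1 + x * (p : ℂ) ^ (i + 1))
        = ∏ i ∈ Finset.range n, (1 + (x * p) * (p : ℂ) ^ i) :=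
      Finset.prod_congr rfl fun i _ => by ring
    rw [Finset.prod_range_succ', h1, ih, Finset.sum_range_succ' _ (n + 1)]
    have h2 : ∀ k ∈ Finset.range (n + 1),
        (p : ℂ) ^ ((k + 1).choose 2) * (gaussBinom p (n + 1) (k + 1) : ℂ) * x ^ (k + 1)
          = (p : ℂ) ^ (k.choose 2) * (gaussBinom p n k : ℂ) * (x * p) ^ k * x
            + (p : ℂ) ^ ((k + 1).choose 2) * (gaussBinom p n (k + 1) : ℂ) * (x * p) ^ (k + 1) := by
      intro k _
      rw [gaussBinom, Nat.choose_succ_succ' k 1, Nat.choose_one_right]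
      push_cast
      ring
    rw [Finset.sum_congr rfl h2, Finset.sum_add_distrib, ← Finset.sum_mul, add_assoc]
    have h3 := Finset.sum_range_succ'
      (fun k => (p : ℂ) ^ (k.choose 2) * (gaussBinom p n k : ℂ) * (x * p) ^ k) (n + 1)
    rw [Finset.sum_range_succ, gaussBinom_eq_zero p (Nat.lt_succ_self n)] at h3
    simp only [gaussBinom_zero_right, Nat.choose_zero_succ, pow_zero, ofReal_one, mul_one,
      ofReal_zero, mul_zero, zero_mul, add_zero] at h3 ⊢
    rw [← h3]
    ring

/-- The finite form of the Jacobi triple product. -/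
lemma prod_mul_prod_eq_sum {q : ℝ} (hq : q ≠ 0) (n : ℕ) {z : ℂ} (hz : z ≠ 0) :
    (∏ i ∈ Finset.range n, (1 + (q : ℂ) ^ (2 * i + 1) * z))
        * ∏ i ∈ Finset.range n, (1 + (q : ℂ) ^ (2 * i + 1) * z⁻¹)
      = ∑ k ∈ Finset.range (2 * n + 1), (q : ℂ) ^ (((k : ℤ) - n) ^ 2)
          * (gaussBinom (q ^ 2) (2 * n) k : ℂ) * z ^ ((k : ℤ) - n) := by
  have hq' : (q : ℂ) ≠ 0 := by exact_mod_cast hq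
  -- With x = z q^{1−2n} the 2n factors carry the odd exponents 1−2n, …, 2n−1 of q. The first n,
  -- after extraction of z^n q^{−n²} in all, form the product in z⁻¹; the last n form the product in
  -- z.
  have h := prod_one_add_mul_pow (q ^ 2) (2 * n) (z * (q : ℂ) ^ (1 - 2 * (n : ℤ)))
  have hr : ∏ i ∈ Finset.range n, (1 + z * (q : ℂ) ^ (1 - 2 * (n : ℤ)) * ((q ^ 2 : ℝ) : ℂ) ^ i)
      = z ^ n * (q : ℂ) ^ (-(n : ℤ) ^ 2) * ∏ i ∈ Finset.range n, (1 + (q : ℂ) ^ (2 * i + 1) * z⁻¹) := by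
    rw [← Finset.prod_range_reflect]
    have : ∀ m : ℕ, ∏ i ∈ Finset.range m, (z * (q : ℂ) ^ (-(2 * (i : ℤ) + 1)))
        = z ^ m * (q : ℂ) ^ (-(m : ℤ) ^ 2) := by
      intro m
      induction m with
      | zero => simp
      | succ m ih =>
        rw [Finset.prod_range_succ, ih, show -((m + 1 : ℕ) : ℤ) ^ 2 = -(m : ℤ) ^ 2
          + -(2 * (m : ℤ) + 1) by push_cast; ring, zpow_add₀ hq']
        ring
    rw [← this, ← Finset.prod_mul_distrib]
    refine Finset.prod_congr rfl fun i hi => ?_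
    have hi' : i < n := Finset.mem_range.1 hi
    have e1 : (q : ℂ) ^ (1 - 2 * (n : ℤ)) * ((q ^ 2 : ℝ) : ℂ) ^ (n - 1 - i)
        = (q : ℂ) ^ (-(2 * (i : ℤ) + 1)) := by
      push_cast
      rw [← pow_mul, ← zpow_natCast, ← zpow_add₀ hq']
      congr 1
      have : ((2 * (n - 1 - i) : ℕ) : ℤ) = 2 * (n - 1 - i) := by omega
      rw [this]; ring
    rw [mul_assoc, e1, mul_add, mul_one]
    have e2 : (q : ℂ) ^ (-(2 * (i : ℤ) + 1)) * (q : ℂ) ^ (2 * i + 1) = 1 := by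
      rw [← zpow_natCast, ← zpow_add₀ hq']
      push_cast
      simp
    rw [show z * (q : ℂ) ^ (-(2 * (i : ℤ) + 1)) * ((q : ℂ) ^ (2 * i + 1) * z⁻¹)
      = (z * z⁻¹) * ((q : ℂ) ^ (-(2 * (i : ℤ) + 1)) * (q : ℂ) ^ (2 * i + 1)) by ring, e2,
      mul_inv_cancel₀ hz]
    ring
  have hl : ∏ i ∈ Finset.range n, (1 + z * (q : ℂ) ^ (1 - 2 * (n : ℤ)) * ((q ^ 2 : ℝ) : ℂ) ^ (n + i))
      = ∏ i ∈ Finset.range n, (1 + (q : ℂ) ^ (2 * i + 1) * z) := by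
    refine Finset.prod_congr rfl fun i _ => ?_
    push_cast
    rw [mul_assoc, ← pow_mul, ← zpow_natCast _ (2 * (n + i)), ← zpow_add₀ hq', mul_comm z,
      ← zpow_natCast]
    congr 3
    push_cast; ring
  have hs := h
  rw [two_mul n, Finset.prod_range_add, hr, hl, ← two_mul] at hs
  have hne : z ^ n * (q : ℂ) ^ (-(n : ℤ) ^ 2) ≠ 0 :=
    mul_ne_zero (pow_ne_zero _ hz) (zpow_ne_zero _ hq')
  apply mul_left_cancel₀ hne
  rw [Finset.mul_sum]
  refine Eq.trans (by ring) (hs.trans (Finset.sum_congr rfl fun k _ => ?_))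
  have e3 : ((q ^ 2 : ℝ) : ℂ) ^ (k.choose 2) * ((q : ℂ) ^ (1 - 2 * (n : ℤ))) ^ k
      = (q : ℂ) ^ (-(n : ℤ) ^ 2) * (q : ℂ) ^ (((k : ℤ) - n) ^ 2) := by
    push_cast
    rw [← pow_mul, ← zpow_natCast, ← zpow_natCast, ← zpow_mul, ← zpow_add₀ hq', ← zpow_add₀ hq']
    congr 1
    have : ((2 * k.choose 2 : ℕ) : ℤ) = k * (k - 1) := by
      have h5 := Nat.triangle_succ (k - 1)
      rcases k with _ | k
      · simp
      · have := Nat.choose_two_right (k + 1)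
        have h6 : 2 ∣ (k + 1) * (k + 1 - 1) := (Nat.even_mul_pred_self (k + 1)).two_dvd
        have h7 : 2 * (k + 1).choose 2 = (k + 1) * k := by
          rw [this, Nat.mul_div_cancel' h6]; simp
        rw [h7]; push_cast; ring
    rw [this]; ring
  have e4 : z ^ k = z ^ n * z ^ ((k : ℤ) - n) := by
    rw [← zpow_natCast, ← zpow_natCast, ← zpow_add₀ hz]; congr 1; ring
  rw [mul_pow, e4]
  linear_combination ((gaussBinom (q ^ 2) (2 * n) k : ℂ) * (z ^ n * z ^ ((k : ℤ) - n))) * e3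


lemma summable_pow_two_mul_add_one {q : ℝ} (h0 : 0 < q) (h1 : q < 1) (z : ℂ) :
    Summable fun n : ℕ => ‖(q : ℂ) ^ (2 * n + 1) * z‖ := by
  have h : Summable fun n : ℕ => (q ^ 2) ^ n * (q * ‖z‖) :=
    (summable_geometric_of_lt_one (by positivity) (by nlinarith)).mul_right _
  refine h.congr fun n => ?_
  rw [norm_mul, norm_pow, norm_real, Real.norm_of_nonneg h0.le]
  ring

/-- The partial products decrease, so their limit is also a lower bound; it is positive because Σ
p^i converges. This bound is what dominates the Gaussian binomials when n → ∞. -/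
lemma exists_tendsto_qPochhammer {p : ℝ} (h0 : 0 < p) (h1 : p < 1) :
    ∃ L : ℝ, 0 < L ∧ (∀ n, L ≤ qPochhammer p n) ∧
      Filter.Tendsto (qPochhammer p) Filter.atTop (𝓝 L) := by
  have hpow : ∀ i : ℕ, p ^ (i + 1) < 1 := fun i => pow_lt_one₀ h0.le h1 (by omega)
  have hs : Summable fun i : ℕ => ‖-p ^ (i + 1)‖ := by
    have h : Summable fun n : ℕ => p ^ n * p := (summable_geometric_of_lt_one h0.le h1).mul_right _
    refine h.congr fun n => ?_
    rw [norm_neg, Real.norm_of_nonneg (by positivity), pow_succ]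
  have hm : Multipliable fun i : ℕ => (1 + -p ^ (i + 1)) := multipliable_one_add_of_summable hs
  have ht : Filter.Tendsto (qPochhammer p) Filter.atTop (𝓝 (∏' i : ℕ, (1 + -p ^ (i + 1)))) := by
    refine hm.hasProd.tendsto_prod_nat.congr fun n => ?_
    simp only [qPochhammer, sub_eq_add_neg]
  have hne : ∏' i : ℕ, (1 + -p ^ (i + 1)) ≠ 0 :=
    tprod_one_add_ne_zero_of_summable (fun i => by linarith [hpow i]) hs
  have hpos : ∀ n, 0 < qPochhammer p n := fun n =>
    Finset.prod_pos fun i _ => by linarith [hpow i]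
  have hanti : Antitone (qPochhammer p) := antitone_nat_of_succ_le fun n => by
    rw [qPochhammer_succ]
    exact mul_le_of_le_one_right (hpos n).le (by linarith [pow_pos h0 (n + 1)])
  exact ⟨_, lt_of_le_of_ne (ge_of_tendsto' ht fun n => (hpos n).le) hne.symm,
    fun n => hanti.le_of_tendsto ht n, ht⟩

/-- The Jacobi triple product, with an unspecified positive constant. -/
lemma exists_jacobi_tripleProduct {q : ℝ} (h0 : 0 < q) (h1 : q < 1) :
    ∃ L : ℝ, 0 < L ∧ ∀ z : ℂ, z ≠ 0 → ∀ s : ℂ, HasSum (fun j : ℤ => (q : ℂ) ^ (j ^ 2) * z ^ j) s →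
      s = L * ((∏' n : ℕ, (1 + (q : ℂ) ^ (2 * n + 1) * z))
        * ∏' n : ℕ, (1 + (q : ℂ) ^ (2 * n + 1) * z⁻¹)) := by
  obtain ⟨L, hL, hLle, hLt⟩ := exists_tendsto_qPochhammer (p := q ^ 2) (by positivity) (by nlinarith)
  refine ⟨L, hL, fun z hz s hs => ?_⟩
  have hQpos : ∀ n, 0 < qPochhammer (q ^ 2) n := fun n => hL.trans_le (hLle n)
  have hQle : ∀ n, qPochhammer (q ^ 2) n ≤ 1 := fun n =>
    Finset.prod_le_one (fun i _ => by
      have : (q ^ 2) ^ (i + 1) < 1 := pow_lt_one₀ (by positivity) (by nlinarith) (by omega)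
      linarith) fun i _ => by
        have : 0 < (q ^ 2) ^ (i + 1) := by positivity
        linarith
  -- The coefficients of the finite identity, centred at j = 0 and extended by zero. As ratios of
  -- three Pochhammer symbols they are bounded by 1/L² and tend to L/L² = 1/L, so dominated
  -- convergence applies.
  set c : ℕ → ℤ → ℂ := fun n j =>
    if j ∈ Finset.Icc (-(n : ℤ)) n then (gaussBinom (q ^ 2) (2 * n) (j + n).toNat : ℂ) else 0 with hc
  have hcval : ∀ (n : ℕ) (j : ℤ), j ∈ Finset.Icc (-(n : ℤ)) n → c n j =
      ((qPochhammer (q ^ 2) (2 * n) / (qPochhammer (q ^ 2) (j + n).toNat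
        * qPochhammer (q ^ 2) (n - j).toNat) : ℝ) : ℂ) := by
    intro n j hj
    simp only [hc, if_pos hj]
    congr 1
    rw [Finset.mem_Icc] at hj
    rw [eq_div_iff (mul_pos (hQpos _) (hQpos _)).ne', ← mul_assoc]
    exact gaussBinom_mul_qPochhammer _ _ _ _ (by omega)
  have hbound : ∀ n j, ‖c n j‖ ≤ 1 / (L * L) := by
    intro n j
    by_cases hj : j ∈ Finset.Icc (-(n : ℤ)) n
    · rw [hcval n j hj, norm_real, Real.norm_of_nonneg (div_pos (hQpos _)
        (mul_pos (hQpos _) (hQpos _))).le]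
      exact div_le_div₀ zero_le_one (hQle _) (mul_pos hL hL)
        (mul_le_mul (hLle _) (hLle _) hL.le (hQpos _).le)
    · simp only [hc, if_neg hj, norm_zero]
      positivity
  have hlim : ∀ j : ℤ, Filter.Tendsto (fun n => c n j) Filter.atTop (𝓝 ((1 / L : ℝ) : ℂ)) := by
    intro j
    have t1 : Filter.Tendsto (fun n : ℕ => 2 * n) Filter.atTop Filter.atTop :=
      Filter.tendsto_atTop_mono (fun n => (by omega : n ≤ 2 * n)) Filter.tendsto_id
    have t2 : Filter.Tendsto (fun n : ℕ => (j + n).toNat) Filter.atTop Filter.atTop :=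
      Filter.tendsto_atTop.2 fun b => Filter.eventually_atTop.2 ⟨b + j.natAbs, fun n hn => by omega⟩
    have t3 : Filter.Tendsto (fun n : ℕ => ((n : ℤ) - j).toNat) Filter.atTop Filter.atTop :=
      Filter.tendsto_atTop.2 fun b => Filter.eventually_atTop.2 ⟨b + j.natAbs, fun n hn => by omega⟩
    have t := (hLt.comp t1).div ((hLt.comp t2).mul (hLt.comp t3)) (mul_pos hL hL).ne'
    rw [show L / (L * L) = 1 / L by field_simp] at t
    refine ((continuous_ofReal.tendsto _).comp t).congr' ?_
    filter_upwards [Filter.eventually_ge_atTop j.natAbs] with n hn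
    rw [hcval n j (by rw [Finset.mem_Icc]; omega)]
    rfl
  have hfin : ∀ n : ℕ, (∏ i ∈ Finset.range n, (1 + (q : ℂ) ^ (2 * i + 1) * z))
        * ∏ i ∈ Finset.range n, (1 + (q : ℂ) ^ (2 * i + 1) * z⁻¹)
      = ∑' j : ℤ, c n j * ((q : ℂ) ^ (j ^ 2) * z ^ j) := by
    intro n
    rw [prod_mul_prod_eq_sum h0.ne' n hz, tsum_eq_sum (s := Finset.Icc (-(n : ℤ)) n)
      fun j hj => by simp only [hc, if_neg hj, zero_mul]]
    refine Finset.sum_bij (fun k _ => (k : ℤ) - n) ?_ ?_ ?_ ?_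
    · intro k hk
      rw [Finset.mem_range] at hk
      rw [Finset.mem_Icc]; omega
    · intro a _ b _ hab
      simpa using hab
    · intro j hj
      rw [Finset.mem_Icc] at hj
      exact ⟨(j + n).toNat, by rw [Finset.mem_range]; omega, by omega⟩
    · intro k hk
      rw [Finset.mem_range] at hk
      simp only [hc]
      rw [if_pos (by rw [Finset.mem_Icc]; omega)]
      simp only [sub_add_cancel, Int.toNat_natCast]
      ring
  have hR : Filter.Tendsto (fun n => ∑' j : ℤ, c n j * ((q : ℂ) ^ (j ^ 2) * z ^ j)) Filter.atTop
      (𝓝 (∑' j : ℤ, ((1 / L : ℝ) : ℂ) * ((q : ℂ) ^ (j ^ 2) * z ^ j))) := by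
    refine tendsto_tsum_of_dominated_convergence (hs.summable.norm.mul_left (1 / (L * L)))
      (fun j => (hlim j).mul_const _) (Filter.Eventually.of_forall fun n j => ?_)
    rw [norm_mul]
    exact mul_le_mul_of_nonneg_right (hbound n j) (norm_nonneg _)
  have hP : ∀ y : ℂ, Filter.Tendsto (fun n => ∏ i ∈ Finset.range n, (1 + (q : ℂ) ^ (2 * i + 1) * y))
      Filter.atTop (𝓝 (∏' i : ℕ, (1 + (q : ℂ) ^ (2 * i + 1) * y))) := fun y =>
    (multipliable_one_add_of_summable
      (summable_pow_two_mul_add_one h0 h1 y)).hasProd.tendsto_prod_nat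
  have hE := tendsto_nhds_unique (((hP z).mul (hP z⁻¹)).congr hfin) hR
  rw [hE, tsum_mul_left, hs.tsum_eq, ← mul_assoc, ← ofReal_mul, mul_one_div_cancel hL.ne',
    ofReal_one, one_mul]

/-- The product formula for `ϑ₃`. -/
lemma exists_vth3_eq_prod {T : ℝ} (hT : 0 < T) :
    ∃ L : ℝ, 0 < L ∧ ∀ w : ℂ, vth3 T w =
      L * ((∏' n : ℕ, (1 + (Real.exp (-T) : ℂ) ^ (2 * n + 1) * exp (2 * I * w)))
        * ∏' n : ℕ, (1 + (Real.exp (-T) : ℂ) ^ (2 * n + 1) * exp (-(2 * I * w)))) := by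
  obtain ⟨L, hL, h⟩ := exists_jacobi_tripleProduct (Real.exp_pos (-T))
    (Real.exp_lt_one_iff.2 (by linarith))
  refine ⟨L, hL, fun w => ?_⟩
  rw [exp_neg]
  refine h _ (exp_ne_zero _) _ ((hasSum_vth3 hT w).congr_fun fun n => ?_)
  rw [ofReal_exp, ← exp_int_mul, ← exp_int_mul, ← exp_add]
  congr 1
  push_cast
  ring

lemma vth1_add_pi_div_two (T : ℝ) (w : ℂ) : vth1 T (w + Real.pi / 2) = vth2 T w := by
  rw [vth1, add_sub_cancel_right]

lemma vth4_sub_pi_div_two (T : ℝ) (w : ℂ) : vth4 T (w - Real.pi / 2) = vth3 T w := by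
  rw [vth4, sub_add_cancel]

/-! ### Zeros -/

/-- An absolutely convergent product vanishes only if one of its factors does. -/
lemma exists_of_vth3_eq_zero {T : ℝ} (hT : 0 < T) {w : ℂ} (h : vth3 T w = 0) :
    ∃ n : ℕ, 1 + (Real.exp (-T) : ℂ) ^ (2 * n + 1) * exp (2 * I * w) = 0 ∨
      1 + (Real.exp (-T) : ℂ) ^ (2 * n + 1) * exp (-(2 * I * w)) = 0 := by
  by_contra! hne
  obtain ⟨L, hL, hp⟩ := exists_vth3_eq_prod hT
  have h1 : Real.exp (-T) < 1 := Real.exp_lt_one_iff.2 (by linarith)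
  refine mul_ne_zero (ofReal_ne_zero.2 hL.ne') (mul_ne_zero ?_ ?_) ((hp w).symm.trans h)
  · exact tprod_one_add_ne_zero_of_summable (fun n => (hne n).1)
      (summable_pow_two_mul_add_one (Real.exp_pos _) h1 _)
  · exact tprod_one_add_ne_zero_of_summable (fun n => (hne n).2)
      (summable_pow_two_mul_add_one (Real.exp_pos _) h1 _)

lemma exp_pow_mul_exp (T : ℝ) (n : ℕ) (w : ℂ) :
    (Real.exp (-T) : ℂ) ^ n * exp w = exp (-(n * T) + w) := by
  rw [ofReal_exp, ← exp_nat_mul, ← exp_add]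
  congr 1; push_cast; ring

/-- A vanishing factor forces an exponential to have modulus 1. The first product would need Im w =
−(n+1)T and the second Im w = nT, so only n = 0 in the second survives, and its zeros are the
multiples of π. -/
lemma eq_int_mul_pi_of_vth1_eq_zero {T : ℝ} (hT : 0 < T) {w : ℂ} (hw : |w.im| < T)
    (h : vth1 T w = 0) : ∃ k : ℤ, w = k * Real.pi := by
  rw [vth1, vth2] at h
  rcases mul_eq_zero.1 h with h | h
  · exact absurd h (exp_ne_zero _)
  obtain ⟨hl, hr⟩ := abs_lt.1 hw
  obtain ⟨n, hn | hn⟩ := exists_of_vth3_eq_zero hT h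
  · exfalso
    rw [exp_pow_mul_exp] at hn
    have hn' := congrArg norm (eq_neg_of_add_eq_zero_right hn)
    rw [norm_exp, norm_neg, norm_one, Real.exp_eq_one_iff] at hn'
    have e : (-((2 * n + 1 : ℕ) * T) + 2 * I * (w - Real.pi / 2 + I * T / 2) : ℂ)
      = ((-((2 * n + 2) * T) : ℝ) : ℂ) + 2 * I * (w - (Real.pi / 2 : ℝ)) := by
      push_cast; linear_combination (T : ℂ) * I_sq
    rw [e] at hn'
    simp only [add_re, ofReal_re, mul_re, I_re, I_im, sub_re, sub_im, ofReal_im, re_ofNat,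
      im_ofNat, mul_im] at hn'
    have : 0 ≤ (n : ℝ) * T := by positivity
    nlinarith
  · rw [exp_pow_mul_exp] at hn
    have e : (-((2 * n + 1 : ℕ) * T) + -(2 * I * (w - Real.pi / 2 + I * T / 2)) : ℂ)
      = (((-(2 * n * T) : ℝ) : ℂ) - 2 * I * w) + Real.pi * I := by
      push_cast; linear_combination (-T : ℂ) * I_sq
    rw [e, exp_add, exp_pi_mul_I] at hn
    have hn1 : exp (((-(2 * n * T) : ℝ) : ℂ) - 2 * I * w) = 1 := by linear_combination -hn
    have hn' := congrArg norm hn1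
    rw [norm_exp, norm_one, Real.exp_eq_one_iff] at hn'
    simp only [sub_re, ofReal_re, mul_re, I_re, I_im, re_ofNat, im_ofNat, mul_im] at hn'
    have hn0 : n = 0 := by
      by_contra h0
      have : (1 : ℝ) ≤ n := by exact_mod_cast Nat.one_le_iff_ne_zero.2 h0
      nlinarith
    subst hn0
    rw [exp_eq_one_iff] at hn1
    obtain ⟨k, hk⟩ := hn1
    refine ⟨-k, ?_⟩
    have h2 : (2 * I : ℂ) ≠ 0 := mul_ne_zero two_ne_zero I_ne_zero
    apply mul_left_cancel₀ h2
    push_cast at hk ⊢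
    linear_combination -hk

lemma vth1_int_mul_pi (T : ℝ) (k : ℤ) : vth1 T (k * Real.pi) = 0 := by
  have h := Function.Antiperiodic.add_int_mul_eq (f := vth1 T) (c := (Real.pi : ℂ)) (x := 0)
    (fun w => vth1_add_pi T w) k
  rw [zero_add] at h
  rw [h, vth1_zero, mul_zero]

lemma vth4_ne_zero {T : ℝ} (hT : 0 < T) {w : ℂ} (hw : |w.im| < T / 2) : vth4 T w ≠ 0 := by
  intro h
  obtain ⟨hl, hr⟩ := abs_lt.1 hw
  have hs := vth1_add_half T w
  rw [h, mul_zero] at hs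
  have him : (w + I * T / 2).im = w.im + T / 2 := by
    rw [show w + I * T / 2 = w + I * ((T / 2 : ℝ) : ℂ) by push_cast; ring]
    simp
  obtain ⟨k, hk⟩ := eq_int_mul_pi_of_vth1_eq_zero hT (abs_lt.2 ⟨by linarith, by linarith⟩) hs
  have := congrArg im hk
  rw [him] at this
  simp at this
  linarith

lemma vth3_ne_zero {T : ℝ} (hT : 0 < T) {w : ℂ} (hw : |w.im| < T / 2) : vth3 T w ≠ 0 := by
  rw [← vth4_sub_pi_div_two]
  refine vth4_ne_zero hT ?_
  rwa [show w - (Real.pi : ℂ) / 2 = w - ((Real.pi / 2 : ℝ) : ℂ) by push_cast; ring, sub_im,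
    ofReal_im, sub_zero]

lemma vth2_ne_zero {T : ℝ} (hT : 0 < T) {w : ℂ} (hw : |w.im| < T) (hr : |w.re| < Real.pi / 2) :
    vth2 T w ≠ 0 := by
  intro h
  rw [← vth1_add_pi_div_two, show w + (Real.pi : ℂ) / 2 = w + ((Real.pi / 2 : ℝ) : ℂ) by
    push_cast; ring] at h
  obtain ⟨k, hk⟩ := eq_int_mul_pi_of_vth1_eq_zero hT (by simpa using hw) h
  have h2 := congrArg re hk
  simp at h2
  obtain ⟨hr1, hr2⟩ := abs_lt.1 hr
  have hpi := Real.pi_pos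
  have h3 : (0 : ℝ) < k := by by_contra! h; nlinarith
  have h4 : (k : ℝ) < 1 := by by_contra! h; nlinarith
  have h5 : 0 < k := by exact_mod_cast h3
  have h6 : k < 1 := by exact_mod_cast h4
  omega

lemma vth1_ne_zero {T : ℝ} (hT : 0 < T) {w : ℂ} (hw : |w.im| < T) (h0 : 0 < w.re)
    (h1 : w.re < Real.pi) : vth1 T w ≠ 0 := by
  rw [vth1, show w - (Real.pi : ℂ) / 2 = w - ((Real.pi / 2 : ℝ) : ℂ) by push_cast; ring]
  exact vth2_ne_zero hT (by simpa using hw) (by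
    rw [sub_re, ofReal_re, abs_lt]; constructor <;> linarith)

/-! ### Addition formulas -/

lemma two_mul_add_half (T : ℝ) (w : ℂ) :
    2 * (w + I * T / 2) = 2 * w + I * ((2 * T : ℝ) : ℂ) / 2 := by push_cast; ring

lemma vth4_mul_vth4 {T : ℝ} (hT : 0 < T) (x y : ℂ) :
    vth4 T (x + y) * vth4 T (x - y) = vth3 (2 * T) (2 * x) * vth3 (2 * T) (2 * y)
      - vth2 (2 * T) (2 * x) * vth2 (2 * T) (2 * y) := by
  have h := vth3_mul_vth3 hT (x + Real.pi / 2) y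
  rw [show 2 * (x + (Real.pi : ℂ) / 2) = 2 * x + Real.pi by ring, vth3_add_pi, vth2_add_pi] at h
  rw [vth4, vth4]
  convert h using 1 <;> ring_nf

lemma vth2_mul_vth2 {T : ℝ} (hT : 0 < T) (x y : ℂ) :
    vth2 T (x + y) * vth2 T (x - y) = vth2 (2 * T) (2 * x) * vth3 (2 * T) (2 * y)
      + vth3 (2 * T) (2 * x) * vth2 (2 * T) (2 * y) := by
  have h := vth3_mul_vth3 hT (x + I * T / 2) y
  rw [two_mul_add_half, vth3_add_half, vth2_add_half] at h
  have e : exp (-(T : ℂ) / 4 + I * (x + y)) * exp (-(T : ℂ) / 4 + I * (x - y))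
      * exp (((2 * T : ℝ) : ℂ) / 4 - I * (2 * x)) = 1 := by
    rw [← exp_add, ← exp_add, exp_eq_one_iff]
    exact ⟨0, by push_cast; ring⟩
  rw [vth2, vth2, show x + y + I * T / 2 = x + I * T / 2 + y by ring,
    show x - y + I * T / 2 = x + I * T / 2 - y by ring]
  linear_combination exp (-(T : ℂ) / 4 + I * (x + y)) * exp (-(T : ℂ) / 4 + I * (x - y)) * h
    + (vth2 (2 * T) (2 * x) * vth3 (2 * T) (2 * y)
      + vth3 (2 * T) (2 * x) * vth2 (2 * T) (2 * y)) * e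

lemma vth1_mul_vth1 {T : ℝ} (hT : 0 < T) (x y : ℂ) :
    vth1 T (x + y) * vth1 T (x - y) = vth3 (2 * T) (2 * x) * vth2 (2 * T) (2 * y)
      - vth2 (2 * T) (2 * x) * vth3 (2 * T) (2 * y) := by
  have h := vth2_mul_vth2 hT (x - Real.pi / 2) y
  rw [show 2 * (x - (Real.pi : ℂ) / 2) = 2 * x - Real.pi by ring, vth3_sub_pi, vth2_sub_pi] at h
  rw [vth1, vth1]
  convert h using 1 <;> ring_nf

/-- Every product here, squares included (take y = 0), is bilinear in ϑ₂ and ϑ₃ of parameter 2T at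
doubled arguments, so the claim is a polynomial identity. The same elimination proves the next three
lemmas. -/
lemma vth4_addition {T : ℝ} (hT : 0 < T) (x y : ℂ) :
    vth4 T (x + y) * vth4 T (x - y) * vth4 T 0 ^ 2
      = vth4 T x ^ 2 * vth4 T y ^ 2 - vth1 T x ^ 2 * vth1 T y ^ 2 := by
  have h1 := vth4_mul_vth4 hT x y
  have h2 := vth4_mul_vth4 hT x 0
  have h3 := vth4_mul_vth4 hT y 0
  have h4 := vth4_mul_vth4 hT 0 0
  have h5 := vth1_mul_vth1 hT x 0
  have h6 := vth1_mul_vth1 hT y 0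
  simp only [add_zero, sub_zero, mul_zero] at h2 h3 h4 h5 h6
  rw [sq, sq, sq, sq, sq, h1, h2, h3, h4, h5, h6]
  ring

lemma vth1_addition {T : ℝ} (hT : 0 < T) (x y : ℂ) :
    vth1 T (x + y) * vth1 T (x - y) * vth4 T 0 ^ 2
      = vth1 T x ^ 2 * vth4 T y ^ 2 - vth4 T x ^ 2 * vth1 T y ^ 2 := by
  have h1 := vth1_mul_vth1 hT x y
  have h2 := vth4_mul_vth4 hT x 0
  have h3 := vth4_mul_vth4 hT y 0
  have h4 := vth4_mul_vth4 hT 0 0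
  have h5 := vth1_mul_vth1 hT x 0
  have h6 := vth1_mul_vth1 hT y 0
  simp only [add_zero, sub_zero, mul_zero] at h2 h3 h4 h5 h6
  rw [sq, sq, sq, sq, sq, h1, h2, h3, h4, h5, h6]
  ring

lemma vth3_sq_mul_vth1_sq {T : ℝ} (hT : 0 < T) (x : ℂ) :
    vth3 T 0 ^ 2 * vth1 T x ^ 2 + vth4 T 0 ^ 2 * vth2 T x ^ 2 = vth2 T 0 ^ 2 * vth4 T x ^ 2 := by
  have h1 := vth3_mul_vth3 hT 0 0
  have h2 := vth1_mul_vth1 hT x 0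
  have h3 := vth4_mul_vth4 hT 0 0
  have h4 := vth2_mul_vth2 hT x 0
  have h5 := vth2_mul_vth2 hT 0 0
  have h6 := vth4_mul_vth4 hT x 0
  simp only [add_zero, sub_zero, mul_zero] at h1 h2 h3 h4 h5 h6
  rw [sq, sq, sq, sq, sq, sq, h1, h2, h3, h4, h5, h6]
  ring

lemma vth4_sq_mul_vth3_sq {T : ℝ} (hT : 0 < T) (x : ℂ) :
    vth4 T 0 ^ 2 * vth3 T x ^ 2 + vth2 T 0 ^ 2 * vth1 T x ^ 2 = vth3 T 0 ^ 2 * vth4 T x ^ 2 := by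
  have h1 := vth3_mul_vth3 hT x 0
  have h2 := vth1_mul_vth1 hT x 0
  have h3 := vth4_mul_vth4 hT 0 0
  have h4 := vth3_mul_vth3 hT 0 0
  have h5 := vth2_mul_vth2 hT 0 0
  have h6 := vth4_mul_vth4 hT x 0
  simp only [add_zero, sub_zero, mul_zero] at h1 h2 h3 h4 h5 h6
  rw [sq, sq, sq, sq, sq, sq, h1, h2, h3, h4, h5, h6]
  ring

/-! ### Mixed products and Landen's transformation -/

/-- The sum of the terms of `ϑ₂(x; e^{-T/2})` of even index. -/
def vthQuarter (T : ℝ) (x : ℂ) : ℂ := exp (-T / 8 + I * x) * vth3 (2 * T) (2 * x + I * T / 2)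

lemma vthQuarter_neg (T : ℝ) (x : ℂ) :
    vthQuarter T (-x) = exp (-T / 8 + I * x) * vth2 (2 * T) (2 * x + I * T / 2) := by
  rw [vthQuarter, vth2, show 2 * x + I * T / 2 + I * ((2 * T : ℝ) : ℂ) / 2
    = (2 * x - I * T / 2) + I * ((2 * T : ℝ) : ℂ) by push_cast; ring, vth3_add_I_mul, ← mul_assoc,
    ← mul_assoc, ← exp_add, ← exp_add, ← vth3_neg]
  congr 2
  · push_cast
    linear_combination (-(3 / 2 : ℂ) * T) * I_sq
  · ring

/-- Moving both `x` and `y` by iT/4 turns ϑ₃(x+y) into ϑ₂(x+y), up to an exponential, and leaves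
ϑ₃(x−y) alone; the addition theorem for ϑ₃ does the rest. -/
lemma vth2_mul_vth3 {T : ℝ} (hT : 0 < T) (x y : ℂ) :
    vth2 T (x + y) * vth3 T (x - y)
      = vthQuarter T x * vthQuarter T y + vthQuarter T (-x) * vthQuarter T (-y) := by
  have h := vth3_mul_vth3 hT (x + I * T / 4) (y + I * T / 4)
  rw [vthQuarter_neg, vthQuarter_neg, vthQuarter, vthQuarter, vth2]
  rw [show 2 * (x + I * T / 4) = 2 * x + I * T / 2 by ring,
    show 2 * (y + I * T / 4) = 2 * y + I * T / 2 by ring,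
    show x + I * T / 4 + (y + I * T / 4) = x + y + I * T / 2 by ring,
    show x + I * T / 4 - (y + I * T / 4) = x - y by ring] at h
  have e : exp (-(T : ℂ) / 4 + I * (x + y)) = exp (-(T : ℂ) / 8 + I * x) * exp (-(T : ℂ) / 8 + I * y) := by
    rw [← exp_add]; congr 1; ring
  rw [e]
  linear_combination exp (-(T : ℂ) / 8 + I * x) * exp (-(T : ℂ) / 8 + I * y) * h

lemma vthQuarter_sub_pi_div_two (T : ℝ) (x : ℂ) :
    vthQuarter T (x - Real.pi / 2) = -I * vthQuarter T x := by
  rw [vthQuarter, vthQuarter, show 2 * (x - (Real.pi : ℂ) / 2) + I * T / 2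
    = 2 * x + I * T / 2 - Real.pi by ring, vth3_sub_pi,
    show -(T : ℂ) / 8 + I * (x - Real.pi / 2) = -T / 8 + I * x + -(I * (Real.pi / 2)) by ring,
    exp_add _ (-(I * _)), exp_neg_I_pi_div_two]
  ring

lemma vthQuarter_neg_sub_pi_div_two (T : ℝ) (x : ℂ) :
    vthQuarter T (-(x - Real.pi / 2)) = I * vthQuarter T (-x) := by
  have h := vthQuarter_sub_pi_div_two T (-x + Real.pi / 2)
  rw [add_sub_cancel_right] at h
  rw [h, show -(x - (Real.pi : ℂ) / 2) = -x + Real.pi / 2 by ring]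
  linear_combination vthQuarter T (-x + Real.pi / 2) * I_sq

lemma vth1_mul_vth4 {T : ℝ} (hT : 0 < T) (x y : ℂ) :
    vth1 T (x + y) * vth4 T (x - y)
      = -I * (vthQuarter T x * vthQuarter T y - vthQuarter T (-x) * vthQuarter T (-y)) := by
  have h := vth2_mul_vth3 hT (x - Real.pi / 2) y
  rw [vthQuarter_sub_pi_div_two, vthQuarter_neg_sub_pi_div_two] at h
  rw [vth1, vth4, ← vth3_sub_pi T (x - y + _),
    show x + y - (Real.pi : ℂ) / 2 = x - Real.pi / 2 + y by ring,
    show x - y + (Real.pi : ℂ) / 2 - Real.pi = x - Real.pi / 2 - y by ring, h]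
  ring

lemma vth2_half_nome {T : ℝ} (hT : 0 < T) (x : ℂ) :
    vth2 (T / 2) x = vthQuarter T x + vthQuarter T (-x) := by
  rw [vthQuarter_neg, vthQuarter, vth2, vth3_half_nome hT]
  push_cast
  rw [show 2 * (x + I * ((T : ℂ) / 2) / 2) = 2 * x + I * T / 2 by ring,
    show -((T : ℂ) / 2) / 4 = -T / 8 by ring]
  ring

lemma vth1_half_nome {T : ℝ} (hT : 0 < T) (x : ℂ) :
    vth1 (T / 2) x = -I * (vthQuarter T x - vthQuarter T (-x)) := by
  rw [vth1, vth2_half_nome hT, vthQuarter_sub_pi_div_two, vthQuarter_neg_sub_pi_div_two]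
  ring

/-- Landen's transformation. -/
lemma vth1_mul_vth4_eq_half_nome {T : ℝ} (hT : 0 < T) (x : ℂ) :
    2 * (vth1 T x * vth4 T x) = vth2 (T / 2) 0 * vth1 (T / 2) x := by
  have h := vth1_mul_vth4 hT x 0
  rw [vth2_half_nome hT, vth1_half_nome hT]
  simp only [add_zero, sub_zero, neg_zero] at h ⊢
  rw [h]
  ring

lemma vth2_half_nome_sq {T : ℝ} (hT : 0 < T) :
    vth2 (T / 2) 0 ^ 2 = 2 * (vth2 T 0 * vth3 T 0) := by
  have h := vth2_mul_vth3 hT 0 0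
  rw [vth2_half_nome hT]
  simp only [add_zero, sub_zero, neg_zero] at h ⊢
  rw [h]
  ring

lemma vth3_mul_vth4_half_nome {T : ℝ} (hT : 0 < T) :
    vth3 (T / 2) 0 * vth4 (T / 2) 0 = vth4 T 0 ^ 2 := by
  have h := vth4_mul_vth4 hT 0 0
  have h3 := vth3_half_nome hT 0
  have h4 := vth3_half_nome hT (0 + Real.pi / 2)
  rw [show 2 * (0 + (Real.pi : ℂ) / 2) = 2 * 0 + Real.pi by ring, vth3_add_pi, vth2_add_pi] at h4
  simp only [add_zero, sub_zero, mul_zero] at h h3 h4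
  rw [sq, h, h3, vth4, h4]
  ring

/-! ### Derivatives -/

lemma deriv_eq_zero_of_even {f : ℂ → ℂ} (hf : ∀ w, f (-w) = f w) : deriv f 0 = 0 := by
  have h := deriv_comp_neg f 0
  rw [show (fun x => f (-x)) = f from funext hf, neg_zero] at h
  exact self_eq_neg.mp h

/-- Differentiated in `y` at 0, this yields the Wronskian of ϑ₁ and ϑ₄ up to the constant ϑ₁'(0). -/
lemma vth1_mul_vth4_mixed {T : ℝ} (hT : 0 < T) (x y : ℂ) :
    vth1 T (x + y) * vth4 T (x - y) * (vth2 T 0 * vth3 T 0)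
      = vth1 T x * vth4 T x * (vth2 T y * vth3 T y) + vth2 T x * vth3 T x * (vth1 T y * vth4 T y) := by
  have h1 := vth1_mul_vth4 hT x y
  have h2 := vth2_mul_vth3 hT 0 0
  have h3 := vth1_mul_vth4 hT x 0
  have h4 := vth2_mul_vth3 hT y 0
  have h5 := vth2_mul_vth3 hT x 0
  have h6 := vth1_mul_vth4 hT y 0
  simp only [add_zero, sub_zero, neg_zero] at h2 h3 h4 h5 h6
  rw [h1, h2, h3, h4, h5, h6]
  ring

lemma wronskian_aux {T : ℝ} (hT : 0 < T) (x : ℂ) :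
    (deriv (vth1 T) x * vth4 T x - vth1 T x * deriv (vth4 T) x) * (vth2 T 0 * vth3 T 0)
      = vth2 T x * vth3 T x * (deriv (vth1 T) 0 * vth4 T 0) := by
  have d1 := fun w => (differentiable_vth1 hT w).hasDerivAt
  have d2 := fun w => (differentiable_vth2 hT w).hasDerivAt
  have d3 := fun w => (differentiable_vth3 hT w).hasDerivAt
  have d4 := fun w => (differentiable_vth4 hT w).hasDerivAt
  have e2 := deriv_eq_zero_of_even (vth2_neg T)
  have e3 := deriv_eq_zero_of_even (vth3_neg T)
  have hl : HasDerivAt (fun y => vth1 T (x + y) * vth4 T (x - y) * (vth2 T 0 * vth3 T 0))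
      ((deriv (vth1 T) x * vth4 T x - vth1 T x * deriv (vth4 T) x) * (vth2 T 0 * vth3 T 0)) 0 := by
    have a1 : HasDerivAt (fun y => vth1 T (x + y)) (deriv (vth1 T) x) 0 := by
      have := (d1 (x + 0)).comp_const_add x 0
      simpa using this
    have a4 : HasDerivAt (fun y => vth4 T (x - y)) (-deriv (vth4 T) x) 0 := by
      have := (d4 (x - 0)).comp_const_sub x 0
      simpa using this
    refine ((a1.mul a4).mul_const (vth2 T 0 * vth3 T 0)).congr_deriv ?_
    simp only [add_zero, sub_zero]
    ring
  have hr := (((d2 0).mul (d3 0)).const_mul (vth1 T x * vth4 T x)).add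
    (((d1 0).mul (d4 0)).const_mul (vth2 T x * vth3 T x))
  have := (hl.congr_of_eventuallyEq (f₁ := fun y => vth1 T x * vth4 T x * (vth2 T y * vth3 T y)
    + vth2 T x * vth3 T x * (vth1 T y * vth4 T y))
    (Filter.Eventually.of_forall fun y => (vth1_mul_vth4_mixed hT x y).symm)).unique hr
  rw [this, e2, e3, vth1_zero]
  ring


/-! ### Jacobi's derivative identity -/

lemma deriv_vth1_half_nome {T : ℝ} (hT : 0 < T) :
    2 * (deriv (vth1 T) 0 * vth4 T 0) = vth2 (T / 2) 0 * deriv (vth1 (T / 2)) 0 := by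
  have d1 := (differentiable_vth1 hT 0).hasDerivAt
  have d4 := (differentiable_vth4 hT 0).hasDerivAt
  have d1' := (differentiable_vth1 (half_pos hT) 0).hasDerivAt
  have hl := ((d1.mul d4).const_mul 2)
  have hr := (d1'.const_mul (vth2 (T / 2) 0)).congr_of_eventuallyEq
    (Filter.Eventually.of_forall fun y => vth1_mul_vth4_eq_half_nome hT y)
  have := hl.unique hr
  rw [vth1_zero] at this
  rw [← this]
  ring

lemma vth2_zero_ne_zero {T : ℝ} (hT : 0 < T) : vth2 T 0 ≠ 0 :=
  vth2_ne_zero hT (by simpa using hT) (by simpa using half_pos Real.pi_pos)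

lemma vth3_zero_ne_zero {T : ℝ} (hT : 0 < T) : vth3 T 0 ≠ 0 :=
  vth3_ne_zero hT (by simpa using hT)

lemma vth4_zero_ne_zero {T : ℝ} (hT : 0 < T) : vth4 T 0 ≠ 0 :=
  vth4_ne_zero hT (by simpa using hT)

/-- The three half-nome identities combine to make the ratio invariant under halving of T. It is
therefore constant along T·2ⁿ and equals its limit 1 as n → ∞. -/
lemma jacobi_ratio_half_nome {T : ℝ} (hT : 0 < T) :
    deriv (vth1 (T / 2)) 0 / (vth2 (T / 2) 0 * vth3 (T / 2) 0 * vth4 (T / 2) 0)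
      = deriv (vth1 T) 0 / (vth2 T 0 * vth3 T 0 * vth4 T 0) := by
  have h1 := deriv_vth1_half_nome hT
  have h2 := vth2_half_nome_sq hT
  have h3 := vth3_mul_vth4_half_nome hT
  have hT2 := half_pos hT
  have n2 := vth2_zero_ne_zero hT
  have n3 := vth3_zero_ne_zero hT
  have n4 := vth4_zero_ne_zero hT
  have m2 := vth2_zero_ne_zero hT2
  have m3 := vth3_zero_ne_zero hT2
  have m4 := vth4_zero_ne_zero hT2
  rw [div_eq_div_iff (by positivity) (by positivity)]
  apply mul_left_cancel₀ m2
  linear_combination (-(vth2 T 0 * vth3 T 0 * vth4 T 0)) * h1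
    - (deriv (vth1 T) 0 * vth3 (T / 2) 0 * vth4 (T / 2) 0) * h2
    - (2 * deriv (vth1 T) 0 * vth2 T 0 * vth3 T 0) * h3

/-- The terms at T = 1 dominate those for T ≥ 1, and only the terms with zero exponent survive. -/
lemma tendsto_tsum_exp_atTop {c : ℤ → ℂ} {e : ℤ → ℝ} (he : ∀ n, 0 ≤ e n)
    (hs : Summable fun n => ‖c n * exp (-1 * e n)‖) :
    Filter.Tendsto (fun T : ℝ => ∑' n, c n * exp (-T * e n)) Filter.atTop
      (𝓝 (∑' n, if e n = 0 then c n else 0)) := by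
  refine tendsto_tsum_of_dominated_convergence hs (fun n => ?_) ?_
  · split_ifs with h
    · simp [h]
    · have hpos : 0 < e n := lt_of_le_of_ne (he n) (Ne.symm h)
      have h1 : Filter.Tendsto (fun T : ℝ => Real.exp (-(T * e n))) Filter.atTop (𝓝 0) :=
        Real.tendsto_exp_neg_atTop_nhds_zero.comp (Filter.tendsto_id.atTop_mul_const hpos)
      have h2 := ((continuous_ofReal.tendsto _).comp h1).const_mul (c n)
      simp only [ofReal_zero, mul_zero] at h2
      refine h2.congr fun T => ?_
      simp
  · filter_upwards [Filter.eventually_ge_atTop 1] with T hT n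
    rw [norm_mul, norm_mul, norm_exp, norm_exp]
    refine mul_le_mul_of_nonneg_left (Real.exp_le_exp.2 ?_) (norm_nonneg _)
    simp only [mul_re, neg_re, ofReal_re, neg_im, ofReal_im, one_re, one_im]
    nlinarith [he n]

lemma tendsto_vth3 (x : ℝ) :
    Filter.Tendsto (fun T : ℝ => vth3 T x) Filter.atTop (𝓝 1) := by
  have hs : Summable fun n : ℤ => ‖exp (2 * I * n * x) * exp (-1 * ((n : ℝ) ^ 2 : ℝ))‖ := by
    refine (hasSum_vth3 one_pos x).summable.norm.congr fun n => ?_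
    rw [← exp_add]; congr 2; push_cast; ring
  have h := tendsto_tsum_exp_atTop (fun n : ℤ => sq_nonneg (n : ℝ)) hs
  rw [tsum_eq_single 0 fun n hn => if_neg (by simpa using hn)] at h
  simp only [Int.cast_zero, ne_eq, OfNat.ofNat_ne_zero, not_false_eq_true, zero_pow, if_true,
    mul_zero, zero_mul, exp_zero] at h
  refine h.congr' ?_
  filter_upwards [Filter.eventually_gt_atTop 0] with T hT
  rw [← (hasSum_vth3 hT x).tsum_eq]
  refine tsum_congr fun n => ?_
  rw [← exp_add]; congr 1; push_cast; ring

lemma tsum_ite_mul_add_one {c : ℤ → ℂ} :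
    (∑' n : ℤ, if ((n : ℝ) * (n + 1)) = 0 then c n else 0) = c 0 + c (-1) := by
  rw [tsum_eq_sum (s := {0, -1})]
  · rw [Finset.sum_pair (by norm_num)]
    norm_num
  · intro n hn
    rw [Finset.mem_insert, Finset.mem_singleton, not_or] at hn
    refine if_neg (mul_ne_zero (by exact_mod_cast hn.1) ?_)
    intro h
    have : (n : ℝ) = -1 := by linarith
    exact hn.2 (by exact_mod_cast this)

lemma int_mul_add_one_nonneg (n : ℤ) : 0 ≤ (n : ℝ) * (n + 1) := by
  have : 0 ≤ n * (n + 1) := by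
    rcases le_or_gt 0 n with h | h
    · positivity
    · nlinarith
  exact_mod_cast this

/-- The factor e^{T/4} replaces the exponent (n+1/2)² by n(n+1), which vanishes exactly for n = 0
and n = −1. Both this limit and the one for ϑ₁'(0) are therefore 1 + 1. -/
lemma tendsto_exp_mul_vth2 :
    Filter.Tendsto (fun T : ℝ => exp (T / 4) * vth2 T 0) Filter.atTop (𝓝 2) := by
  have hs : Summable fun n : ℤ => ‖(1 : ℂ) * exp (-1 * ((n : ℝ) * (n + 1) : ℝ))‖ := by
    refine ((hasSum_vth2 one_pos 0).summable.mul_left (exp (1 / 4))).norm.congr fun n => ?_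
    rw [← exp_add, one_mul]; congr 2; push_cast; ring
  have h := tendsto_tsum_exp_atTop int_mul_add_one_nonneg hs
  rw [tsum_ite_mul_add_one, one_add_one_eq_two] at h
  refine h.congr' ?_
  filter_upwards [Filter.eventually_gt_atTop 0] with T hT
  rw [← (hasSum_vth2 hT 0).tsum_eq, ← tsum_mul_left]
  refine tsum_congr fun n => ?_
  rw [← exp_add, one_mul]; congr 1; push_cast; ring

lemma hasSum_deriv_vth3 {T : ℝ} (hT : 0 < T) (w : ℂ) :
    HasSum (fun n : ℤ => 2 * I * n * exp (-T * n ^ 2 + 2 * I * n * w)) (deriv (vth3 T) w) := by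
  have hpi : (Real.pi : ℂ) ≠ 0 := by exact_mod_cast Real.pi_ne_zero
  have h1 := (hasDerivAt_jacobiTheta₂_fst (w / Real.pi) (im_thetaParameter_pos hT)).comp w
    ((hasDerivAt_id w).div_const (Real.pi : ℂ))
  have h2 : deriv (vth3 T) w = jacobiTheta₂' (w / Real.pi) (I * T / Real.pi) * (1 / Real.pi) :=
    h1.deriv
  rw [h2]
  refine ((hasSum_jacobiTheta₂'_term (w / Real.pi) (im_thetaParameter_pos hT)).mul_right
    (1 / (Real.pi : ℂ))).congr_fun fun n => ?_
  rw [jacobiTheta₂'_term, jacobiTheta₂_term]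
  have e : (2 * Real.pi * I * n * (w / Real.pi) + Real.pi * I * n ^ 2 * (I * T / Real.pi) : ℂ)
      = -T * n ^ 2 + 2 * I * n * w := by
    field_simp
    linear_combination ((n : ℂ) ^ 2 * T) * I_sq
  rw [e]
  field_simp

lemma hasSum_deriv_vth1 {T : ℝ} (hT : 0 < T) :
    HasSum (fun n : ℤ => exp (-T / 4) * ((-1) ^ n * (2 * n + 1) * exp (-T * ((n : ℝ) * (n + 1) : ℝ))))
      (deriv (vth1 T) 0) := by
  set v : ℂ := 0 - Real.pi / 2 + I * T / 2 with hv
  have hd : HasDerivAt (vth1 T) (exp (-T / 4 + I * (0 - Real.pi / 2)) * I * vth3 T v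
      + exp (-T / 4 + I * (0 - Real.pi / 2)) * deriv (vth3 T) v) 0 := by
    have a : HasDerivAt (fun w : ℂ => exp (-T / 4 + I * (w - Real.pi / 2)))
        (exp (-T / 4 + I * (0 - Real.pi / 2)) * I) 0 := by
      have := ((((hasDerivAt_id (0 : ℂ)).sub_const (Real.pi / 2 : ℂ)).const_mul I).const_add
        (-T / 4 : ℂ)).cexp
      simpa using this
    have b : HasDerivAt (fun w : ℂ => vth3 T (w - Real.pi / 2 + I * T / 2)) (deriv (vth3 T) v) 0 := by
      have hin : HasDerivAt (fun w : ℂ => w - Real.pi / 2 + I * T / 2) 1 0 :=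
        ((hasDerivAt_id (0 : ℂ)).sub_const (Real.pi / 2 : ℂ)).add_const (I * T / 2)
      have := (differentiable_vth3 hT v).hasDerivAt.comp (0 : ℂ) hin
      rwa [mul_one] at this
    exact a.mul b
  rw [hd.deriv]
  refine (((hasSum_vth3 hT v).mul_left _).add ((hasSum_deriv_vth3 hT v).mul_left _)).congr_fun
    fun n => ?_
  have e1 : exp (-T / 4 + I * (0 - Real.pi / 2)) = exp (-T / 4) * -I := by
    rw [← exp_neg_I_pi_div_two, ← exp_add]; congr 1; ring
  have e2 : exp (-T * n ^ 2 + 2 * I * n * v) = (-1) ^ n * exp (-T * ((n : ℝ) * (n + 1) : ℝ)) := by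
    have e3 : exp (-(Real.pi * I)) = -1 := by rw [exp_neg, exp_pi_mul_I]; norm_num
    rw [← e3, ← exp_int_mul, ← exp_add, hv]
    congr 1
    push_cast
    linear_combination ((n : ℂ) * T) * I_sq
  rw [e1, e2]
  linear_combination (exp (-T / 4) * (2 * n + 1) * ((-1) ^ n * exp (-T * ((n : ℝ) * (n + 1) : ℝ)))) * I_sq

lemma tendsto_exp_mul_deriv_vth1 :
    Filter.Tendsto (fun T : ℝ => exp (T / 4) * deriv (vth1 T) 0) Filter.atTop (𝓝 2) := by
  have hs : Summable fun n : ℤ => ‖(-1) ^ n * (2 * n + 1) * exp (-1 * ((n : ℝ) * (n + 1) : ℝ))‖ := by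
    have := ((hasSum_deriv_vth1 one_pos).summable.mul_left (exp (1 / 4))).norm
    refine this.congr fun n => ?_
    rw [← mul_assoc (exp _), ← exp_add, show (1 / 4 + -((1 : ℝ) : ℂ) / 4 : ℂ) = 0 by
      push_cast; ring]
    simp
  have h := tendsto_tsum_exp_atTop int_mul_add_one_nonneg hs
  rw [tsum_ite_mul_add_one] at h
  norm_num at h
  refine h.congr' ?_
  filter_upwards [Filter.eventually_gt_atTop 0] with T hT
  rw [← (hasSum_deriv_vth1 hT).tsum_eq, ← tsum_mul_left]
  refine tsum_congr fun n => ?_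
  rw [← mul_assoc (exp _), ← exp_add]
  simp [neg_div]

/-- Jacobi's identity `ϑ₁'(0) = ϑ₂(0) ϑ₃(0) ϑ₄(0)`. -/
theorem deriv_vth1_zero {T : ℝ} (hT : 0 < T) :
    deriv (vth1 T) 0 = vth2 T 0 * vth3 T 0 * vth4 T 0 := by
  set D : ℝ → ℂ := fun T => deriv (vth1 T) 0 / (vth2 T 0 * vth3 T 0 * vth4 T 0) with hD
  have hpow : ∀ n : ℕ, D (T * 2 ^ n) = D T := by
    intro n
    induction n with
    | zero => simp
    | succ n ih =>
      rw [← ih, show T * 2 ^ n = T * 2 ^ (n + 1) / 2 by ring]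
      exact (jacobi_ratio_half_nome (by positivity)).symm
  have h4 : Filter.Tendsto (fun T : ℝ => vth4 T 0) Filter.atTop (𝓝 1) := by
    refine (tendsto_vth3 (Real.pi / 2)).congr fun T => ?_
    rw [vth4, zero_add]; push_cast; rfl
  have h3 : Filter.Tendsto (fun T : ℝ => vth3 T 0) Filter.atTop (𝓝 1) := by
    simpa using tendsto_vth3 0
  have hlim : Filter.Tendsto D Filter.atTop (𝓝 1) := by
    have h := tendsto_exp_mul_deriv_vth1.div ((tendsto_exp_mul_vth2.mul h3).mul h4) (by norm_num)
    norm_num at h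
    refine h.congr fun T => ?_
    have := exp_ne_zero ((T : ℂ) / 4)
    simp only [hD, Pi.div_apply]
    rw [mul_assoc, mul_assoc, mul_div_mul_left _ _ this, mul_assoc]
  have hseq : Filter.Tendsto (fun n : ℕ => T * 2 ^ n) Filter.atTop Filter.atTop :=
    (tendsto_pow_atTop_atTop_of_one_lt one_lt_two).const_mul_atTop hT
  have h1 : D T = 1 := tendsto_nhds_unique
    (tendsto_const_nhds.congr fun n => (hpow n).symm) (hlim.comp hseq)
  have hne : vth2 T 0 * vth3 T 0 * vth4 T 0 ≠ 0 :=
    mul_ne_zero (mul_ne_zero (vth2_zero_ne_zero hT) (vth3_zero_ne_zero hT)) (vth4_zero_ne_zero hT)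
  exact (div_eq_one_iff_eq hne).1 h1

/-- Jacobi's identity supplies the constant; this is sn' = cn dn in theta form, and it also shows
that ϑ₁' and ϑ₄' cannot vanish together where ϑ₂ϑ₃ ≠ 0. -/
lemma vth1_vth4_wronskian {T : ℝ} (hT : 0 < T) (x : ℂ) :
    deriv (vth1 T) x * vth4 T x - vth1 T x * deriv (vth4 T) x
      = vth4 T 0 ^ 2 * (vth2 T x * vth3 T x) := by
  have h := wronskian_aux hT x
  rw [deriv_vth1_zero hT] at h
  apply mul_right_cancel₀ (mul_ne_zero (vth2_zero_ne_zero hT) (vth3_zero_ne_zero hT))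
  rw [h]
  ring

/-! ### Critical points of the quotient of shifted theta functions -/

/-- The derivative of the addition theorem for `ϑ₄` with respect to `y`. -/
lemma vth4_addition_deriv {T : ℝ} (hT : 0 < T) (x y : ℂ) :
    (deriv (vth4 T) (x + y) * vth4 T (x - y) - vth4 T (x + y) * deriv (vth4 T) (x - y))
        * vth4 T 0 ^ 2
      = 2 * (vth4 T x ^ 2 * (vth4 T y * deriv (vth4 T) y)
          - vth1 T x ^ 2 * (vth1 T y * deriv (vth1 T) y)) := by
  have d1 := fun w => (differentiable_vth1 hT w).hasDerivAt
  have d4 := fun w => (differentiable_vth4 hT w).hasDerivAt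
  have a1 : HasDerivAt (fun y => vth4 T (x + y)) (deriv (vth4 T) (x + y)) y :=
    (d4 (x + y)).comp_const_add x y
  have a4 : HasDerivAt (fun y => vth4 T (x - y)) (-deriv (vth4 T) (x - y)) y :=
    (d4 (x - y)).comp_const_sub x y
  have hl := (a1.mul a4).mul_const (vth4 T 0 ^ 2)
  have hr := (((d4 y).pow 2).const_mul (vth4 T x ^ 2)).sub (((d1 y).pow 2).const_mul (vth1 T x ^ 2))
  have h := (hr.congr_of_eventuallyEq
    (Filter.Eventually.of_forall fun y => vth4_addition hT x y)).unique hl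
  simp only [Nat.cast_ofNat] at h
  linear_combination -h

/-- Zeros `x` of the derivative of `ϑ₄(x + y) / ϑ₄(x - y)` differ by zeros of `ϑ₁`, up to sign. -/
lemma vth1_add_mul_vth1_sub_eq_zero {T : ℝ} (hT : 0 < T) {x x₀ y : ℂ}
    (h1 : vth1 T y ≠ 0) (h2 : vth2 T y ≠ 0) (h3 : vth3 T y ≠ 0) (h4 : vth4 T y ≠ 0)
    (hx : deriv (vth4 T) (x + y) * vth4 T (x - y) - vth4 T (x + y) * deriv (vth4 T) (x - y) = 0)
    (hx₀ : deriv (vth4 T) (x₀ + y) * vth4 T (x₀ - y)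
      - vth4 T (x₀ + y) * deriv (vth4 T) (x₀ - y) = 0) :
    vth1 T (x + x₀) * vth1 T (x - x₀) = 0 := by
  have e := vth4_addition_deriv hT x y
  have e₀ := vth4_addition_deriv hT x₀ y
  rw [hx, zero_mul, eq_comm, mul_eq_zero, or_iff_right two_ne_zero, sub_eq_zero] at e
  rw [hx₀, zero_mul, eq_comm, mul_eq_zero, or_iff_right two_ne_zero, sub_eq_zero] at e₀
  have n0 := vth4_zero_ne_zero hT
  have ha := vth1_addition hT x x₀
  have hw := vth1_vth4_wronskian hT y
  -- The two critical equations are linear in ϑ₄(y)ϑ₄'(y) and ϑ₁(y)ϑ₁'(y). Their determinant is, up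
  -- to sign and the factor ϑ₄(0)², the product ϑ₁(x+x₀)ϑ₁(x−x₀). If it were non-zero, both
  -- derivatives at `y` would vanish, against the Wronskian.
  by_contra hne
  have hne' : vth1 T x ^ 2 * vth4 T x₀ ^ 2 - vth4 T x ^ 2 * vth1 T x₀ ^ 2 ≠ 0 := by
    rw [← ha]; exact mul_ne_zero hne (pow_ne_zero 2 n0)
  have k4 : vth4 T y * deriv (vth4 T) y = 0 := by
    apply mul_left_cancel₀ hne'
    linear_combination (-vth1 T x₀ ^ 2) * e + vth1 T x ^ 2 * e₀
  have k1 : vth1 T y * deriv (vth1 T) y = 0 := by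
    apply mul_left_cancel₀ hne'
    linear_combination (-vth4 T x₀ ^ 2) * e + vth4 T x ^ 2 * e₀
  rw [(mul_eq_zero.1 k4).resolve_left h4, (mul_eq_zero.1 k1).resolve_left h1] at hw
  exact mul_ne_zero (pow_ne_zero 2 n0) (mul_ne_zero h2 h3) (by rw [← hw]; ring)

section imaginary

variable {T a : ℝ}

lemma vth1_I_mul_ne_zero (ha : 0 < a) (haT : a < T) : vth1 T (I * a) ≠ 0 := by
  intro h
  obtain ⟨k, hk⟩ := eq_int_mul_pi_of_vth1_eq_zero (ha.trans haT)
    (by simpa [abs_of_pos ha] using haT) h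
  have := congrArg im hk
  simp at this
  exact ha.ne' this

lemma vth2_I_mul_ne_zero (ha : 0 < a) (haT : a < T) : vth2 T (I * a) ≠ 0 :=
  vth2_ne_zero (ha.trans haT) (by simpa [abs_of_pos ha] using haT)
    (by simpa using half_pos Real.pi_pos)

lemma vth3_I_mul_ne_zero (ha : 0 < a) (haT : a < T / 2) : vth3 T (I * a) ≠ 0 :=
  vth3_ne_zero (by linarith) (by simpa [abs_of_pos ha] using haT)

lemma vth4_I_mul_ne_zero (ha : 0 < a) (haT : a < T / 2) : vth4 T (I * a) ≠ 0 :=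
  vth4_ne_zero (by linarith) (by simpa [abs_of_pos ha] using haT)

end imaginary

/-! ### The boundary phase -/

/-- All but one of the terms of `phaseLog`. -/
def phaseLogTail (R q x : ℝ) : ℂ :=
  ∑' n : ℕ, (log (1 + -((q ^ (2 * n + 1) / R : ℝ) : ℂ) * exp (2 * I * x))
    + log (1 + -((q ^ (2 * n + 3) * R : ℝ) : ℂ) * exp (-(2 * I * x))))

/-- A logarithm of `ϑ₄(x + i (log R) / 2; q)`, up to a real constant. -/
def phaseLog (R q x : ℝ) : ℂ :=
  log (1 + -((q * R : ℝ) : ℂ) * exp (-(2 * I * x))) + phaseLogTail R q x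

/-- The argument of `ϑ₄(x + i (log R) / 2; q) / ϑ₄(x - i (log R) / 2; q)`. -/
def boundaryPhase (R q x : ℝ) : ℝ := 2 * (phaseLog R q x).im

lemma norm_exp_two_I (x : ℝ) : ‖exp (2 * I * x)‖ = 1 := by
  rw [show 2 * I * (x : ℂ) = ((2 * x : ℝ) : ℂ) * I by push_cast; ring, norm_exp_ofReal_mul_I]

lemma norm_exp_neg_two_I (x : ℝ) : ‖exp (-(2 * I * x))‖ = 1 := by
  rw [show -(2 * I * (x : ℂ)) = ((-2 * x : ℝ) : ℂ) * I by push_cast; ring, norm_exp_ofReal_mul_I]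

lemma norm_log_one_add_le_mul {z : ℂ} {r : ℝ} (hz : ‖z‖ ≤ r) (hr : r < 1) :
    ‖log (1 + z)‖ ≤ ((1 - r)⁻¹ / 2 + 1) * ‖z‖ := by
  refine (norm_log_one_add_le (hz.trans_lt hr)).trans ?_
  have h1 : (1 - ‖z‖)⁻¹ ≤ (1 - r)⁻¹ := inv_anti₀ (by linarith) (by linarith)
  have h0 : 0 ≤ (1 - r)⁻¹ := inv_nonneg.2 (by linarith)
  have hn := norm_nonneg z
  have h2 : ‖z‖ ^ 2 * (1 - ‖z‖)⁻¹ ≤ ‖z‖ * (1 - r)⁻¹ := by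
    apply mul_le_mul _ h1 (inv_nonneg.2 (by linarith)) hn
    nlinarith
  linarith

lemma one_add_mem_slitPlane {z : ℂ} (hz : ‖z‖ < 1) : 1 + z ∈ slitPlane :=
  mem_slitPlane_of_norm_lt_one hz

section phase

variable {R : ℝ}

lemma tail_coeff_bounds (hR : 1 < R) {q : ℝ} (h0 : 0 ≤ q) (h1 : q * R ≤ 1) (n : ℕ) :
    (0 ≤ q ^ (2 * n + 1) / R ∧ q ^ (2 * n + 1) / R ≤ (R⁻¹ ^ 2) ^ (n + 1)) ∧
      (0 ≤ q ^ (2 * n + 3) * R ∧ q ^ (2 * n + 3) * R ≤ (R⁻¹ ^ 2) ^ (n + 1)) := by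
  have hR0 : 0 < R := by linarith
  have hq : q ≤ R⁻¹ := by rw [← one_div, le_div_iff₀ hR0]; exact h1
  refine ⟨⟨by positivity, ?_⟩, by positivity, ?_⟩
  · calc q ^ (2 * n + 1) / R ≤ R⁻¹ ^ (2 * n + 1) / R := by gcongr
      _ = (R⁻¹ ^ 2) ^ (n + 1) := by rw [div_eq_mul_inv]; ring
  · calc q ^ (2 * n + 3) * R = q ^ (2 * n + 2) * (q * R) := by ring
      _ ≤ R⁻¹ ^ (2 * n + 2) * 1 := by gcongr
      _ = (R⁻¹ ^ 2) ^ (n + 1) := by ring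

lemma inv_sq_lt_one (hR : 1 < R) : R⁻¹ ^ 2 < 1 :=
  pow_lt_one₀ (by positivity) (inv_lt_one_of_one_lt₀ hR) two_ne_zero

lemma norm_ofReal_mul_exp (c x : ℝ) (hc : 0 ≤ c) : ‖-(c : ℂ) * exp (2 * I * x)‖ = c := by
  rw [norm_mul, norm_neg, norm_real, Real.norm_of_nonneg hc, norm_exp_two_I, mul_one]

lemma norm_ofReal_mul_exp_neg (c x : ℝ) (hc : 0 ≤ c) : ‖-(c : ℂ) * exp (-(2 * I * x))‖ = c := by
  rw [norm_mul, norm_neg, norm_real, Real.norm_of_nonneg hc, norm_exp_neg_two_I, mul_one]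

lemma inv_sq_pow_le (hR : 1 < R) (n : ℕ) : (R⁻¹ ^ 2) ^ (n + 1) ≤ R⁻¹ ^ 2 :=
  pow_le_of_le_one (by positivity) (inv_sq_lt_one hR).le (by omega)

lemma norm_phaseLogTail_term_le (hR : 1 < R) {q : ℝ} (h0 : 0 ≤ q) (h1 : q * R ≤ 1) (x : ℝ) (n : ℕ) :
    ‖log (1 + -((q ^ (2 * n + 1) / R : ℝ) : ℂ) * exp (2 * I * x))
      + log (1 + -((q ^ (2 * n + 3) * R : ℝ) : ℂ) * exp (-(2 * I * x)))‖
      ≤ 2 * ((1 - R⁻¹ ^ 2)⁻¹ / 2 + 1) * (R⁻¹ ^ 2) ^ (n + 1) := by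
  obtain ⟨⟨a0, a1⟩, b0, b1⟩ := tail_coeff_bounds hR h0 h1 n
  have hr := inv_sq_lt_one hR
  have hrn := inv_sq_pow_le hR n
  have ha := norm_ofReal_mul_exp _ x a0
  have hb := norm_ofReal_mul_exp_neg _ x b0
  have hC : 0 ≤ (1 - R⁻¹ ^ 2)⁻¹ / 2 + 1 := by
    have : 0 ≤ (1 - R⁻¹ ^ 2)⁻¹ := inv_nonneg.2 (by linarith)
    linarith
  have ea := norm_log_one_add_le_mul (ha.le.trans (a1.trans hrn)) hr
  have eb := norm_log_one_add_le_mul (hb.le.trans (b1.trans hrn)) hr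
  rw [ha] at ea
  rw [hb] at eb
  calc _ ≤ _ := norm_add_le _ _
    _ ≤ ((1 - R⁻¹ ^ 2)⁻¹ / 2 + 1) * (R⁻¹ ^ 2) ^ (n + 1)
        + ((1 - R⁻¹ ^ 2)⁻¹ / 2 + 1) * (R⁻¹ ^ 2) ^ (n + 1) :=
      add_le_add (ea.trans (mul_le_mul_of_nonneg_left a1 hC))
        (eb.trans (mul_le_mul_of_nonneg_left b1 hC))
    _ = _ := by ring

lemma summable_tail_bound (hR : 1 < R) :
    Summable fun n : ℕ => 2 * ((1 - R⁻¹ ^ 2)⁻¹ / 2 + 1) * (R⁻¹ ^ 2) ^ (n + 1) := by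
  refine Summable.mul_left _ ?_
  exact (summable_nat_add_iff 1).2 (summable_geometric_of_lt_one (by positivity) (inv_sq_lt_one hR))

/-- Continuity holds up to qR = 1 inclusive: only the factor 1 − qRe^{−2ix}, kept out of the tail,
can vanish there, while the other coefficients are at most R^{−2(n+1)}. -/
lemma continuousOn_phaseLogTail (hR : 1 < R) :
    ContinuousOn (fun p : ℝ × ℝ => phaseLogTail R p.1 p.2) {p | 0 ≤ p.1 ∧ p.1 * R ≤ 1} := by
  refine continuousOn_tsum (fun n => ?_) (summable_tail_bound hR)
    fun n p hp => norm_phaseLogTail_term_le hR hp.1 hp.2 p.2 n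
  refine ContinuousOn.add (ContinuousOn.clog (by fun_prop) fun p hp => ?_)
    (ContinuousOn.clog (by fun_prop) fun p hp => ?_)
  · obtain ⟨⟨a0, a1⟩, -⟩ := tail_coeff_bounds hR hp.1 hp.2 n
    apply one_add_mem_slitPlane
    rw [norm_ofReal_mul_exp _ _ a0]
    exact (a1.trans (inv_sq_pow_le hR n)).trans_lt (inv_sq_lt_one hR)
  · obtain ⟨-, b0, b1⟩ := tail_coeff_bounds hR hp.1 hp.2 n
    apply one_add_mem_slitPlane
    rw [norm_ofReal_mul_exp_neg _ _ b0]
    exact (b1.trans (inv_sq_pow_le hR n)).trans_lt (inv_sq_lt_one hR)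

lemma continuousOn_boundaryPhase (hR : 1 < R) :
    ContinuousOn (fun p : ℝ × ℝ => boundaryPhase R p.1 p.2) {p | 0 ≤ p.1 ∧ p.1 * R < 1} := by
  have hR0 : 0 < R := by linarith
  refine continuousOn_const.mul (continuous_im.comp_continuousOn (ContinuousOn.add
    (ContinuousOn.clog (by fun_prop) fun p hp => ?_)
    ((continuousOn_phaseLogTail hR).mono fun p hp => ⟨hp.1, hp.2.le⟩)))
  apply one_add_mem_slitPlane
  rw [norm_ofReal_mul_exp_neg _ _ (mul_nonneg hp.1 hR0.le)]
  exact hp.2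

lemma boundaryPhase_zero_nome (x : ℝ) : boundaryPhase R 0 x = 0 := by
  simp [boundaryPhase, phaseLog, phaseLogTail]

lemma boundaryPhase_add_pi (q x : ℝ) : boundaryPhase R q (x + Real.pi) = boundaryPhase R q x := by
  have e1 : exp (2 * I * ((x + Real.pi : ℝ) : ℂ)) = exp (2 * I * x) := by
    rw [← exp_periodic (2 * I * (x : ℂ))]; congr 1; push_cast; ring
  have e2 : exp (-(2 * I * ((x + Real.pi : ℝ) : ℂ))) = exp (-(2 * I * x)) := by
    rw [← exp_periodic.sub_eq (-(2 * I * (x : ℂ)))]; congr 1; push_cast; ring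
  simp only [boundaryPhase, phaseLog, phaseLogTail, e1, e2]

lemma log_conj_one_add (c : ℝ) {w : ℂ} (h : ‖-(c : ℂ) * exp w‖ < 1) :
    log (1 + -(c : ℂ) * exp (starRingEnd ℂ w)) = starRingEnd ℂ (log (1 + -(c : ℂ) * exp w)) := by
  rw [← log_conj _ (slitPlane_arg_ne_pi (one_add_mem_slitPlane h))]
  simp [exp_conj]

lemma phaseLogTail_neg (hR : 1 < R) {q : ℝ} (h0 : 0 ≤ q) (h1 : q * R ≤ 1) (x : ℝ) :
    phaseLogTail R q (-x) = starRingEnd ℂ (phaseLogTail R q x) := by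
  have c1 : (2 * I * ((-x : ℝ) : ℂ)) = starRingEnd ℂ (2 * I * x) := by
    simp [map_ofNat (starRingEnd ℂ) 2]
  have c2 : (-(2 * I * ((-x : ℝ) : ℂ))) = starRingEnd ℂ (-(2 * I * x)) := by
    simp [map_ofNat (starRingEnd ℂ) 2]
  rw [phaseLogTail, phaseLogTail, conj_tsum]
  refine tsum_congr fun n => ?_
  obtain ⟨⟨a0, a1⟩, b0, b1⟩ := tail_coeff_bounds hR h0 h1 n
  rw [c2, c1, log_conj_one_add, log_conj_one_add, map_add]
  · rw [norm_ofReal_mul_exp_neg _ _ b0]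
    exact (b1.trans (inv_sq_pow_le hR n)).trans_lt (inv_sq_lt_one hR)
  · rw [norm_ofReal_mul_exp _ _ a0]
    exact (a1.trans (inv_sq_pow_le hR n)).trans_lt (inv_sq_lt_one hR)

lemma boundaryPhase_neg (hR : 1 < R) {q : ℝ} (h0 : 0 ≤ q) (h1 : q * R < 1) (x : ℝ) :
    boundaryPhase R q (-x) = -boundaryPhase R q x := by
  have c2 : (-(2 * I * ((-x : ℝ) : ℂ))) = starRingEnd ℂ (-(2 * I * x)) := by
    simp [map_ofNat (starRingEnd ℂ) 2]
  rw [boundaryPhase, phaseLog, phaseLogTail_neg hR h0 h1.le, c2, log_conj_one_add, ← map_add,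
    conj_im, boundaryPhase, phaseLog]
  · ring
  · rwa [norm_ofReal_mul_exp_neg _ _ (mul_nonneg h0 (by linarith))]

lemma boundaryPhase_zero (hR : 1 < R) {q : ℝ} (h0 : 0 ≤ q) (h1 : q * R < 1) :
    boundaryPhase R q 0 = 0 := by
  have := boundaryPhase_neg hR h0 h1 0
  rw [neg_zero] at this
  exact self_eq_neg.mp this

lemma boundaryPhase_pi_div_two (hR : 1 < R) {q : ℝ} (h0 : 0 ≤ q) (h1 : q * R < 1) :
    boundaryPhase R q (Real.pi / 2) = 0 := by
  have h := boundaryPhase_neg hR h0 h1 (Real.pi / 2)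
  rw [← boundaryPhase_add_pi, show -(Real.pi / 2) + Real.pi = Real.pi / 2 by ring] at h
  exact self_eq_neg.mp h

/-- Here 1 − e^{−2ix} = 2 sin x · e^{i(π/2 − x)}. This is the exceptional factor at qR = 1; for
small x > 0 it contributes nearly π to the phase. -/
lemma im_log_one_sub_exp {x : ℝ} (h0 : 0 < x) (h1 : x < Real.pi / 2) :
    (log (1 + -1 * exp (-(2 * I * x)))).im = Real.pi / 2 - x := by
  have hs : 0 < 2 * Real.sin x := by
    have := Real.sin_pos_of_pos_of_lt_pi h0 (by linarith)
    linarith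
  have e : 1 + -1 * exp (-(2 * I * x))
      = ((2 * Real.sin x : ℝ) : ℂ) * (cos ((Real.pi / 2 - x : ℝ) : ℂ)
        + sin ((Real.pi / 2 - x : ℝ) : ℂ) * I) := by
    push_cast
    rw [cos_pi_div_two_sub, sin_pi_div_two_sub,
      show -(2 * I * (x : ℂ)) = ((-(2 * x) : ℂ)) * I by ring, exp_mul_I, cos_neg, sin_neg,
      cos_two_mul, sin_two_mul]
    linear_combination (-2 : ℂ) * sin_sq_add_cos_sq (x : ℂ)
  rw [log_im, e, arg_mul_cos_add_sin_mul_I hs ⟨by linarith, by linarith⟩]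

/-- The boundary phase takes all values below `π`. -/
lemma exists_boundaryPhase_gt (hR : 1 < R) {γ : ℝ} (hγ : γ < Real.pi) :
    ∃ q x : ℝ, 0 < q ∧ q * R < 1 ∧ x ∈ Set.Icc 0 (Real.pi / 2) ∧ γ < boundaryPhase R q x := by
  have hR0 : 0 < R := by linarith
  have hpi := Real.pi_pos
  have hinv : R⁻¹ * R = 1 := inv_mul_cancel₀ hR0.ne'
  have hmem : ((R⁻¹, 0) : ℝ × ℝ) ∈ {p : ℝ × ℝ | 0 ≤ p.1 ∧ p.1 * R ≤ 1} := ⟨by positivity, hinv.le⟩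
  have htail0 : (phaseLogTail R R⁻¹ 0).im = 0 := by
    have h := phaseLogTail_neg hR (q := R⁻¹) (by positivity) hinv.le 0
    rw [neg_zero] at h
    exact conj_eq_iff_im.1 h.symm
  -- At qR = 1 the exceptional factor contributes π − 2x, and the tail is real at x = 0, so the
  -- phase exceeds γ for small x > 0.
  obtain ⟨x, ⟨hx0, hx1⟩, hx⟩ : ∃ x : ℝ, (0 < x ∧ x < Real.pi / 2) ∧
      γ < 2 * ((Real.pi / 2 - x) + (phaseLogTail R R⁻¹ x).im) := by
    have hc : ContinuousAt (fun x : ℝ => 2 * ((Real.pi / 2 - x) + (phaseLogTail R R⁻¹ x).im)) 0 := by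
      have h1 : Continuous fun x : ℝ => phaseLogTail R R⁻¹ x :=
        (continuousOn_phaseLogTail hR).comp_continuous (f := fun x : ℝ => (R⁻¹, x)) (by fun_prop)
          fun x => ⟨by positivity, hinv.le⟩
      have h2 := continuous_im.comp h1
      exact (continuous_const.mul ((continuous_const.sub continuous_id).add h2)).continuousAt
    have hev := hc.eventually (lt_mem_nhds (a := γ) (by
      simp only [htail0]; linarith))
    have hev2 : ∀ᶠ x : ℝ in 𝓝[>] 0, x < Real.pi / 2 :=
      nhdsWithin_le_nhds (gt_mem_nhds (half_pos hpi))
    have hev1 : ∀ᶠ x : ℝ in 𝓝[>] 0, γ < 2 * ((Real.pi / 2 - x) + (phaseLogTail R R⁻¹ x).im) :=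
      nhdsWithin_le_nhds hev
    obtain ⟨x, hxa, hxb, hxc⟩ := (hev1.and (hev2.and self_mem_nhdsWithin)).exists
    exact ⟨x, ⟨hxc, hxb⟩, hxa⟩
  -- With `x` fixed, the phase is continuous in q from the left at 1/R, so a slightly smaller nome
  -- still exceeds γ.
  have hc : ContinuousWithinAt (fun q : ℝ => boundaryPhase R q x) (Set.Icc 0 R⁻¹) R⁻¹ := by
    have h1 : ContinuousOn (fun q : ℝ => phaseLogTail R q x) (Set.Icc 0 R⁻¹) :=
      (continuousOn_phaseLogTail hR).comp (f := fun q : ℝ => (q, x)) (by fun_prop) fun q hq =>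
        ⟨hq.1, by rw [← hinv]; exact mul_le_mul_of_nonneg_right hq.2 hR0.le⟩
    have h2 : ContinuousWithinAt (fun q : ℝ => log (1 + -((q * R : ℝ) : ℂ) * exp (-(2 * I * x))))
        (Set.Icc 0 R⁻¹) R⁻¹ := by
      refine ContinuousWithinAt.clog (by fun_prop) (Or.inl ?_)
      rw [hinv]
      have hre : (exp (-(2 * I * x))).re = Real.cos (2 * x) := by
        rw [exp_re]; simp
      simp only [ofReal_one, add_re, one_re, neg_mul, one_mul, neg_re, hre]
      have := Real.cos_lt_cos_of_nonneg_of_le_pi (x := 0) (y := 2 * x) le_rfl (by linarith) (by linarith)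
      rw [Real.cos_zero] at this
      linarith
    exact continuousWithinAt_const.mul (continuous_im.continuousAt.comp_continuousWithinAt
      (h2.add (h1 _ ⟨by positivity, le_rfl⟩)))
  have hval : boundaryPhase R R⁻¹ x = 2 * ((Real.pi / 2 - x) + (phaseLogTail R R⁻¹ x).im) := by
    rw [boundaryPhase, phaseLog, add_im, hinv, ofReal_one, im_log_one_sub_exp hx0 hx1]
  have hev := hc.eventually (lt_mem_nhds (a := γ) (by
    simp only [hval]; exact hx))
  have hev' : ∀ᶠ q in 𝓝[Set.Ioo 0 R⁻¹] R⁻¹, γ < boundaryPhase R q x :=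
    nhdsWithin_mono _ Set.Ioo_subset_Icc_self hev
  have hRi : 0 < R⁻¹ := by positivity
  have : (𝓝[Set.Ioo 0 R⁻¹] R⁻¹).NeBot := by
    rw [← mem_closure_iff_nhdsWithin_neBot, closure_Ioo hRi.ne]
    exact ⟨hRi.le, le_rfl⟩
  obtain ⟨q, hq1, hq2⟩ := (hev'.and self_mem_nhdsWithin).exists
  refine ⟨q, x, hq2.1, ?_, ⟨hx0.le, hx1.le⟩, hq1⟩
  rw [← hinv]
  exact mul_lt_mul_of_pos_right hq2.2 hR0

/-! ### Choice of the nome -/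

/-- An intermediate value theorem for the maximum over a compact set. -/
lemma exists_isMaxOn_eq {F : ℝ → ℝ → ℝ} {q₁ γ : ℝ} (hq₁ : 0 ≤ q₁) {K : Set ℝ} (hKc : IsCompact K)
    (hF : ContinuousOn (fun p : ℝ × ℝ => F p.1 p.2) {p | p.1 ∈ Set.Icc 0 q₁})
    (h0 : ∀ x ∈ K, F 0 x ≤ γ) {x₁ : ℝ} (hx₁ : x₁ ∈ K) (h1 : γ ≤ F q₁ x₁) :
    ∃ q ∈ Set.Icc 0 q₁, ∃ x₀ ∈ K, F q x₀ = γ ∧ ∀ x ∈ K, F q x ≤ γ := by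
  have hKne : K.Nonempty := ⟨x₁, hx₁⟩
  obtain ⟨f, hfc, hf⟩ : ∃ f : ℝ → ℝ → ℝ, (Continuous fun p : ℝ × ℝ => f p.1 p.2) ∧
      ∀ q ∈ Set.Icc 0 q₁, ∀ x, f q x = F q x := by
    -- Clamping q to [0, q₁] makes the function continuous everywhere, so that the supremum over `K`
    -- is continuous in q.
    refine ⟨fun q x => F (max 0 (min q q₁)) x, ?_, fun q hq x => ?_⟩
    · have hg : Continuous fun p : ℝ × ℝ => (max 0 (min p.1 q₁), p.2) := by fun_prop
      have hm : ∀ p : ℝ × ℝ, (max 0 (min p.1 q₁), p.2) ∈ {p : ℝ × ℝ | p.1 ∈ Set.Icc 0 q₁} :=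
        fun p => ⟨le_max_left _ _, max_le hq₁ (min_le_right _ _)⟩
      exact hF.comp_continuous hg hm
    · simp only [min_eq_left hq.2, max_eq_right hq.1]
  have hfx : ∀ q, Continuous (f q) := fun q =>
    hfc.comp (by fun_prop : Continuous fun x : ℝ => (q, x))
  have hM : Continuous fun q => sSup (f q '' K) := hKc.continuous_sSup (f := f) hfc
  have hbdd : ∀ q, BddAbove (f q '' K) := fun q => (hKc.image (hfx q)).bddAbove
  have hle : sSup (f 0 '' K) ≤ γ := by
    refine csSup_le (hKne.image _) ?_
    rintro _ ⟨x, hx, rfl⟩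
    rw [hf 0 ⟨le_rfl, hq₁⟩]
    exact h0 x hx
  have hge : γ ≤ sSup (f q₁ '' K) := by
    refine le_trans ?_ (le_csSup (hbdd q₁) ⟨x₁, hx₁, rfl⟩)
    rwa [hf q₁ ⟨hq₁, le_rfl⟩]
  obtain ⟨q, hq, hqe⟩ := intermediate_value_Icc hq₁ hM.continuousOn ⟨hle, hge⟩
  obtain ⟨x₀, hx₀, hx₀e⟩ := hKc.exists_sSup_image_eq hKne (hfx q).continuousOn
  refine ⟨q, hq, x₀, hx₀, ?_, fun x hx => ?_⟩
  · rw [← hf q hq, ← hx₀e]; exact hqe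
  · rw [← hf q hq]
    exact (le_csSup (hbdd q) ⟨x, hx, rfl⟩).trans hqe.le

/-- Every angle in `(0, π)` is the maximal boundary phase for some nome. -/
lemma exists_nome_of_angle (hR : 1 < R) {γ : ℝ} (hγ0 : 0 < γ) (hγ : γ < Real.pi) :
    ∃ q : ℝ, 0 < q ∧ q * R < 1 ∧ ∃ x₀ ∈ Set.Ioo 0 (Real.pi / 2), boundaryPhase R q x₀ = γ ∧
      ∀ x ∈ Set.Icc 0 (Real.pi / 2), boundaryPhase R q x ≤ γ := by
  have hR0 : 0 < R := by linarith
  obtain ⟨q₁, x₁, hq₁, hq₁R, hx₁, hgt⟩ := exists_boundaryPhase_gt hR hγ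
  have hmem : ∀ q ∈ Set.Icc 0 q₁, 0 ≤ q ∧ q * R < 1 := fun q hq =>
    ⟨hq.1, (mul_le_mul_of_nonneg_right hq.2 hR0.le).trans_lt hq₁R⟩
  obtain ⟨q, hq, x₀, hx₀, hval, hmax⟩ := exists_isMaxOn_eq hq₁.le isCompact_Icc
    ((continuousOn_boundaryPhase hR).mono fun p hp => hmem p.1 hp)
    (fun x _ => (boundaryPhase_zero_nome x).trans_le hγ0.le) hx₁ hgt.le
  obtain ⟨hqn, hqR⟩ := hmem q hq
  have hq0 : 0 < q := by
    rcases hqn.eq_or_lt with h | h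
    · rw [← h, boundaryPhase_zero_nome] at hval
      exact absurd hval hγ0.ne
    · exact h
  -- The phase vanishes at both ends of [0, π/2], whereas the maximum γ is positive; hence x₀ is
  -- interior.
  refine ⟨q, hq0, hqR, x₀, ⟨lt_of_le_of_ne hx₀.1 ?_, lt_of_le_of_ne hx₀.2 ?_⟩, hval, hmax⟩
  · rintro rfl
    rw [boundaryPhase_zero hR hqn hqR] at hval
    exact hγ0.ne hval
  · rintro rfl
    rw [boundaryPhase_pi_div_two hR hqn hqR] at hval
    exact hγ0.ne hval

end phase

/-! ### The phase as the argument of the theta quotient -/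

/-- A continuous real argument of a differentiable function is differentiable. -/
lemma exists_hasDerivAt_of_exp_I_mul {φ : ℝ → ℝ} {g : ℝ → ℂ} {g' : ℂ} {x : ℝ}
    (hφ : ContinuousAt φ x) (h : ∀ y, exp (I * φ y) = g y) (hg : HasDerivAt g g' x) :
    ∃ d : ℝ, HasDerivAt φ d x ∧ g' = I * d * g x := by
  have hgx : g x ≠ 0 := by rw [← h]; exact exp_ne_zero _
  have hlog : HasDerivAt (fun y => log (g y / g x)) (g' / g x) x := by
    have h1 := (hg.div_const (g x)).clog_real (by rw [div_self hgx]; exact one_mem_slitPlane)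
    rwa [div_self hgx, div_one] at h1
  -- Near `x` the increment of φ stays in (−π, π), where the principal logarithm recovers it.
  have hev : ∀ᶠ y in 𝓝 x, log (g y / g x) = I * ((φ y - φ x : ℝ) : ℂ) := by
    have hc : ContinuousAt (fun y => φ y - φ x) x := hφ.sub continuousAt_const
    have hI : Set.Ioo (-Real.pi) Real.pi ∈ 𝓝 (φ x - φ x) := by
      rw [sub_self]; exact Ioo_mem_nhds (by linarith [Real.pi_pos]) Real.pi_pos
    filter_upwards [hc hI] with y hy
    rw [← h, ← h, ← exp_sub, ← mul_sub, ← ofReal_sub, log_exp]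
    · simpa using hy.1
    · simpa using hy.2.le
  have hψ : HasDerivAt (fun y => I * ((φ y - φ x : ℝ) : ℂ)) (g' / g x) x :=
    hlog.congr_of_eventuallyEq (hev.mono fun y hy => hy.symm)
  have him := (imCLM.hasFDerivAt.comp_hasDerivAt x hψ)
  have hre := (reCLM.hasFDerivAt.comp_hasDerivAt x hψ)
  have e1 : (imCLM ∘ fun y => I * ((φ y - φ x : ℝ) : ℂ)) = fun y => φ y - φ x := by
    funext y; simp
  have e2 : (reCLM ∘ fun y => I * ((φ y - φ x : ℝ) : ℂ)) = fun _ => 0 := by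
    funext y; simp
  rw [e1] at him
  rw [e2] at hre
  have hre0 : (g' / g x).re = 0 := hre.unique (hasDerivAt_const x (0 : ℝ))
  refine ⟨(g' / g x).im, by simpa using him.add_const (φ x), ?_⟩
  have : g' / g x = I * ((g' / g x).im : ℂ) := by
    apply Complex.ext <;> simp [hre0]
  rw [← this, div_mul_cancel₀ _ hgx]

section

variable {T a : ℝ}

lemma exp_neg_mul_exp_lt_one (haT : a < T / 2) : Real.exp (-T) * Real.exp (2 * a) < 1 := by
  rw [← Real.exp_add, Real.exp_lt_one_iff]
  linarith

/-- Since e^{−T}e^{2a} < 1, every factor of the product formula is 1 + z with |z| < 1, so the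
principal logarithms may be summed. The first factor of the second product is the one split off in
`phaseLog`. -/
lemma exists_vth4_eq_exp_phaseLog (ha : 0 < a) (haT : a < T / 2) :
    ∃ L : ℝ, 0 < L ∧ ∀ x : ℝ,
      vth4 T (x + I * a) = L * exp (phaseLog (Real.exp (2 * a)) (Real.exp (-T)) x) := by
  have hT : 0 < T := by linarith
  obtain ⟨L, hL, hp⟩ := exists_vth3_eq_prod hT
  refine ⟨L, hL, fun x => ?_⟩
  set q := Real.exp (-T) with hq
  set R := Real.exp (2 * a) with hRdef
  have hR : 1 < R := Real.one_lt_exp_iff.2 (by linarith)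
  have hR0 : 0 < R := by linarith
  have hq0 : 0 ≤ q := (Real.exp_pos _).le
  have hqR : q * R < 1 := exp_neg_mul_exp_lt_one haT
  have hq1 : q < 1 := Real.exp_lt_one_iff.2 (by linarith)
  rw [vth4, hp]
  have e1 : ∀ n : ℕ, (1 + (q : ℂ) ^ (2 * n + 1) * exp (2 * I * (x + I * a + Real.pi / 2)))
      = 1 + -((q ^ (2 * n + 1) / R : ℝ) : ℂ) * exp (2 * I * x) := by
    intro n
    have : exp (2 * I * (x + I * a + Real.pi / 2)) = -exp (2 * I * x) / R := by
      rw [hRdef, ofReal_exp, eq_div_iff (exp_ne_zero _), ← exp_add,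
        show 2 * I * (x + I * a + (Real.pi : ℂ) / 2) + ((2 * a : ℝ) : ℂ) = 2 * I * x + Real.pi * I by
          push_cast; linear_combination (2 * a : ℂ) * I_sq, exp_add, exp_pi_mul_I]
      ring
    rw [this]; push_cast; ring
  have e2 : ∀ n : ℕ, (1 + (q : ℂ) ^ (2 * n + 1) * exp (-(2 * I * (x + I * a + Real.pi / 2))))
      = 1 + -((q ^ (2 * n + 1) * R : ℝ) : ℂ) * exp (-(2 * I * x)) := by
    intro n
    have : exp (-(2 * I * (x + I * a + Real.pi / 2))) = -exp (-(2 * I * x)) * R := by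
      rw [hRdef, ofReal_exp, neg_mul, ← exp_add,
        show -(2 * I * (x + I * a + (Real.pi : ℂ) / 2))
          = -(2 * I * x) + ((2 * a : ℝ) : ℂ) - Real.pi * I by
          push_cast; linear_combination (-2 * a : ℂ) * I_sq, exp_sub _ (Real.pi * I), exp_pi_mul_I]
      ring
    rw [this]; push_cast; ring
  have n1 : ∀ n : ℕ, ‖-((q ^ (2 * n + 1) / R : ℝ) : ℂ) * exp (2 * I * x)‖ < 1 := fun n => by
    obtain ⟨⟨a0, a1⟩, -⟩ := tail_coeff_bounds hR hq0 hqR.le n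
    rw [norm_ofReal_mul_exp _ _ a0]
    exact (a1.trans (inv_sq_pow_le hR n)).trans_lt (inv_sq_lt_one hR)
  have n2 : ∀ n : ℕ, ‖-((q ^ (2 * n + 1) * R : ℝ) : ℂ) * exp (-(2 * I * x))‖ < 1 := fun n => by
    rw [norm_ofReal_mul_exp_neg _ _ (by positivity)]
    calc q ^ (2 * n + 1) * R = q ^ (2 * n) * (q * R) := by ring
      _ ≤ 1 * (q * R) := by gcongr; exact pow_le_one₀ hq0 hq1.le
      _ < 1 := by linarith
  have s1 : Summable fun n : ℕ => log (1 + -((q ^ (2 * n + 1) / R : ℝ) : ℂ) * exp (2 * I * x)) := by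
    refine summable_log_one_add_of_summable (Summable.of_norm ?_)
    refine (summable_pow_two_mul_add_one (Real.exp_pos (-T)) hq1
      (exp (2 * I * (x + I * a + Real.pi / 2)))).congr fun n => ?_
    congr 1
    exact add_left_cancel (e1 n)
  have s2 : Summable fun n : ℕ => log (1 + -((q ^ (2 * n + 1) * R : ℝ) : ℂ) * exp (-(2 * I * x))) := by
    refine summable_log_one_add_of_summable (Summable.of_norm ?_)
    refine (summable_pow_two_mul_add_one (Real.exp_pos (-T)) hq1
      (exp (-(2 * I * (x + I * a + Real.pi / 2))))).congr fun n => ?_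
    congr 1
    exact add_left_cancel (e2 n)
  have ne : ∀ {z : ℂ}, ‖z‖ < 1 → 1 + z ≠ 0 := fun hz => slitPlane_ne_zero (one_add_mem_slitPlane hz)
  rw [tprod_congr e1, tprod_congr e2, ← cexp_tsum_eq_tprod (fun n => ne (n1 n)) s1,
    ← cexp_tsum_eq_tprod (fun n => ne (n2 n)) s2, ← exp_add, s2.tsum_eq_zero_add, phaseLog,
    phaseLogTail, ← add_assoc, add_comm (∑' n : ℕ, _), add_assoc, ← s1.tsum_add
    ((summable_nat_add_iff (f := fun n : ℕ =>
      log (1 + -((q ^ (2 * n + 1) * R : ℝ) : ℂ) * exp (-(2 * I * x)))) 1).2 s2)]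
  simp only [mul_zero, zero_add, pow_one]
  rfl

/-- The quotient `ϑ₄(x + ia) / ϑ₄(x - ia)` lies on the unit circle for real `x`. -/
lemma exp_I_mul_boundaryPhase (ha : 0 < a) (haT : a < T / 2) (x : ℝ) :
    exp (I * boundaryPhase (Real.exp (2 * a)) (Real.exp (-T)) x)
      = vth4 T (x + I * a) / vth4 T (x - I * a) := by
  obtain ⟨L, hL, h⟩ := exists_vth4_eq_exp_phaseLog ha haT
  have hc : vth4 T (x - I * a) = starRingEnd ℂ (vth4 T (x + I * a)) := by
    rw [← vth4_conj]; congr 1; simp [sub_eq_add_neg]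
  have hL' : (L : ℂ) ≠ 0 := ofReal_ne_zero.2 hL.ne'
  rw [hc, h, map_mul, conj_ofReal, ← exp_conj, mul_div_mul_left _ _ hL', ← exp_sub, boundaryPhase,
    sub_conj]
  congr 1
  push_cast; ring

lemma continuous_boundaryPhase (ha : 0 < a) (haT : a < T / 2) :
    Continuous (boundaryPhase (Real.exp (2 * a)) (Real.exp (-T))) :=
  (continuousOn_boundaryPhase (Real.one_lt_exp_iff.2 (by linarith))).comp_continuous
    (f := fun x : ℝ => (Real.exp (-T), x)) (by fun_prop)
    fun _ => ⟨(Real.exp_pos _).le, exp_neg_mul_exp_lt_one haT⟩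

lemma vth4_real_add_ne_zero (ha : 0 < a) (haT : a < T / 2) (x : ℝ) : vth4 T (x + I * a) ≠ 0 :=
  vth4_ne_zero (by linarith) (by simpa [abs_of_pos ha] using haT)

lemma vth4_real_sub_ne_zero (ha : 0 < a) (haT : a < T / 2) (x : ℝ) : vth4 T (x - I * a) ≠ 0 :=
  vth4_ne_zero (by linarith) (by simpa [abs_of_pos ha] using haT)

/-- The numerator of the derivative of `ϑ₄(x + ia) / ϑ₄(x - ia)`. -/
def quotDerivNum (T a : ℝ) (x : ℂ) : ℂ :=
  deriv (vth4 T) (x + I * a) * vth4 T (x - I * a) - vth4 T (x + I * a) * deriv (vth4 T) (x - I * a)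

lemma hasDerivAt_vth4_quot (hT : 0 < T) {x : ℂ} (hx : vth4 T (x - I * a) ≠ 0) :
    HasDerivAt (fun x => vth4 T (x + I * a) / vth4 T (x - I * a))
      (quotDerivNum T a x / vth4 T (x - I * a) ^ 2) x := by
  have d4 := fun w => (differentiable_vth4 hT w).hasDerivAt
  have h1 : HasDerivAt (fun x => vth4 T (x + I * a)) (deriv (vth4 T) (x + I * a)) x :=
    (d4 (x + I * a)).comp_add_const x _
  have h2 : HasDerivAt (fun x => vth4 T (x - I * a)) (deriv (vth4 T) (x - I * a)) x :=
    (d4 (x - I * a)).comp_sub_const x _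
  exact h1.div h2 hx

lemma exists_hasDerivAt_boundaryPhase (ha : 0 < a) (haT : a < T / 2) (x : ℝ) :
    ∃ d : ℝ, HasDerivAt (boundaryPhase (Real.exp (2 * a)) (Real.exp (-T))) d x ∧
      quotDerivNum T a x = I * d * (vth4 T (x + I * a) * vth4 T (x - I * a)) := by
  have hx := vth4_real_sub_ne_zero ha haT x
  obtain ⟨d, hd, he⟩ := exists_hasDerivAt_of_exp_I_mul (continuous_boundaryPhase ha haT).continuousAt
    (exp_I_mul_boundaryPhase ha haT)
    (hasDerivAt_vth4_quot (a := a) (by linarith) hx).comp_ofReal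
  refine ⟨d, hd, ?_⟩
  rw [div_eq_iff (pow_ne_zero 2 hx)] at he
  rw [he]
  field_simp

lemma vth1_add_mul_vth1_sub_of_critical (ha : 0 < a) (haT : a < T / 2) {x x₀ : ℂ}
    (hx : quotDerivNum T a x = 0) (hx₀ : quotDerivNum T a x₀ = 0) :
    vth1 T (x + x₀) = 0 ∨ vth1 T (x - x₀) = 0 :=
  mul_eq_zero.1 (vth1_add_mul_vth1_sub_eq_zero (by linarith)
    (vth1_I_mul_ne_zero ha (by linarith)) (vth2_I_mul_ne_zero ha (by linarith))
    (vth3_I_mul_ne_zero ha haT) (vth4_I_mul_ne_zero ha haT) hx hx₀)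

/-- The sum x + x₀ lies in (0, π), where ϑ₁ has no zero, and x − x₀ lies in (−π/2, π/2), where 0 is
its only zero. -/
lemma critical_unique (ha : 0 < a) (haT : a < T / 2) {x x₀ : ℝ}
    (hxm : x ∈ Set.Ioo 0 (Real.pi / 2)) (hx₀m : x₀ ∈ Set.Ioo 0 (Real.pi / 2))
    (hx : quotDerivNum T a x = 0) (hx₀ : quotDerivNum T a x₀ = 0) : x = x₀ := by
  have hT : 0 < T := by linarith
  rcases vth1_add_mul_vth1_sub_of_critical ha haT hx hx₀ with h | h
  · refine absurd h (vth1_ne_zero hT (by simpa using hT) ?_ ?_)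
    · simp only [add_re, ofReal_re]; linarith [hxm.1, hx₀m.1]
    · simp only [add_re, ofReal_re]; linarith [hxm.2, hx₀m.2]
  · by_contra hne
    rcases lt_or_gt_of_ne hne with hlt | hlt
    · have h' : vth1 T (x₀ - x) = 0 := by
        rw [← neg_sub, vth1_neg, h, neg_zero]
      refine absurd h' (vth1_ne_zero hT (by simpa using hT) ?_ ?_)
      · simp only [sub_re, ofReal_re]; linarith
      · simp only [sub_re, ofReal_re]; linarith [hxm.1, hx₀m.2]
    · refine absurd h (vth1_ne_zero hT (by simpa using hT) ?_ ?_)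
      · simp only [sub_re, ofReal_re]; linarith
      · simp only [sub_re, ofReal_re]; linarith [hxm.2, hx₀m.1]

lemma quotDerivNum_eq_zero_of_isLocalExtr (ha : 0 < a) (haT : a < T / 2) {x : ℝ}
    (h : IsLocalExtr (boundaryPhase (Real.exp (2 * a)) (Real.exp (-T))) x) :
    quotDerivNum T a x = 0 := by
  obtain ⟨d, hd, he⟩ := exists_hasDerivAt_boundaryPhase ha haT x
  rw [he, h.hasDerivAt_eq_zero hd]
  simp

/-- The image of the boundary under the phase. -/
lemma image_boundaryPhase (ha : 0 < a) (haT : a < T / 2) {γ x₀ : ℝ} (hγ : 0 < γ)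
    (hx₀ : x₀ ∈ Set.Ioo 0 (Real.pi / 2))
    (h₀ : boundaryPhase (Real.exp (2 * a)) (Real.exp (-T)) x₀ = γ)
    (hmax : ∀ x ∈ Set.Icc 0 (Real.pi / 2), boundaryPhase (Real.exp (2 * a)) (Real.exp (-T)) x ≤ γ) :
    quotDerivNum T a x₀ = 0 ∧
    boundaryPhase (Real.exp (2 * a)) (Real.exp (-T)) '' Set.Icc (-(Real.pi / 2)) (Real.pi / 2)
      = Set.Icc (-γ) γ := by
  set Φ := boundaryPhase (Real.exp (2 * a)) (Real.exp (-T)) with hΦ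
  have hR : 1 < Real.exp (2 * a) := Real.one_lt_exp_iff.2 (by linarith)
  have hq := (Real.exp_pos (-T)).le
  have hqR := exp_neg_mul_exp_lt_one haT
  have hc : Continuous Φ := continuous_boundaryPhase ha haT
  have hodd : ∀ x, Φ (-x) = -Φ x := boundaryPhase_neg hR hq hqR
  have hpi := Real.pi_pos
  have hcrit : quotDerivNum T a x₀ = 0 := by
    refine quotDerivNum_eq_zero_of_isLocalExtr ha haT (Or.inr ?_)
    filter_upwards [Icc_mem_nhds hx₀.1 hx₀.2] with x hx
    exact (hmax x hx).trans h₀.ge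
  -- A negative minimum would be interior, hence a critical point, hence x₀ by uniqueness; but there
  -- the phase is γ > 0.
  have hnonneg : ∀ x ∈ Set.Icc 0 (Real.pi / 2), 0 ≤ Φ x := by
    obtain ⟨x₁, hx₁, hmin⟩ := isCompact_Icc.exists_isMinOn
      (⟨0, le_rfl, by positivity⟩ : (Set.Icc 0 (Real.pi / 2)).Nonempty) hc.continuousOn
    suffices 0 ≤ Φ x₁ from fun x hx => this.trans (hmin hx)
    by_contra! hneg
    have h0 : x₁ ≠ 0 := by
      rintro rfl
      exact hneg.ne (boundaryPhase_zero hR hq hqR)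
    have h1 : x₁ ≠ Real.pi / 2 := by
      rintro rfl
      exact hneg.ne (boundaryPhase_pi_div_two hR hq hqR)
    have hm : x₁ ∈ Set.Ioo 0 (Real.pi / 2) :=
      ⟨lt_of_le_of_ne hx₁.1 h0.symm, lt_of_le_of_ne hx₁.2 h1⟩
    have hcrit₁ : quotDerivNum T a x₁ = 0 := by
      refine quotDerivNum_eq_zero_of_isLocalExtr ha haT (Or.inl ?_)
      filter_upwards [Icc_mem_nhds hm.1 hm.2] with x hx
      exact hmin hx
    rw [critical_unique ha haT hm hx₀ hcrit₁ hcrit, h₀] at hneg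
    linarith
  refine ⟨hcrit, Set.Subset.antisymm ?_ ?_⟩
  · rintro _ ⟨x, hx, rfl⟩
    rcases le_total 0 x with h | h
    · exact ⟨by linarith [hnonneg x ⟨h, hx.2⟩], hmax x ⟨h, hx.2⟩⟩
    · have hx' : -x ∈ Set.Icc 0 (Real.pi / 2) := ⟨by linarith, by linarith [hx.1]⟩
      have h1 := hnonneg _ hx'
      have h2 := hmax _ hx'
      rw [hodd] at h1
      rw [hodd] at h2
      exact ⟨by linarith, by linarith⟩
  · intro y hy
    have hiv := intermediate_value_Icc (by linarith [hx₀.1] : -x₀ ≤ x₀) hc.continuousOn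
    rw [hodd, h₀] at hiv
    obtain ⟨x, hx, hxy⟩ := hiv hy
    exact ⟨x, ⟨by linarith [hx.1, hx₀.2], by linarith [hx.2, hx₀.2]⟩, hxy⟩

/-! ### The conformal map -/

/-- The conformal map of the cylinder `{|Im w| < T / 2} / π ℤ` onto the field of the condenser. -/
def condenserMap (T a : ℝ) (w : ℂ) : ℂ :=
  exp (2 * a) * (vth4 T (w - I * T / 2 + I * a) / vth4 T (w - I * T / 2 - I * a))

lemma condenserMap_add_pi (T a : ℝ) (w : ℂ) : condenserMap T a (w + Real.pi) = condenserMap T a w := by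
  rw [condenserMap, condenserMap,
    show w + Real.pi - I * T / 2 + I * a = w - I * T / 2 + I * a + Real.pi by ring,
    show w + Real.pi - I * T / 2 - I * a = w - I * T / 2 - I * a + Real.pi by ring,
    vth4_add_pi, vth4_add_pi]

lemma vth4_add_I_mul (T : ℝ) (w : ℂ) : vth4 T (w + I * T) = -exp (T - 2 * I * w) * vth4 T w := by
  rw [vth4, vth4, show w + I * T + Real.pi / 2 = w + Real.pi / 2 + I * T by ring, vth3_add_I_mul,
    show (T : ℂ) - 2 * I * (w + Real.pi / 2) = T - 2 * I * w - Real.pi * I by ring,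
    exp_sub _ (Real.pi * I), exp_pi_mul_I]
  ring

lemma condenserMap_top (ha : 0 < a) (haT : a < T / 2) (x : ℝ) :
    condenserMap T a (x + I * T / 2)
      = (Real.exp (2 * a) : ℂ) * exp (I * boundaryPhase (Real.exp (2 * a)) (Real.exp (-T)) x) := by
  rw [exp_I_mul_boundaryPhase ha haT, condenserMap, add_sub_cancel_right]
  push_cast; rfl

/-- The quasi-period factors of numerator and denominator have quotient e^{−4a} when the strip is
crossed downwards. So the modulus drops from e^{2a} to e^{−2a} and the phase is unchanged. -/
lemma condenserMap_bottom (ha : 0 < a) (haT : a < T / 2) (x : ℝ) :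
    condenserMap T a (x - I * T / 2) = ((1 / Real.exp (2 * a) : ℝ) : ℂ)
      * exp (I * boundaryPhase (Real.exp (2 * a)) (Real.exp (-T)) x) := by
  rw [exp_I_mul_boundaryPhase ha haT, condenserMap]
  have h1 := vth4_add_I_mul T (x - I * T / 2 - I * T / 2 + I * a)
  have h2 := vth4_add_I_mul T (x - I * T / 2 - I * T / 2 - I * a)
  rw [show (x : ℂ) - I * T / 2 - I * T / 2 + I * a + I * T = x + I * a by ring] at h1
  rw [show (x : ℂ) - I * T / 2 - I * T / 2 - I * a + I * T = x - I * a by ring] at h2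
  rw [h1, h2, mul_div_mul_comm, neg_div_neg_eq, ← exp_sub, ← mul_assoc]
  congr 1
  push_cast
  rw [one_div, ← exp_neg, ← exp_add]
  congr 1
  linear_combination (4 * a : ℂ) * I_sq

lemma vth4_shift_eq_zero_iff (T : ℝ) (w : ℂ) : vth4 T (w - I * T / 2) = 0 ↔ vth1 T w = 0 := by
  have h := vth1_add_half T (w - I * T / 2)
  rw [sub_add_cancel] at h
  rw [h]
  simp [exp_ne_zero]

lemma vth1_add_ne_zero {w : ℂ} {b : ℝ} (hT : 0 < T) (hb : |b| < T / 2) (hw : |w.im| ≤ T / 2)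
    (hne : ∀ k : ℤ, w ≠ -(I * b) + k * Real.pi) : vth1 T (w + I * b) ≠ 0 := by
  intro h
  have him : |(w + I * b).im| < T := by
    simp only [add_im, mul_im, I_re, I_im, ofReal_re, ofReal_im, zero_mul, one_mul, zero_add]
    exact (abs_add_le _ _).trans_lt (by linarith)
  obtain ⟨k, hk⟩ := eq_int_mul_pi_of_vth1_eq_zero hT him h
  exact hne k (by rw [← hk]; ring)

lemma condenserMap_num_ne_zero (ha : 0 < a) (haT : a < T / 2) {w : ℂ} (hw : |w.im| ≤ T / 2)
    (hne : ∀ k : ℤ, w ≠ -(I * a) + k * Real.pi) : vth4 T (w - I * T / 2 + I * a) ≠ 0 := by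
  rw [show w - I * T / 2 + I * a = w + I * a - I * T / 2 by ring, Ne, vth4_shift_eq_zero_iff]
  exact vth1_add_ne_zero (by linarith) (by rwa [abs_of_pos ha]) hw hne

lemma condenserMap_denom_ne_zero (ha : 0 < a) (haT : a < T / 2) {w : ℂ} (hw : |w.im| ≤ T / 2)
    (hne : ∀ k : ℤ, w ≠ I * a + k * Real.pi) : vth4 T (w - I * T / 2 - I * a) ≠ 0 := by
  rw [show w - I * T / 2 - I * a = w + I * ((-a : ℝ) : ℂ) - I * T / 2 by push_cast; ring, Ne,
    vth4_shift_eq_zero_iff]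
  refine vth1_add_ne_zero (by linarith) (by rwa [abs_neg, abs_of_pos ha]) hw fun k => ?_
  simpa using hne k

lemma condenserMap_eq_zero_iff (ha : 0 < a) (haT : a < T / 2) {w : ℂ} (hw : |w.im| ≤ T / 2)
    (hne : ∀ k : ℤ, w ≠ I * a + k * Real.pi) :
    condenserMap T a w = 0 ↔ ∃ k : ℤ, w = -(I * a) + k * Real.pi := by
  constructor
  · intro h
    by_contra! hk
    exact mul_ne_zero (exp_ne_zero _) (div_ne_zero (condenserMap_num_ne_zero ha haT hw hk)
      (condenserMap_denom_ne_zero ha haT hw hne)) h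
  · rintro ⟨k, rfl⟩
    rw [condenserMap, show -(I * (a : ℂ)) + k * Real.pi - I * T / 2 + I * a
      = k * Real.pi - I * T / 2 by ring, (vth4_shift_eq_zero_iff T _).2 (vth1_int_mul_pi T k)]
    simp

lemma hasDerivAt_condenserMap (ha : 0 < a) (haT : a < T / 2) {w : ℂ} (hw : |w.im| ≤ T / 2)
    (hne : ∀ k : ℤ, w ≠ I * a + k * Real.pi) :
    HasDerivAt (condenserMap T a) (exp (2 * a) * (quotDerivNum T a (w - I * T / 2)
      / vth4 T (w - I * T / 2 - I * a) ^ 2)) w :=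
  ((hasDerivAt_vth4_quot (by linarith) (condenserMap_denom_ne_zero ha haT hw hne)).comp_sub_const
    w (I * T / 2)).const_mul _

/-- A critical point inside, lowered by iT/2, would differ from ±x₀ by a zero of ϑ₁. Its imaginary
part lies in (−T, 0), where ϑ₁ does not vanish. -/
lemma deriv_condenserMap_ne_zero (ha : 0 < a) (haT : a < T / 2) {x₀ : ℝ}
    (hx₀ : quotDerivNum T a x₀ = 0) {w : ℂ} (hw : |w.im| < T / 2)
    (hne : ∀ k : ℤ, w ≠ I * a + k * Real.pi) : deriv (condenserMap T a) w ≠ 0 := by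
  have hT : 0 < T := by linarith
  rw [(hasDerivAt_condenserMap ha haT hw.le hne).deriv]
  refine mul_ne_zero (exp_ne_zero _) (div_ne_zero (fun h => ?_)
    (pow_ne_zero 2 (condenserMap_denom_ne_zero ha haT hw.le hne)))
  obtain ⟨h1, h2⟩ := abs_lt.1 hw
  have e : (I * (T : ℂ) / 2) = ((T / 2 : ℝ) : ℂ) * I := by push_cast; ring
  rcases vth1_add_mul_vth1_sub_of_critical ha haT h hx₀ with h | h
  · have him : (w - I * T / 2 + x₀).im = w.im - T / 2 := by rw [e]; simp
    obtain ⟨k, hk⟩ := eq_int_mul_pi_of_vth1_eq_zero hT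
      (abs_lt.2 ⟨by rw [him]; linarith, by rw [him]; linarith⟩) h
    have := congrArg im hk
    rw [him] at this
    simp at this
    linarith
  · have him : (w - I * T / 2 - x₀).im = w.im - T / 2 := by rw [e]; simp
    obtain ⟨k, hk⟩ := eq_int_mul_pi_of_vth1_eq_zero hT
      (abs_lt.2 ⟨by rw [him]; linarith, by rw [him]; linarith⟩) h
    have := congrArg im hk
    rw [him] at this
    simp at this
    linarith

/-- The map has a pole at `ia`. -/
lemma tendsto_inv_condenserMap (ha : 0 < a) (haT : a < T / 2) :
    Filter.Tendsto (fun w => (condenserMap T a w)⁻¹) (𝓝 (I * a)) (𝓝 0) := by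
  have hT : 0 < T := by linarith
  have hn : vth4 T (I * a - I * T / 2 + I * a) ≠ 0 := by
    refine condenserMap_num_ne_zero ha haT (by simpa [abs_of_pos ha] using haT.le) fun k hk => ?_
    have := congrArg im hk
    simp at this
    linarith
  have hd : vth4 T (I * a - I * T / 2 - I * a) = 0 := by
    rw [show I * (a : ℂ) - I * T / 2 - I * a = 0 - I * T / 2 by ring, vth4_shift_eq_zero_iff,
      vth1_zero]
  have hc := (differentiable_vth4 hT).continuous
  have h : ContinuousAt (fun w => exp (-(2 * a)) * (vth4 T (w - I * T / 2 - I * a)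
      / vth4 T (w - I * T / 2 + I * a))) (I * a) := by
    refine continuousAt_const.mul (ContinuousAt.div ?_ ?_ hn)
    · exact (hc.comp (by fun_prop : Continuous fun w : ℂ => w - I * T / 2 - I * a)).continuousAt
    · exact (hc.comp (by fun_prop : Continuous fun w : ℂ => w - I * T / 2 + I * a)).continuousAt
  have h0 := h.tendsto
  rw [hd, zero_div, mul_zero] at h0
  refine h0.congr fun w => ?_
  rw [condenserMap, mul_inv, inv_div, exp_neg]

end

/-! ### Strip maps: bijectivity onto the complement of the plates -/

/-- A `π`-periodic meromorphic function on the closed strip `{|Im w| ≤ h}`, locally univalent in the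
open strip, with a single pole `p` and a single zero modulo the period, which maps the boundary
onto a set `E` with connected dense complement. -/
structure IsStripMap (G : ℂ → ℂ) (h : ℝ) (p : ℂ) (E : Set ℂ) : Prop where
  periodic : Function.Periodic G Real.pi
  pole_re : p.re = 0
  pole_im : |p.im| < h
  differentiableAt : ∀ w : ℂ, |w.im| ≤ h → sin (w - p) ≠ 0 → DifferentiableAt ℂ G w
  deriv_ne_zero : ∀ w : ℂ, |w.im| < h → sin (w - p) ≠ 0 → deriv G w ≠ 0
  tendsto_pole : Filter.Tendsto (fun w => ‖G w‖) (𝓝[≠] p) Filter.atTop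
  map_boundary : ∀ w : ℂ, |w.im| = h → G w ∈ E
  boundary_surj : ∀ e ∈ E, ∃ w : ℂ, |w.im| = h ∧ G w = e
  dense_compl : Dense Eᶜ
  isPreconnected_compl : IsPreconnected Eᶜ
  zero_notMem : (0 : ℂ) ∉ E
  exists_zero : ∃ w : ℂ, |w.im| < h ∧ sin (w - p) ≠ 0 ∧ G w = 0
  zero_unique : ∀ w w' : ℂ, |w.im| < h → sin (w - p) ≠ 0 → |w'.im| < h → sin (w' - p) ≠ 0 →
    G w = 0 → G w' = 0 → sin (w' - w) = 0

/-- The open strip without the points congruent to `p`. -/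
def puncturedStrip (h : ℝ) (p : ℂ) : Set ℂ := {w | |w.im| < h ∧ sin (w - p) ≠ 0}

lemma isOpen_puncturedStrip (h : ℝ) (p : ℂ) : IsOpen (puncturedStrip h p) := by
  have h1 : Continuous fun w : ℂ => |w.im| := by fun_prop
  have h2 : Continuous fun w : ℂ => sin (w - p) := continuous_sin.comp (by fun_prop)
  exact (isOpen_lt h1 continuous_const).inter (isOpen_ne_fun h2 continuous_const)

/-- Throughout, congruence of w and w' modulo the period π is expressed by sin(w − w') = 0. -/
lemma sin_int_mul_pi' (k : ℤ) : sin (k * Real.pi) = 0 := sin_eq_zero_iff.2 ⟨k, rfl⟩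

lemma sin_sub_int_mul_pi_eq_zero_iff (x : ℂ) (k : ℤ) : sin (x - k * Real.pi) = 0 ↔ sin x = 0 := by
  rw [sin_eq_zero_iff, sin_eq_zero_iff]
  constructor
  · rintro ⟨n, hn⟩; exact ⟨n + k, by push_cast; linear_combination hn⟩
  · rintro ⟨n, hn⟩; exact ⟨n - k, by push_cast; linear_combination hn⟩

lemma sub_int_mul_pi_mem_puncturedStrip {h : ℝ} {p w : ℂ} (hw : w ∈ puncturedStrip h p) (k : ℤ) :
    w - k * Real.pi ∈ puncturedStrip h p := by
  refine ⟨by simpa using hw.1, ?_⟩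
  rw [sub_right_comm, Ne, sin_sub_int_mul_pi_eq_zero_iff]
  exact hw.2

lemma exists_int_sub_mul_pi_re_mem (w : ℂ) :
    ∃ k : ℤ, (w - k * Real.pi).re ∈ Set.Ico (-(Real.pi / 2)) (Real.pi / 2) := by
  have hpi := Real.pi_pos
  refine ⟨⌊w.re / Real.pi + 1 / 2⌋, ?_⟩
  have h1 := Int.floor_le (w.re / Real.pi + 1 / 2)
  have h2 := Int.lt_floor_add_one (w.re / Real.pi + 1 / 2)
  set k := ⌊w.re / Real.pi + 1 / 2⌋
  have e : w.re / Real.pi * Real.pi = w.re := div_mul_cancel₀ _ hpi.ne'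
  simp only [sub_re, mul_re, intCast_re, intCast_im, ofReal_re, ofReal_im, mul_zero, sub_zero]
  constructor <;> nlinarith

namespace IsStripMap

variable {G : ℂ → ℂ} {h : ℝ} {p : ℂ} {E : Set ℂ}

lemma map_sub_int_mul_pi (H : IsStripMap G h p E) (w : ℂ) (k : ℤ) : G (w - k * Real.pi) = G w :=
  H.periodic.sub_int_mul_eq k

lemma differentiableOn (H : IsStripMap G h p E) : DifferentiableOn ℂ G (puncturedStrip h p) :=
  fun w hw => (H.differentiableAt w hw.1.le hw.2).differentiableWithinAt

lemma hasStrictDerivAt (H : IsStripMap G h p E) {w : ℂ} (hw : w ∈ puncturedStrip h p) :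
    HasStrictDerivAt G (deriv G w) w :=
  (H.differentiableOn.analyticAt ((isOpen_puncturedStrip h p).mem_nhds hw)).hasStrictDerivAt

lemma map_nhds_eq (H : IsStripMap G h p E) {w : ℂ} (hw : w ∈ puncturedStrip h p) :
    Filter.map G (𝓝 w) = 𝓝 (G w) :=
  (H.hasStrictDerivAt hw).map_nhds_eq (H.deriv_ne_zero w hw.1 hw.2)

/-- The local inverses of the map. -/
lemma exists_openPartialHomeomorph (H : IsStripMap G h p E) {w : ℂ}
    (hw : w ∈ puncturedStrip h p) : ∃ e : OpenPartialHomeomorph ℂ ℂ, w ∈ e.source ∧ ⇑e = G := by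
  have hf := (H.hasStrictDerivAt hw).hasStrictFDerivAt_equiv (H.deriv_ne_zero w hw.1 hw.2)
  exact ⟨hf.toOpenPartialHomeomorph G, hf.mem_toOpenPartialHomeomorph_source, rfl⟩

lemma image_mem_nhds (H : IsStripMap G h p E) {w : ℂ} (hw : w ∈ puncturedStrip h p) {N : Set ℂ}
    (hN : N ∈ 𝓝 w) : G '' N ∈ 𝓝 (G w) := by
  rw [← H.map_nhds_eq hw]; exact Filter.image_mem_map hN

lemma isOpen_image (H : IsStripMap G h p E) {N : Set ℂ} (hN : IsOpen N)
    (hs : N ⊆ puncturedStrip h p) : IsOpen (G '' N) := by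
  rw [isOpen_iff_mem_nhds]
  rintro _ ⟨w, hw, rfl⟩
  exact H.image_mem_nhds (hs hw) (hN.mem_nhds hw)

/-- Limits of preimages of points converging in the complement of `E`. -/
lemma exists_subseq_tendsto (H : IsStripMap G h p E) {w : ℕ → ℂ} {z : ℂ}
    (hw : ∀ n, w n ∈ puncturedStrip h p)
    (hre : ∀ n, (w n).re ∈ Set.Icc (-(Real.pi / 2)) (Real.pi / 2))
    (hlim : Filter.Tendsto (fun n => G (w n)) Filter.atTop (𝓝 z)) (hz : z ∉ E) :
    ∃ w₀ ∈ puncturedStrip h p, G w₀ = z ∧ ∃ φ : ℕ → ℕ, StrictMono φ ∧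
      Filter.Tendsto (w ∘ φ) Filter.atTop (𝓝 w₀) := by
  have hpi := Real.pi_pos
  have hK : IsCompact (Set.Icc (-(Real.pi / 2)) (Real.pi / 2) ×ℂ Set.Icc (-h) h) :=
    isCompact_Icc.reProdIm isCompact_Icc
  obtain ⟨w₀, hw₀, φ, hφ, hlim₀⟩ := hK.tendsto_subseq (x := w) fun n =>
    ⟨hre n, abs_le.1 (hw n).1.le⟩
  rw [mem_reProdIm] at hw₀
  have him : |w₀.im| ≤ h := abs_le.2 hw₀.2
  have hlimφ := hlim.comp hφ.tendsto_atTop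
  -- The limit cannot be the pole, because the values converge; nor, below, a boundary point,
  -- because its value would lie in `E`.
  have hsin : sin (w₀ - p) ≠ 0 := by
    intro hs
    obtain ⟨k, hk⟩ := sin_eq_zero_iff.1 hs
    have hkre := congrArg re hk
    simp only [sub_re, H.pole_re, mul_re, intCast_re, intCast_im, ofReal_re, ofReal_im, mul_zero,
      sub_zero] at hkre
    have hk0 : k = 0 := by
      have h1 : (k : ℝ) < 1 := by by_contra! hc; nlinarith [hw₀.1.2]
      have h2 : (-1 : ℝ) < k := by by_contra! hc; nlinarith [hw₀.1.1]
      have h1' : k < 1 := by exact_mod_cast h1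
      have h2' : -1 < k := by exact_mod_cast h2
      omega
    rw [hk0, Int.cast_zero, zero_mul, sub_eq_zero] at hk
    rw [hk] at hlim₀
    have hne : Filter.Tendsto (w ∘ φ) Filter.atTop (𝓝[≠] p) := by
      refine tendsto_nhdsWithin_iff.2 ⟨hlim₀, Filter.Eventually.of_forall fun n hn => ?_⟩
      have := (hw (φ n)).2
      rw [show w (φ n) = p from hn, sub_self, sin_zero] at this
      exact this rfl
    exact not_tendsto_nhds_of_tendsto_atTop (H.tendsto_pole.comp hne) _ hlimφ.norm
  have hG : G w₀ = z := tendsto_nhds_unique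
    ((H.differentiableAt w₀ him hsin).continuousAt.tendsto.comp hlim₀) hlimφ
  refine ⟨w₀, ⟨lt_of_le_of_ne him fun hb => hz ?_, hsin⟩, hG, φ, hφ, hlim₀⟩
  rw [← hG]
  exact H.map_boundary w₀ hb

/-- The image is open, is closed relative to `Eᶜ` by compactness modulo the period, and contains 0;
`Eᶜ` is connected. -/
lemma compl_subset_image (H : IsStripMap G h p E) : Eᶜ ⊆ G '' puncturedStrip h p := by
  refine H.isPreconnected_compl.subset_of_closure_inter_subset
    (H.isOpen_image (isOpen_puncturedStrip h p) subset_rfl) ?_ ?_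
  · obtain ⟨w, h1, h2, h3⟩ := H.exists_zero
    exact ⟨0, H.zero_notMem, w, ⟨h1, h2⟩, h3⟩
  · rintro z ⟨hz, hzE⟩
    obtain ⟨z', hz', hlim⟩ := mem_closure_iff_seq_limit.1 hz
    choose v hv hvz using hz'
    choose k hk using fun n => exists_int_sub_mul_pi_re_mem (v n)
    obtain ⟨w₀, hw₀, hG, -⟩ := H.exists_subseq_tendsto (w := fun n => v n - k n * Real.pi)
      (fun n => sub_int_mul_pi_mem_puncturedStrip (hv n) (k n))
      (fun n => ⟨(hk n).1, (hk n).2.le⟩) (z := z)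
      (hlim.congr fun n => by rw [H.map_sub_int_mul_pi, hvz]) hzE
    exact ⟨w₀, hw₀, hG⟩

/-- The map is injective modulo the period over the complement of `E`. -/
lemma sin_sub_eq_zero_of_map_eq (H : IsStripMap G h p E) {w w' : ℂ}
    (hw : w ∈ puncturedStrip h p) (hw' : w' ∈ puncturedStrip h p) (he : G w = G w')
    (hE : G w ∉ E) : sin (w' - w) = 0 := by
  by_contra hne
  -- The values taken at two incongruent points. This set is open, and closed relative to `Eᶜ`; were
  -- it to meet `Eᶜ`, it would contain 0, which is taken only once.
  set D : Set ℂ := {z | ∃ v ∈ puncturedStrip h p, ∃ v' ∈ puncturedStrip h p,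
    G v = z ∧ G v' = z ∧ sin (v' - v) ≠ 0} with hD
  have hopen : IsOpen D := by
    rw [isOpen_iff_mem_nhds]
    rintro z ⟨v, hv, v', hv', hz, hz', hs⟩
    have hc : Continuous fun x : ℂ × ℂ => sin (x.2 - x.1) := continuous_sin.comp (by fun_prop)
    have hev : {x : ℂ × ℂ | sin (x.2 - x.1) ≠ 0} ∈ 𝓝 (v, v') :=
      (isOpen_ne_fun hc continuous_const).mem_nhds hs
    obtain ⟨N, hN, N', hN', hNN⟩ := mem_nhds_prod_iff.1 hev
    have hU := isOpen_puncturedStrip h p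
    have m1 := H.image_mem_nhds hv (Filter.inter_mem hN (hU.mem_nhds hv))
    have m2 := H.image_mem_nhds hv' (Filter.inter_mem hN' (hU.mem_nhds hv'))
    rw [hz] at m1
    rw [hz'] at m2
    filter_upwards [m1, m2]
    rintro y ⟨x, hx, hxy⟩ ⟨x', hx', hxy'⟩
    have h3 : (x, x') ∈ N ×ˢ N' := Set.mk_mem_prod hx.1 hx'.1
    have h4 := hNN h3
    rw [Set.mem_ofPred_eq] at h4
    exact ⟨x, hx.2, x', hx'.2, hxy, hxy', h4⟩
  have hmem : G w ∈ D := ⟨w, hw, w', hw', rfl, he.symm, hne⟩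
  have hsub : Eᶜ ⊆ D := by
    refine H.isPreconnected_compl.subset_of_closure_inter_subset hopen ⟨G w, hE, hmem⟩ ?_
    rintro z ⟨hz, hzE⟩
    obtain ⟨z', hz', hlim⟩ := mem_closure_iff_seq_limit.1 hz
    choose v hv v' hv' hvz hvz' hs using hz'
    choose k hk using fun n => exists_int_sub_mul_pi_re_mem (v n)
    choose k' hk' using fun n => exists_int_sub_mul_pi_re_mem (v' n)
    obtain ⟨x, hx, hGx, φ, hφ, hlimx⟩ := H.exists_subseq_tendsto
      (w := fun n => v n - k n * Real.pi)
      (fun n => sub_int_mul_pi_mem_puncturedStrip (hv n) (k n))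
      (fun n => ⟨(hk n).1, (hk n).2.le⟩) (z := z)
      (hlim.congr fun n => by rw [H.map_sub_int_mul_pi, hvz]) hzE
    obtain ⟨x', hx', hGx', ψ, hψ, hlimx'⟩ := H.exists_subseq_tendsto
      (w := fun n => v' (φ n) - k' (φ n) * Real.pi)
      (fun n => sub_int_mul_pi_mem_puncturedStrip (hv' _) _)
      (fun n => ⟨(hk' _).1, (hk' _).2.le⟩) (z := z)
      ((hlim.comp hφ.tendsto_atTop).congr fun n => by
        rw [H.map_sub_int_mul_pi, hvz']; rfl) hzE
    -- If the two limits were congruent, local injectivity at `x` would make the preimages in the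
    -- sequence congruent already.
    refine ⟨x, hx, x', hx', hGx, hGx', fun hsx => ?_⟩
    obtain ⟨m, hm⟩ := sin_eq_zero_iff.1 hsx
    obtain ⟨e, hxe, heG⟩ := H.exists_openPartialHomeomorph hx
    have t1 : Filter.Tendsto (fun n => v (φ (ψ n)) - k (φ (ψ n)) * Real.pi) Filter.atTop (𝓝 x) :=
      hlimx.comp hψ.tendsto_atTop
    have t2 : Filter.Tendsto (fun n => v' (φ (ψ n)) - k' (φ (ψ n)) * Real.pi - m * Real.pi)
        Filter.atTop (𝓝 x) := by
      have := hlimx'.sub_const (m * Real.pi : ℂ)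
      rwa [show x' - m * Real.pi = x by linear_combination hm] at this
    obtain ⟨n, hn1, hn2⟩ := ((t1.eventually (e.open_source.mem_nhds hxe)).and
      (t2.eventually (e.open_source.mem_nhds hxe))).exists
    have heq := e.injOn hn1 hn2 (by
      rw [heG, H.map_sub_int_mul_pi, H.map_sub_int_mul_pi, H.map_sub_int_mul_pi, hvz, hvz'])
    apply hs (φ (ψ n))
    rw [show v' (φ (ψ n)) - v (φ (ψ n))
      = ((m + k' (φ (ψ n)) - k (φ (ψ n)) : ℤ) : ℂ) * Real.pi by
        push_cast; linear_combination -heq]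
    exact sin_int_mul_pi' _
  obtain ⟨v, hv, v', hv', hz, hz', hs⟩ := hsub H.zero_notMem
  exact hs (H.zero_unique v v' hv.1 hv.2 hv'.1 hv'.2 hz hz')

/-- A value of `E` taken at an interior point is also taken at a boundary point `b`. Then a narrower
strip and points near the boundary have overlapping open images; by density the overlap meets `Eᶜ`,
where congruent preimages would have to share one imaginary part. -/
lemma map_notMem (H : IsStripMap G h p E) {w : ℂ} (hw : w ∈ puncturedStrip h p) : G w ∉ E := by
  intro hwE
  have hU := isOpen_puncturedStrip h p
  obtain ⟨b, hb, hGb⟩ := H.boundary_surj _ hwE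
  have hh : 0 < h := (abs_nonneg _).trans_lt H.pole_im
  obtain ⟨h', hwh', hh'⟩ := exists_between hw.1
  set W : Set ℂ := {v | |v.im| < h'} ∩ puncturedStrip h p with hW
  have hWo : IsOpen W := (isOpen_lt (by fun_prop) continuous_const).inter hU
  have hGW : IsOpen (G '' W) := H.isOpen_image hWo Set.inter_subset_right
  have hbsin : sin (b - p) ≠ 0 := by
    intro hs
    obtain ⟨k, hk⟩ := sin_eq_zero_iff.1 hs
    have := congrArg im hk
    simp only [sub_im, mul_im, intCast_re, intCast_im, ofReal_re, ofReal_im, mul_zero, zero_mul,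
      add_zero] at this
    have hbp : b.im = p.im := by linarith
    rw [hbp] at hb
    exact H.pole_im.ne hb
  have hGc : ContinuousAt G b := (H.differentiableAt b hb.le hbsin).continuousAt
  have hmem : G ⁻¹' (G '' W) ∈ 𝓝 b := hGc (hGW.mem_nhds (by rw [hGb]; exact ⟨w, ⟨hwh', hw⟩, rfl⟩))
  have hs1 : {v : ℂ | sin (v - p) ≠ 0} ∈ 𝓝 b :=
    (isOpen_ne_fun (continuous_sin.comp (by fun_prop)) continuous_const).mem_nhds hbsin
  have hs2 : {v : ℂ | h' < |v.im|} ∈ 𝓝 b :=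
    (isOpen_lt continuous_const (by fun_prop)).mem_nhds (by simpa [hb] using hh')
  obtain ⟨v, hv1, hv2, hv3, hv4⟩ : ∃ v : ℂ, v ∈ G ⁻¹' (G '' W) ∧ sin (v - p) ≠ 0 ∧ h' < |v.im| ∧
      |v.im| < h := by
    have ht : Filter.Tendsto (fun t : ℝ => b - (t : ℂ) * (b.im * I)) (𝓝[>] 0) (𝓝 b) := by
      have : Continuous fun t : ℝ => b - (t : ℂ) * (b.im * I) := by fun_prop
      have h0 := this.tendsto 0
      simp only [ofReal_zero, zero_mul, sub_zero] at h0
      exact h0.mono_left nhdsWithin_le_nhds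
    have hlt : ∀ᶠ t : ℝ in 𝓝[>] 0, t < 1 := nhdsWithin_le_nhds (gt_mem_nhds one_pos)
    have hev := ht.eventually (Filter.inter_mem (Filter.inter_mem hmem hs1) hs2)
    obtain ⟨t, ⟨⟨h1, h2⟩, h3⟩, h4, h5⟩ := (hev.and (hlt.and self_mem_nhdsWithin)).exists
    refine ⟨_, h1, h2, h3, ?_⟩
    have h5' : (0 : ℝ) < t := h5
    have : (b - (t : ℂ) * (b.im * I)).im = (1 - t) * b.im := by simp; ring
    rw [this, abs_mul, hb, abs_of_pos (by linarith)]
    nlinarith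
  have hvU : v ∈ puncturedStrip h p := ⟨hv4, hv2⟩
  set N : Set ℂ := ({u | h' < |u.im|} ∩ puncturedStrip h p) with hN
  have hNo : IsOpen N := (isOpen_lt continuous_const (by fun_prop)).inter hU
  have hGN := H.isOpen_image hNo Set.inter_subset_right
  obtain ⟨z, ⟨hzW, hzN⟩, hzE⟩ := H.dense_compl.inter_open_nonempty (G '' W ∩ G '' N)
    (hGW.inter hGN) ⟨G v, hv1, v, ⟨hv3, hvU⟩, rfl⟩
  obtain ⟨x, hx, rfl⟩ := hzW
  obtain ⟨y, hy, hyx⟩ := hzN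
  obtain ⟨k, hk⟩ := sin_eq_zero_iff.1 (H.sin_sub_eq_zero_of_map_eq hx.2 hy.2 hyx.symm hzE)
  have := congrArg im hk
  simp only [sub_im, mul_im, intCast_re, intCast_im, ofReal_re, ofReal_im, mul_zero, zero_mul,
    add_zero] at this
  have hyx' : y.im = x.im := by linarith
  have h1 : |x.im| < h' := hx.1
  have h2 : h' < |y.im| := hy.1
  rw [hyx'] at h2
  exact lt_asymm h1 h2

lemma image_eq (H : IsStripMap G h p E) : G '' puncturedStrip h p = Eᶜ := by
  refine Set.Subset.antisymm ?_ H.compl_subset_image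
  rintro _ ⟨w, hw, rfl⟩
  exact H.map_notMem hw

end IsStripMap

/-! ### The plates in the plane and their connected complement -/

/-- The circular arc of radius `r` with arguments in `[-γ, γ]`, in the plane. -/
def planeArc (r γ : ℝ) : Set ℂ := (fun φ : ℝ => (r : ℂ) * exp (I * φ)) '' Set.Icc (-γ) γ

lemma circArc_eq_image (r γ : ℝ) : circArc r γ = (fun z : ℂ => (z : OnePoint ℂ)) '' planeArc r γ := by
  rw [circArc, planeArc, Set.image_image]

lemma coe_mem_circArc {r γ : ℝ} {z : ℂ} : (z : OnePoint ℂ) ∈ circArc r γ ↔ z ∈ planeArc r γ := by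
  rw [circArc_eq_image]
  exact OnePoint.coe_injective.mem_set_image

lemma isCompact_planeArc (r γ : ℝ) : IsCompact (planeArc r γ) :=
  isCompact_Icc.image (by fun_prop)

lemma norm_of_mem_planeArc {r γ : ℝ} (hr : 0 < r) {z : ℂ} (hz : z ∈ planeArc r γ) : ‖z‖ = r := by
  obtain ⟨φ, -, rfl⟩ := hz
  simp only
  rw [norm_mul, mul_comm I, norm_exp_ofReal_mul_I, norm_real, Real.norm_of_nonneg hr.le, mul_one]

lemma volume_planeArc {r : ℝ} (γ : ℝ) (hr : 0 < r) : volume (planeArc r γ) = 0 :=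
  measure_mono_null (fun z hz => by
    rw [mem_sphere_zero_iff_norm]; exact norm_of_mem_planeArc hr hz)
    (Measure.addHaar_sphere volume (0 : ℂ) r)

/-- The two plates of `arcCondenser R γ`, in the plane. -/
def planePlates (R γ : ℝ) : Set ℂ := planeArc (1 / R) γ ∪ planeArc R γ

section

variable {R γ : ℝ}

lemma volume_planePlates (hR : 0 < R) : volume (planePlates R γ) = 0 :=
  measure_union_null (volume_planeArc γ (by positivity)) (volume_planeArc γ hR)

lemma isClosed_planePlates (R γ : ℝ) : IsClosed (planePlates R γ) :=
  ((isCompact_planeArc _ _).union (isCompact_planeArc _ _)).isClosed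

lemma norm_of_mem_planePlates (hR : 0 < R) {z : ℂ} (hz : z ∈ planePlates R γ) :
    ‖z‖ = 1 / R ∨ ‖z‖ = R :=
  hz.imp (norm_of_mem_planeArc (by positivity)) (norm_of_mem_planeArc hR)

lemma zero_notMem_planePlates (hR : 0 < R) : (0 : ℂ) ∉ planePlates R γ := by
  intro h
  have h1 : 0 < 1 / R := by positivity
  rcases norm_of_mem_planePlates hR h with h | h <;> rw [norm_zero] at h <;> linarith

lemma dense_compl_planePlates (hR : 0 < R) : Dense (planePlates R γ)ᶜ := by
  rw [← interior_eq_empty_iff_dense_compl]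
  exact Measure.interior_eq_empty_of_null (volume_planePlates hR)

lemma mem_planeArc_of_norm_of_arg {r : ℝ} {z : ℂ} (h : ‖z‖ = r) (ha : arg z ∈ Set.Icc (-γ) γ) :
    z ∈ planeArc r γ := by
  refine ⟨arg z, ha, ?_⟩
  simp only
  rw [← h, mul_comm I, norm_mul_exp_arg_mul_I]

lemma exp_notMem_planePlates_of_re (hR : 0 < R) {w : ℂ} (h1 : w.re ≠ Real.log R)
    (h2 : w.re ≠ -Real.log R) : exp w ∉ planePlates R γ := by
  intro h
  rcases norm_of_mem_planePlates hR h with h | h <;> rw [norm_exp] at h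
  · apply h2
    rw [← Real.log_inv, ← one_div, ← h, Real.log_exp]
  · apply h1
    rw [← h, Real.log_exp]

lemma exp_notMem_planeArc_of_im {r : ℝ} (hr : 0 < r) {w : ℂ} (h1 : γ < w.im)
    (h2 : w.im < 2 * Real.pi - γ) : exp w ∉ planeArc r γ := by
  rintro ⟨φ, hφ, he⟩
  have he' : exp ((Real.log r : ℂ) + I * φ) = exp w := by
    rw [exp_add, ← ofReal_exp, Real.exp_log hr]; exact he
  obtain ⟨n, hn⟩ := exp_eq_exp_iff_exists_int.1 he'
  have him := congrArg im hn
  simp at him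
  have hpi := Real.pi_pos
  have a1 : (n : ℝ) < 0 := by by_contra! hc; nlinarith [hφ.2]
  have a2 : (-1 : ℝ) < n := by by_contra! hc; nlinarith [hφ.1]
  have a1' : n < 0 := by exact_mod_cast a1
  have a2' : -1 < n := by exact_mod_cast a2
  omega

/-- In logarithmic coordinates the two half-planes and the vertical strip off the circles are joined
by the horizontal strip around Im w = π, which represents the gaps in the arcs. The exponential
image misses only 0, which is recovered by taking the closure. -/
lemma isPreconnected_compl_planePlates (hR : 1 < R) (hγπ : γ < Real.pi) :
    IsPreconnected (planePlates R γ)ᶜ := by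
  have hR0 : 0 < R := by linarith
  have hL : 0 < Real.log R := Real.log_pos hR
  set L := Real.log R with hLdef
  set B : Set ℂ := {w | γ < w.im} ∩ {w | w.im < 2 * Real.pi - γ} with hB
  set A₁ : Set ℂ := {w | w.re < -L} with hA₁
  set A₂ : Set ℂ := {w | -L < w.re} ∩ {w | w.re < L} with hA₂
  set A₃ : Set ℂ := {w | L < w.re} with hA₃
  have cB : IsPreconnected B :=
    ((convex_halfSpace_im_gt γ).inter (convex_halfSpace_im_lt _)).isPreconnected
  have c₁ : IsPreconnected A₁ := (convex_halfSpace_re_lt _).isPreconnected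
  have c₂ : IsPreconnected A₂ :=
    ((convex_halfSpace_re_gt _).inter (convex_halfSpace_re_lt _)).isPreconnected
  have c₃ : IsPreconnected A₃ := (convex_halfSpace_re_gt _).isPreconnected
  have hmemB : ∀ t : ℝ, ((t : ℂ) + Real.pi * I) ∈ B := fun t => by
    constructor
    · simpa using hγπ
    · show ((t : ℂ) + Real.pi * I).im < 2 * Real.pi - γ
      simp; linarith
  have cW : IsPreconnected (((B ∪ A₁) ∪ A₂) ∪ A₃) := by
    refine IsPreconnected.union (((L + 1 : ℝ) : ℂ) + Real.pi * I)
      (Or.inl (Or.inl (hmemB _))) ?_ ?_ c₃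
    · show L < _
      simp
    refine IsPreconnected.union (((0 : ℝ) : ℂ) + Real.pi * I) (Or.inl (hmemB _)) ?_ ?_ c₂
    · constructor
      · show -L < _
        simpa using hL
      · show _ < L
        simpa using hL
    refine IsPreconnected.union (((-L - 1 : ℝ) : ℂ) + Real.pi * I) (hmemB _) ?_ cB c₁
    show _ < -L
    simp
  have himg := cW.image exp continuous_exp.continuousOn
  refine himg.subset_closure ?_ ?_
  · rintro _ ⟨w, hw, rfl⟩
    rcases hw with ((hw | hw) | hw) | hw
    · rintro (h | h)
      · exact exp_notMem_planeArc_of_im (by positivity) hw.1 hw.2 h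
      · exact exp_notMem_planeArc_of_im hR0 hw.1 hw.2 h
    · have hw' : w.re < -L := hw
      exact exp_notMem_planePlates_of_re hR0 (by linarith) hw'.ne
    · have hw1 : -L < w.re := hw.1
      have hw2 : w.re < L := hw.2
      exact exp_notMem_planePlates_of_re hR0 hw2.ne hw1.ne'
    · have hw' : L < w.re := hw
      exact exp_notMem_planePlates_of_re hR0 hw'.ne' (by linarith)
  · have hsub : (planePlates R γ)ᶜ ∩ {0}ᶜ ⊆ exp '' (((B ∪ A₁) ∪ A₂) ∪ A₃) := by
      rintro z ⟨hz, hz0⟩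
      have hz0' : z ≠ 0 := hz0
      have hlog : exp (log z) = z := exp_log hz0'
      have hn : 0 < ‖z‖ := norm_pos_iff.2 hz0'
      have hcase : (‖z‖ = 1 / R ∨ ‖z‖ = R) → z ∈ exp '' (((B ∪ A₁) ∪ A₂) ∪ A₃) := by
        intro hor
        have harg : arg z ∉ Set.Icc (-γ) γ := fun ha => hz
          (hor.imp (fun h => mem_planeArc_of_norm_of_arg h ha) fun h => mem_planeArc_of_norm_of_arg h ha)
        have hle := arg_le_pi z
        have hgt := neg_pi_lt_arg z
        by_cases hpos : γ < arg z
        · refine ⟨log z, Or.inl (Or.inl (Or.inl ⟨?_, ?_⟩)), hlog⟩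
          · show γ < (log z).im
            rwa [log_im]
          · show (log z).im < _
            rw [log_im]; linarith
        · have hneg : arg z < -γ := by
            by_contra! hc
            exact harg ⟨hc, not_lt.1 hpos⟩
          -- An argument below −γ enters the horizontal strip only after adding 2π.
          refine ⟨log z + 2 * Real.pi * I, Or.inl (Or.inl (Or.inl ⟨?_, ?_⟩)), ?_⟩
          · show γ < (log z + 2 * Real.pi * I).im
            simp [log_im]; linarith
          · show (log z + 2 * Real.pi * I).im < _
            simp [log_im]; linarith
          · rw [exp_periodic, hlog]
      rcases lt_trichotomy (Real.log ‖z‖) (-L) with h | h | h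
      · exact ⟨log z, Or.inl (Or.inl (Or.inr (by show (log z).re < -L; rwa [log_re]))), hlog⟩
      · refine hcase (Or.inl ?_)
        rw [← Real.exp_log hn, h, Real.exp_neg, hLdef, Real.exp_log hR0, one_div]
      rcases lt_trichotomy (Real.log ‖z‖) L with h' | h' | h'
      · refine ⟨log z, Or.inl (Or.inr ⟨?_, ?_⟩), hlog⟩
        · show -L < (log z).re
          rwa [log_re]
        · show (log z).re < L
          rwa [log_re]
      · refine hcase (Or.inr ?_)
        rw [← Real.exp_log hn, h', hLdef, Real.exp_log hR0]
      · exact ⟨log z, Or.inr (by show L < (log z).re; rwa [log_re]), hlog⟩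
    refine Set.Subset.trans ?_ (closure_mono hsub)
    have hopen := (isClosed_planePlates R γ).isOpen_compl
    exact (dense_compl_singleton (0 : ℂ)).open_subset_closure_inter hopen

end

/-! ### The theta quotient is a strip map -/

section

variable {T a γ x₀ : ℝ}

lemma sin_sub_ne_zero_iff (w p : ℂ) : sin (w - p) ≠ 0 ↔ ∀ k : ℤ, w ≠ p + k * Real.pi := by
  rw [Ne, sin_eq_zero_iff, not_exists]
  exact forall_congr' fun k => not_congr sub_eq_iff_eq_add'

lemma tendsto_norm_condenserMap (ha : 0 < a) (haT : a < T / 2) :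
    Filter.Tendsto (fun w => ‖condenserMap T a w‖) (𝓝[≠] (I * a)) Filter.atTop := by
  have hT : 0 < T := by linarith
  -- Because `0⁻¹ = 0`, convergence of the reciprocal to 0 does not suffice; the map must also be
  -- non-zero near ia.
  have hinv : Filter.Tendsto (fun w => ‖condenserMap T a w‖⁻¹) (𝓝[≠] (I * a)) (𝓝[>] 0) := by
    refine tendsto_nhdsWithin_iff.2 ⟨?_, ?_⟩
    · have h := (tendsto_inv_condenserMap ha haT).norm
      rw [norm_zero] at h
      refine (h.congr fun w => ?_).mono_left nhdsWithin_le_nhds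
      rw [norm_inv]
    · have h1 : ∀ᶠ w in 𝓝 (I * (a : ℂ)), |w.re| < Real.pi := by
        have : Continuous fun w : ℂ => |w.re| := by fun_prop
        exact this.continuousAt.eventually (gt_mem_nhds (by simpa using Real.pi_pos))
      have h2 : ∀ᶠ w in 𝓝 (I * (a : ℂ)), |w.im| < T / 2 := by
        have : Continuous fun w : ℂ => |w.im| := by fun_prop
        exact this.continuousAt.eventually (gt_mem_nhds (by simpa [abs_of_pos ha] using haT))
      have h3 : ∀ᶠ w in 𝓝 (I * (a : ℂ)), 0 < w.im :=
        continuous_im.continuousAt.eventually (lt_mem_nhds (by simpa using ha))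
      filter_upwards [nhdsWithin_le_nhds h1, nhdsWithin_le_nhds h2, nhdsWithin_le_nhds h3,
        self_mem_nhdsWithin] with w w1 w2 w3 w4
      have hden : ∀ k : ℤ, w ≠ I * a + k * Real.pi := by
        intro k hk
        have hre := congrArg re hk
        simp at hre
        rw [hre, abs_lt] at w1
        have hpi := Real.pi_pos
        have a1 : (k : ℝ) < 1 := by by_contra! hc; nlinarith
        have a2 : (-1 : ℝ) < k := by by_contra! hc; nlinarith
        have a1' : k < 1 := by exact_mod_cast a1
        have a2' : -1 < k := by exact_mod_cast a2
        obtain rfl : k = 0 := by omega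
        apply w4
        simpa using hk
      refine inv_pos.2 (norm_pos_iff.2 fun h0 => ?_)
      obtain ⟨k, hk⟩ := (condenserMap_eq_zero_iff ha haT w2.le hden).1 h0
      have him := congrArg im hk
      simp at him
      linarith
  exact (tendsto_inv_nhdsGT_zero.comp hinv).congr fun w => inv_inv _

/-- The conformal map onto the field of the condenser. -/
theorem isStripMap_condenserMap (ha : 0 < a) (haT : a < T / 2) (hγ : 0 < γ) (hγπ : γ < Real.pi)
    (hx₀ : x₀ ∈ Set.Ioo 0 (Real.pi / 2))
    (h₀ : boundaryPhase (Real.exp (2 * a)) (Real.exp (-T)) x₀ = γ)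
    (hmax : ∀ x ∈ Set.Icc 0 (Real.pi / 2), boundaryPhase (Real.exp (2 * a)) (Real.exp (-T)) x ≤ γ) :
    IsStripMap (condenserMap T a) (T / 2) (I * a) (planePlates (Real.exp (2 * a)) γ) := by
  obtain ⟨hcrit, himg⟩ := image_boundaryPhase ha haT hγ hx₀ h₀ hmax
  have hR : 1 < Real.exp (2 * a) := Real.one_lt_exp_iff.2 (by linarith)
  have hR0 : 0 < Real.exp (2 * a) := Real.exp_pos _
  have hT : 0 < T := by linarith
  have hIT : (I * (T : ℂ) / 2) = ((T / 2 : ℝ) : ℂ) * I := by push_cast; ring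
  refine
    { periodic := condenserMap_add_pi T a
      pole_re := by simp
      pole_im := by simpa [abs_of_pos ha] using haT
      differentiableAt := fun w hw hs =>
        (hasDerivAt_condenserMap ha haT hw ((sin_sub_ne_zero_iff _ _).1 hs)).differentiableAt
      deriv_ne_zero := fun w hw hs =>
        deriv_condenserMap_ne_zero ha haT hcrit hw ((sin_sub_ne_zero_iff _ _).1 hs)
      tendsto_pole := tendsto_norm_condenserMap ha haT
      map_boundary := fun w hw => ?_
      boundary_surj := ?_
      dense_compl := dense_compl_planePlates hR0
      isPreconnected_compl := isPreconnected_compl_planePlates hR hγπ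
      zero_notMem := zero_notMem_planePlates hR0
      exists_zero := ?_
      zero_unique := ?_ }
  · obtain ⟨k, hk⟩ := exists_int_sub_mul_pi_re_mem w
    have hper : condenserMap T a (w - k * Real.pi) = condenserMap T a w :=
      Function.Periodic.sub_int_mul_eq (f := condenserMap T a) (condenserMap_add_pi T a) k
    set x : ℝ := (w - k * Real.pi).re with hx
    have hmem : boundaryPhase (Real.exp (2 * a)) (Real.exp (-T)) x ∈ Set.Icc (-γ) γ := by
      rw [← himg]; exact ⟨x, ⟨hk.1, hk.2.le⟩, rfl⟩
    rw [← hper]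
    rcases eq_or_eq_neg_of_abs_eq hw with hw' | hw'
    · have e : w - k * Real.pi = x + I * T / 2 := by
        rw [hIT]
        apply Complex.ext
        · simp [hx]
        · simp [hw']
      rw [e, condenserMap_top ha haT]
      exact Or.inr ⟨_, hmem, rfl⟩
    · have e : w - k * Real.pi = x - I * T / 2 := by
        rw [hIT]
        apply Complex.ext
        · simp [hx]
        · simp [hw']
      rw [e, condenserMap_bottom ha haT]
      exact Or.inl ⟨_, hmem, rfl⟩
  · rintro e (⟨φ, hφ, rfl⟩ | ⟨φ, hφ, rfl⟩) <;> rw [← himg] at hφ <;> obtain ⟨x, -, rfl⟩ := hφ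
    · refine ⟨x - I * T / 2, ?_, condenserMap_bottom ha haT x⟩
      rw [hIT]; simp; linarith
    · refine ⟨x + I * T / 2, ?_, condenserMap_top ha haT x⟩
      rw [hIT]; simp; linarith
  · have hne : ∀ k : ℤ, -(I * (a : ℂ)) ≠ I * a + k * Real.pi := fun k hk => by
      have := congrArg im hk
      simp at this
      linarith
    have him : |(-(I * (a : ℂ))).im| < T / 2 := by simpa [abs_of_pos ha] using haT
    exact ⟨-(I * a), him, (sin_sub_ne_zero_iff _ _).2 hne,
      (condenserMap_eq_zero_iff ha haT him.le hne).2 ⟨0, by simp⟩⟩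
  · intro w w' hw hs hw' hs' hz hz'
    obtain ⟨k, hk⟩ := (condenserMap_eq_zero_iff ha haT hw.le ((sin_sub_ne_zero_iff _ _).1 hs)).1 hz
    obtain ⟨k', hk'⟩ :=
      (condenserMap_eq_zero_iff ha haT hw'.le ((sin_sub_ne_zero_iff _ _).1 hs')).1 hz'
    exact sin_eq_zero_iff.2 ⟨k' - k, by rw [hk, hk']; push_cast; ring⟩

end

/-! ### Conformal invariance of the Dirichlet integral -/

/-- A fundamental domain of the punctured strip modulo the period. -/
def fundStrip (h : ℝ) (p : ℂ) : Set ℂ :=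
  puncturedStrip h p ∩ {w | w.re ∈ Set.Ico (-(Real.pi / 2)) (Real.pi / 2)}

lemma measurableSet_fundStrip (h : ℝ) (p : ℂ) : MeasurableSet (fundStrip h p) :=
  (isOpen_puncturedStrip h p).measurableSet.inter (measurable_re measurableSet_Ico)

lemma eq_of_sin_sub_eq_zero {w w' : ℂ} (hs : sin (w' - w) = 0) (h : |w'.re - w.re| < Real.pi) :
    w' = w := by
  have hpi := Real.pi_pos
  obtain ⟨k, hk⟩ := sin_eq_zero_iff.1 hs
  have hre := congrArg re hk
  simp only [sub_re, mul_re, intCast_re, intCast_im, ofReal_re, ofReal_im, mul_zero,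
    sub_zero] at hre
  rw [hre, abs_lt] at h
  have h1 : (k : ℝ) < 1 := by by_contra! hc; nlinarith
  have h2 : (-1 : ℝ) < k := by by_contra! hc; nlinarith
  have h1' : k < 1 := by exact_mod_cast h1
  have h2' : -1 < k := by exact_mod_cast h2
  obtain rfl : k = 0 := by omega
  rw [Int.cast_zero, zero_mul, sub_eq_zero] at hk
  exact hk

lemma det_restrictScalars_toSpanSingleton (c : ℂ) :
    ((ContinuousLinearMap.toSpanSingleton ℂ c).restrictScalars ℝ).det = ‖c‖ ^ 2 := by
  rw [← normSq_eq_norm_sq, ← Algebra.norm_complex_apply, Algebra.norm_apply]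
  change LinearMap.det _ = LinearMap.det _
  congr 1
  ext
  simp [mul_comm]

namespace IsStripMap

variable {G : ℂ → ℂ} {h : ℝ} {p : ℂ} {E : Set ℂ}

lemma injOn_fundStrip (H : IsStripMap G h p E) : Set.InjOn G (fundStrip h p) := by
  intro w hw w' hw' he
  refine (eq_of_sin_sub_eq_zero (H.sin_sub_eq_zero_of_map_eq hw.1 hw'.1 he (H.map_notMem hw.1))
    ?_).symm
  have h1 := hw.2
  have h2 := hw'.2
  rw [Set.mem_ofPred_eq] at h1 h2
  rw [abs_lt]
  constructor <;> linarith [h1.1, h1.2, h2.1, h2.2]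

lemma image_fundStrip (H : IsStripMap G h p E) : G '' fundStrip h p = Eᶜ := by
  rw [← H.image_eq]
  refine (Set.image_mono Set.inter_subset_left).antisymm ?_
  rintro _ ⟨w, hw, rfl⟩
  obtain ⟨k, hk⟩ := exists_int_sub_mul_pi_re_mem w
  exact ⟨_, ⟨sub_int_mul_pi_mem_puncturedStrip hw k, hk⟩, H.map_sub_int_mul_pi w k⟩

lemma exists_inverse (H : IsStripMap G h p E) {w : ℂ} (hw : w ∈ puncturedStrip h p) :
    ∃ g : ℂ → ℂ, HasStrictDerivAt g (deriv G w)⁻¹ (G w) ∧ g (G w) = w ∧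
      ∀ᶠ z in 𝓝 (G w), g z ∈ puncturedStrip h p ∧ G (g z) = z := by
  obtain ⟨e, hwe, rfl⟩ := H.exists_openPartialHomeomorph hw
  have hGw := e.map_source hwe
  have hleft := e.left_inv hwe
  have hd : HasStrictDerivAt e.symm (deriv e w)⁻¹ (e w) :=
    e.hasStrictDerivAt_symm hGw (H.deriv_ne_zero w hw.1 hw.2)
      (by rw [hleft]; exact H.hasStrictDerivAt hw)
  refine ⟨e.symm, hd, hleft, ?_⟩
  have h1 : puncturedStrip h p ∈ 𝓝 (e.symm (e w)) := by
    rw [hleft]; exact (isOpen_puncturedStrip h p).mem_nhds hw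
  filter_upwards [hd.hasDerivAt.continuousAt h1, e.open_target.mem_nhds hGw] with z h2 h3
  exact ⟨h2, e.right_inv h3⟩

/-- The chain rule for G and for its local inverse gives the two inequalities. If `v` is not
differentiable at `G w`, neither is the composite at `w`, and both derivatives have the default
value 0. -/
lemma norm_fderiv_comp (H : IsStripMap G h p E) {w : ℂ} (hw : w ∈ puncturedStrip h p)
    (v : ℂ → ℝ) : ‖fderiv ℝ (v ∘ G) w‖ = ‖fderiv ℝ v (G w)‖ * ‖deriv G w‖ := by
  have hne := H.deriv_ne_zero w hw.1 hw.2
  have hG : HasFDerivAt G (((1 : ℂ →L[ℂ] ℂ).smulRight (deriv G w)).restrictScalars ℝ) w :=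
    (H.hasStrictDerivAt hw).hasDerivAt.hasFDerivAt.restrictScalars ℝ
  obtain ⟨g, hg, hgw, hev⟩ := H.exists_inverse hw
  have hg' : HasFDerivAt g (((1 : ℂ →L[ℂ] ℂ).smulRight (deriv G w)⁻¹).restrictScalars ℝ) (G w) :=
    hg.hasDerivAt.hasFDerivAt.restrictScalars ℝ
  have hvg : (v ∘ G) ∘ g =ᶠ[𝓝 (G w)] v := hev.mono fun z hz => congrArg v hz.2
  by_cases hv : DifferentiableAt ℝ v (G w)
  · have h1 := (hv.hasFDerivAt.comp w hG).fderiv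
    have h2 := (DifferentiableAt.hasFDerivAt (by
      rw [hgw]; exact hv.comp w hG.differentiableAt : DifferentiableAt ℝ (v ∘ G) (g (G w)))).comp
      (G w) hg'
    rw [hgw] at h2
    have h2 := (h2.congr_of_eventuallyEq hvg.symm).fderiv
    have hn : ∀ c : ℂ, ‖((1 : ℂ →L[ℂ] ℂ).smulRight c).restrictScalars ℝ‖ = ‖c‖ := by
      intro c
      rw [ContinuousLinearMap.norm_restrictScalars, ContinuousLinearMap.norm_smulRight_apply,
        norm_one, one_mul]
    apply le_antisymm
    · rw [h1, ← hn]
      exact ContinuousLinearMap.opNorm_comp_le _ _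
    · have h3 : ‖fderiv ℝ v (G w)‖ ≤ ‖fderiv ℝ (v ∘ G) w‖ * ‖(deriv G w)⁻¹‖ := by
        rw [h2, ← hn]
        exact ContinuousLinearMap.opNorm_comp_le _ _
      have hpos : 0 < ‖deriv G w‖ := norm_pos_iff.2 hne
      rwa [norm_inv, ← div_eq_mul_inv, le_div_iff₀ hpos] at h3
  · have hv' : ¬ DifferentiableAt ℝ (v ∘ G) w := by
      intro hd
      have hd' : DifferentiableAt ℝ (v ∘ G) (g (G w)) := by rwa [hgw]
      exact hv ((hd'.comp (G w) hg'.differentiableAt).congr_of_eventuallyEq hvg.symm)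
    rw [fderiv_zero_of_not_differentiableAt hv, fderiv_zero_of_not_differentiableAt hv',
      norm_zero, zero_mul]

/-- Conformal invariance of the Dirichlet integral. -/
lemma lintegral_fderiv_sq (H : IsStripMap G h p E) (hE : volume E = 0) (v : ℂ → ℝ) :
    ∫⁻ z, ‖fderiv ℝ v z‖ₑ ^ 2 = ∫⁻ w in fundStrip h p, ‖fderiv ℝ (v ∘ G) w‖ₑ ^ 2 := by
  rw [← setLIntegral_univ, ← setLIntegral_congr (show (Eᶜ : Set ℂ) =ᵐ[volume] Set.univ by
    rw [ae_eq_univ, compl_compl]; exact hE), ← H.image_fundStrip,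
    lintegral_image_eq_lintegral_abs_det_fderiv_mul volume (measurableSet_fundStrip h p)
      (fun w hw => ((H.hasStrictDerivAt hw.1).hasDerivAt.hasFDerivAt.restrictScalars
        ℝ).hasFDerivWithinAt) H.injOn_fundStrip]
  refine setLIntegral_congr_fun (measurableSet_fundStrip h p) fun w hw => ?_
  rw [det_restrictScalars_toSpanSingleton, abs_of_nonneg (by positivity),
    ← ofReal_norm (fderiv ℝ (v ∘ G) w), H.norm_fderiv_comp hw.1,
    ENNReal.ofReal_mul (norm_nonneg _), mul_pow, ENNReal.ofReal_pow (norm_nonneg _),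
    ofReal_norm, ofReal_norm, mul_comm]

end IsStripMap

/-! ### The length–area lower bound on a rectangle -/

/-- Functions which are Lipschitz in a neighbourhood of a point. -/
def LipschitzNear (g : ℂ → ℝ) (w : ℂ) : Prop := ∃ c : ℝ≥0, ∃ t ∈ 𝓝 w, LipschitzOnWith c g t

/-- Rademacher's theorem on small open sets; a set that is locally null is null. -/
lemma ae_differentiableAt_of_lipschitzNear (g : ℂ → ℝ) :
    ∀ᵐ w : ℂ, LipschitzNear g w → DifferentiableAt ℝ g w := by
  rw [ae_iff]
  refine measure_null_of_locally_null _ fun w hw => ?_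
  have hw' : LipschitzNear g w := by
    by_contra hc
    exact hw fun h => absurd h hc
  obtain ⟨c, t, ht, hl⟩ := hw'
  obtain ⟨t', ht't, ht'o, hwt'⟩ := mem_nhds_iff.1 ht
  refine ⟨t' ∩ {w | ¬(LipschitzNear g w → DifferentiableAt ℝ g w)},
    Filter.inter_mem (mem_nhdsWithin_of_mem_nhds (ht'o.mem_nhds hwt')) self_mem_nhdsWithin, ?_⟩
  have := (hl.mono ht't).ae_differentiableWithinAt_of_mem (μ := volume)
  rw [ae_iff] at this
  refine measure_mono_null ?_ this
  rintro x ⟨hx, hx'⟩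
  intro hd
  exact hx' fun _ => (hd hx).differentiableAt (ht'o.mem_nhds hx)

lemma ae_ae_of_ae_complex {P : ℂ → Prop} (hP : ∀ᵐ w : ℂ, P w) :
    ∀ᵐ x : ℝ, ∀ᵐ y : ℝ, P (x + y * I) := by
  have h1 := volume_preserving_equiv_real_prod.symm.quasiMeasurePreserving.ae hP
  have h2 := Measure.ae_ae_of_ae_prod h1
  filter_upwards [h2] with x hx
  filter_upwards [hx] with y hy
  rwa [measurableEquivRealProd_symm_apply, mk_eq_add_mul_I] at hy

lemma setLIntegral_reProdIm {s t : Set ℝ} (hs : MeasurableSet s) (ht : MeasurableSet t)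
    {F : ℂ → ℝ≥0∞} (hF : Measurable F) :
    ∫⁻ w in s ×ℂ t, F w = ∫⁻ x in s, ∫⁻ y in t, F (x + y * I) := by
  have hpre : measurableEquivRealProd.symm ⁻¹' (s ×ℂ t) = s ×ˢ t := by
    ext ⟨x, y⟩
    simp [measurableEquivRealProd_symm_apply, mem_reProdIm]
  have hst : MeasurableSet (s ×ℂ t) := (measurable_re hs).inter (measurable_im ht)
  rw [← volume_preserving_equiv_real_prod.symm.setLIntegral_comp_preimage hst hF, hpre, Measure.volume_eq_prod,
    setLIntegral_prod (fun a => F (measurableEquivRealProd.symm a))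
      (hF.comp measurableEquivRealProd.symm.measurable).aemeasurable]
  simp only [measurableEquivRealProd_symm_apply, mk_eq_add_mul_I]

/-- The length of a curve bounds its increment. -/
lemma ofReal_sub_le_lintegral_enorm_deriv {f : ℝ → ℝ} {h : ℝ} (hh : 0 < h)
    (hcont : ContinuousOn f (Set.Icc (-h) h))
    (hlip : ∀ y ∈ Set.Ioo (-h) h, ∃ c : ℝ≥0, ∃ t ∈ 𝓝 y, LipschitzOnWith c f t) :
    ENNReal.ofReal (f h - f (-h)) ≤ ∫⁻ y in Set.Ioo (-h) h, ‖deriv f y‖ₑ := by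
  -- At ±h only continuity is available, so the fundamental theorem is applied on [−s, s] and s
  -- tends to h.
  have key : ∀ s ∈ Set.Ioo 0 h,
      ENNReal.ofReal (f s - f (-s)) ≤ ∫⁻ y in Set.Ioo (-h) h, ‖deriv f y‖ₑ := by
    rintro s ⟨hs0, hsh⟩
    have hle : -s ≤ s := by linarith
    have hsub : Set.Icc (-s) s ⊆ Set.Ioo (-h) h := fun y hy =>
      ⟨by linarith [hy.1], by linarith [hy.2]⟩
    have hloc : LocallyLipschitzOn (Set.Icc (-s) s) f := fun y hy => by
      obtain ⟨c, t, ht, hl⟩ := hlip y (hsub hy)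
      exact ⟨c, t, mem_nhdsWithin_of_mem_nhds ht, hl⟩
    obtain ⟨c, hc⟩ := hloc.exists_lipschitzOnWith_of_compact isCompact_Icc
    rw [← Set.uIcc_of_le hle] at hc
    rw [← hc.absolutelyContinuousOnInterval.integral_deriv_eq_sub,
      intervalIntegral.integral_of_le hle]
    calc ENNReal.ofReal (∫ y in Set.Ioc (-s) s, deriv f y)
        ≤ ‖∫ y in Set.Ioc (-s) s, deriv f y‖ₑ := by
          rw [Real.enorm_eq_ofReal_abs]; exact ENNReal.ofReal_le_ofReal (le_abs_self _)
      _ ≤ ∫⁻ y in Set.Ioc (-s) s, ‖deriv f y‖ₑ := enorm_integral_le_lintegral_enorm _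
      _ ≤ _ := lintegral_mono_set (Set.Ioc_subset_Icc_self.trans hsub)
  have hlim : Filter.Tendsto (fun s => ENNReal.ofReal (f s - f (-s))) (𝓝[Set.Ioo 0 h] h)
      (𝓝 (ENNReal.ofReal (f h - f (-h)))) := by
    refine (ENNReal.continuous_ofReal.tendsto _).comp (Filter.Tendsto.sub ?_ ?_)
    · exact (hcont h ⟨by linarith, le_rfl⟩).mono fun y hy => ⟨by linarith [hy.1], hy.2.le⟩
    · refine (hcont (-h) ⟨le_rfl, by linarith⟩).tendsto.comp (tendsto_nhdsWithin_iff.2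
        ⟨(continuous_neg.tendsto h).mono_left nhdsWithin_le_nhds, ?_⟩)
      filter_upwards [self_mem_nhdsWithin] with y hy
      exact ⟨by linarith [hy.2], by linarith [hy.1]⟩
  have : (𝓝[Set.Ioo 0 h] h).NeBot := by
    rw [← mem_closure_iff_nhdsWithin_neBot, closure_Ioo hh.ne]
    exact ⟨hh.le, le_rfl⟩
  refine le_of_tendsto hlim ?_
  filter_upwards [self_mem_nhdsWithin] with s hs using key s hs

lemma two_mul_mul_le_sq_add_sq (c x : ℝ≥0) : (2 * c * x : ℝ≥0∞) ≤ (x : ℝ≥0∞) ^ 2 + (c : ℝ≥0∞) ^ 2 := by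
  norm_cast
  rw [← NNReal.coe_le_coe]
  push_cast
  nlinarith [sq_nonneg ((x : ℝ) - c)]

/-- The Cauchy–Schwarz inequality on an interval. -/
lemma ofReal_inv_le_lintegral_enorm_sq {F : Type*} [NormedAddCommGroup F] {f : ℝ → F} {h : ℝ}
    (hh : 0 < h) (h1 : 1 ≤ ∫⁻ y in Set.Ioo (-h) h, ‖f y‖ₑ)
    (hf : Measurable fun y => ‖f y‖ₑ) :
    ENNReal.ofReal (1 / (2 * h)) ≤ ∫⁻ y in Set.Ioo (-h) h, ‖f y‖ₑ ^ 2 := by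
  -- This is the constant slope of the extremal function: integrating 2c|f| ≤ |f|² + c² over length
  -- 2h = 1/c gives 2c ≤ ∫|f|² + c.
  set c : ℝ≥0 := ⟨1 / (2 * h), by positivity⟩ with hc
  have hc' : (c : ℝ≥0∞) = ENNReal.ofReal (1 / (2 * h)) := by
    rw [ENNReal.ofReal, Real.toNNReal_of_nonneg (by positivity)]; rfl
  rw [← hc']
  have hvol : volume (Set.Ioo (-h) h) = ENNReal.ofReal (2 * h) := by
    rw [Real.volume_Ioo]; congr 1; ring
  have hcv : (c : ℝ≥0∞) ^ 2 * volume (Set.Ioo (-h) h) = c := by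
    rw [hvol, hc', sq, mul_assoc, ← ENNReal.ofReal_mul (by positivity),
      one_div_mul_cancel (by positivity), ENNReal.ofReal_one, mul_one]
  have hle : (c : ℝ≥0∞) + c ≤ (∫⁻ y in Set.Ioo (-h) h, ‖f y‖ₑ ^ 2) + c := by
    calc (c : ℝ≥0∞) + c = 2 * c * 1 := by ring
      _ ≤ 2 * c * ∫⁻ y in Set.Ioo (-h) h, ‖f y‖ₑ := by gcongr
      _ = ∫⁻ y in Set.Ioo (-h) h, 2 * c * ‖f y‖ₑ := by
        rw [lintegral_const_mul _ hf]
      _ ≤ ∫⁻ y in Set.Ioo (-h) h, (‖f y‖ₑ ^ 2 + (c : ℝ≥0∞) ^ 2) :=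
        lintegral_mono fun y => two_mul_mul_le_sq_add_sq c ‖f y‖₊
      _ = (∫⁻ y in Set.Ioo (-h) h, ‖f y‖ₑ ^ 2) + c := by
        rw [lintegral_add_right _ measurable_const, setLIntegral_const, hcv]
  exact (ENNReal.add_le_add_iff_right ENNReal.coe_ne_top).1 hle

/-- The lower bound for the Dirichlet integral over a rectangle of a function with prescribed
boundary values. -/
lemma le_setLIntegral_fderiv_sq {g : ℂ → ℝ} {h b : ℝ} (hh : 0 < h) {N : Set ℝ} (hN : N.Finite)
    (hcont : ∀ x ∈ Set.Ioo (-b) b \ N,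
      ContinuousOn (fun y : ℝ => g (x + y * I)) (Set.Icc (-h) h))
    (hbot : ∀ x ∈ Set.Ioo (-b) b \ N, g (x + (-h : ℝ) * I) = 0)
    (htop : ∀ x ∈ Set.Ioo (-b) b \ N, g (x + h * I) = 1)
    (hlip : ∀ x ∈ Set.Ioo (-b) b \ N, ∀ y ∈ Set.Ioo (-h) h, LipschitzNear g (x + y * I)) :
    ENNReal.ofReal (b / h) ≤ ∫⁻ w in Set.Ioo (-b) b ×ℂ Set.Ioo (-h) h, ‖fderiv ℝ g w‖ₑ ^ 2 := by
  have hmeas : Measurable fun w => ‖fderiv ℝ g w‖ₑ := (measurable_fderiv ℝ g).enorm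
  rw [setLIntegral_reProdIm measurableSet_Ioo measurableSet_Ioo (hmeas.pow_const 2)]
  have hae := ae_ae_of_ae_complex (ae_differentiableAt_of_lipschitzNear g)
  have hNae : ∀ᵐ x : ℝ, x ∉ N := measure_eq_zero_iff_ae_notMem.1 (hN.measure_zero volume)
  calc ENNReal.ofReal (b / h)
      = ∫⁻ _ in Set.Ioo (-b) b, ENNReal.ofReal (1 / (2 * h)) := by
        rw [setLIntegral_const, Real.volume_Ioo, ← ENNReal.ofReal_mul (by positivity)]
        congr 1
        field_simp
        ring
    _ ≤ _ := by
        refine setLIntegral_mono_ae' measurableSet_Ioo ?_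
        filter_upwards [hae, hNae] with x hx hxN hxb
        have hxm : x ∈ Set.Ioo (-b) b \ N := ⟨hxb, hxN⟩
        have hline : ∀ y : ℝ, HasDerivAt (fun y : ℝ => (x + y * I : ℂ)) I y := fun y => by
          simpa using ((hasDerivAt_id y).ofReal_comp.mul_const I).const_add (x : ℂ)
        have hmy : Measurable fun y : ℝ => ‖fderiv ℝ g (x + y * I)‖ₑ :=
          hmeas.comp (by fun_prop)
        refine ofReal_inv_le_lintegral_enorm_sq hh ?_ hmy
        have hlip' : ∀ y ∈ Set.Ioo (-h) h, ∃ c : ℝ≥0, ∃ t ∈ 𝓝 y,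
            LipschitzOnWith c (fun y : ℝ => g (x + y * I)) t := by
          intro y hy
          obtain ⟨c, t, ht, hl⟩ := hlip x hxm y hy
          have hiso : LipschitzWith 1 fun y : ℝ => (x + y * I : ℂ) :=
            LipschitzWith.of_dist_le_mul fun y y' => by
              simp [dist_eq_norm, ← sub_mul, ← ofReal_sub]
          exact ⟨c * 1, _, (hline y).continuousAt ht,
            hl.comp hiso.lipschitzOnWith fun _ hz => hz⟩
        have hlen := ofReal_sub_le_lintegral_enorm_deriv hh (hcont x hxm) hlip'
        simp only [htop x hxm, hbot x hxm, sub_zero, ENNReal.ofReal_one] at hlen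
        refine hlen.trans (setLIntegral_mono_ae' measurableSet_Ioo ?_)
        filter_upwards [hx] with y hy hyh
        have hd := (hy (hlip x hxm y hyh)).hasFDerivAt.comp_hasDerivAt y (hline y)
        have hd' : HasDerivAt (fun y : ℝ => g (x + y * I)) (fderiv ℝ g (x + y * I) I) y := hd
        rw [hd'.deriv, ← ofReal_norm, ← ofReal_norm]
        refine ENNReal.ofReal_le_ofReal ?_
        simpa using (fderiv ℝ g (x + y * I)).le_opNorm I

/-! ### Extension to the sphere and computation of the capacity -/

/-- The extension of a function on the plane to the sphere, with value `∞` at `p`. -/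
def sphereMap (G : ℂ → ℂ) (p : ℂ) : ℂ → OnePoint ℂ :=
  Function.update (fun w => (G w : OnePoint ℂ)) p OnePoint.infty

lemma sphereMap_self (G : ℂ → ℂ) (p : ℂ) : sphereMap G p p = OnePoint.infty :=
  Function.update_self ..

lemma sphereMap_of_ne (G : ℂ → ℂ) {p w : ℂ} (h : w ≠ p) : sphereMap G p w = G w :=
  Function.update_of_ne h ..

/-- The closed rectangle over which the strip map covers the sphere. -/
def periodRect (h : ℝ) : Set ℂ := Set.Icc (-(Real.pi / 2)) (Real.pi / 2) ×ℂ Set.Icc (-h) h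

lemma isCompact_periodRect (h : ℝ) : IsCompact (periodRect h) :=
  isCompact_Icc.reProdIm isCompact_Icc

lemma lipschitzNear_im (h : ℝ) (g : ℂ → ℂ) {d z : ℂ} (hg : HasStrictDerivAt g d z) :
    LipschitzNear (fun z => ((g z).im + h) / (2 * h)) z := by
  have h1 : HasStrictFDerivAt g ((ContinuousLinearMap.toSpanSingleton ℂ d).restrictScalars ℝ) z :=
    hg.hasStrictFDerivAt.restrictScalars ℝ
  exact ((((imCLM.hasStrictFDerivAt (x := g z)).comp z h1).add_const h).mul_const
    (2 * h)⁻¹).exists_lipschitzOnWith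

lemma norm_fderiv_im_add_div (h : ℝ) (w : ℂ) (hh : 0 < h) :
    ‖fderiv ℝ (fun w : ℂ => (w.im + h) / (2 * h)) w‖ = 1 / (2 * h) := by
  have h1 : HasFDerivAt (fun w : ℂ => (w.im + h) / (2 * h)) ((2 * h)⁻¹ • imCLM) w :=
    ((imCLM.hasFDerivAt (x := w)).add_const h).mul_const (2 * h)⁻¹
  rw [h1.fderiv, norm_smul, imCLM_norm, mul_one, Real.norm_of_nonneg (by positivity), one_div]

namespace IsStripMap

variable {G : ℂ → ℂ} {h : ℝ} {p : ℂ} {E : Set ℂ}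

lemma height_pos (H : IsStripMap G h p E) : 0 < h := (abs_nonneg _).trans_lt H.pole_im

lemma sin_sub_pole_ne_zero (H : IsStripMap G h p E) {w : ℂ} (hw : |w.re| < Real.pi)
    (hne : w ≠ p) : sin (w - p) ≠ 0 :=
  fun hs => hne (eq_of_sin_sub_eq_zero hs (by rwa [H.pole_re, sub_zero]))

lemma abs_re_lt_pi {w : ℂ} (hw : w ∈ periodRect h) : |w.re| < Real.pi := by
  have := Real.pi_pos
  obtain ⟨h1, h2⟩ := hw.1
  rw [abs_lt]
  constructor <;> linarith

lemma continuousOn_sphereMap (H : IsStripMap G h p E) :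
    ContinuousOn (sphereMap G p) (periodRect h) := by
  intro w hw
  refine ContinuousAt.continuousWithinAt ?_
  rcases eq_or_ne w p with rfl | hne
  · rw [sphereMap, continuousAt_update_same]
    have h1 : Filter.Tendsto G (𝓝[≠] w) (Filter.coclosedCompact ℂ) := by
      rw [Filter.coclosedCompact_eq_cocompact, ← Metric.cobounded_eq_cocompact,
        ← tendsto_norm_atTop_iff_cobounded]
      exact H.tendsto_pole
    exact OnePoint.tendsto_coe_infty.comp h1
  · rw [sphereMap, continuousAt_update_of_ne hne]
    exact OnePoint.continuous_coe.continuousAt.comp (H.differentiableAt w (abs_le.2 hw.2)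
      (H.sin_sub_pole_ne_zero (abs_re_lt_pi hw) hne)).continuousAt

lemma exists_mem_periodRect (H : IsStripMap G h p E) {w : ℂ} (hw : |w.im| ≤ h)
    (hs : sin (w - p) ≠ 0) : ∃ w' ∈ periodRect h, w'.im = w.im ∧ sphereMap G p w' = G w := by
  obtain ⟨k, hk⟩ := exists_int_sub_mul_pi_re_mem w
  have him : (w - k * Real.pi).im = w.im := by simp
  refine ⟨w - k * Real.pi, ⟨⟨hk.1, hk.2.le⟩, ?_⟩, him, ?_⟩
  · change (w - k * Real.pi).im ∈ Set.Icc (-h) h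
    rw [him]; exact abs_le.1 hw
  · rw [sphereMap_of_ne, H.map_sub_int_mul_pi]
    intro he
    apply hs
    rw [← he, sub_sub_cancel]
    exact sin_int_mul_pi' k

lemma sin_ne_zero_of_abs_im_eq (H : IsStripMap G h p E) {w : ℂ} (hw : |w.im| = h) :
    sin (w - p) ≠ 0 := by
  intro hs
  obtain ⟨k, hk⟩ := sin_eq_zero_iff.1 hs
  have := congrArg im hk
  simp only [sub_im, mul_im, intCast_re, intCast_im, ofReal_re, ofReal_im, mul_zero, zero_mul,
    add_zero] at this
  rw [sub_eq_zero.1 this] at hw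
  exact H.pole_im.ne hw

lemma surjOn_sphereMap (H : IsStripMap G h p E) (z : OnePoint ℂ) :
    ∃ w ∈ periodRect h, sphereMap G p w = z := by
  induction z using OnePoint.rec with
  | infty =>
    refine ⟨p, ⟨?_, abs_le.1 H.pole_im.le⟩, sphereMap_self G p⟩
    change p.re ∈ Set.Icc (-(Real.pi / 2)) (Real.pi / 2)
    rw [H.pole_re]
    constructor <;> linarith [Real.pi_pos]
  | coe z =>
    by_cases hz : z ∈ E
    · obtain ⟨w, hw, rfl⟩ := H.boundary_surj z hz
      obtain ⟨w', h1, -, h2⟩ := H.exists_mem_periodRect hw.le (H.sin_ne_zero_of_abs_im_eq hw)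
      exact ⟨w', h1, h2⟩
    · have : z ∈ G '' puncturedStrip h p := by rw [H.image_eq]; exact hz
      obtain ⟨w, hw, rfl⟩ := this
      obtain ⟨w', h1, -, h2⟩ := H.exists_mem_periodRect hw.1.le hw.2
      exact ⟨w', h1, h2⟩

variable {C : Condenser}

/-- The imaginary part is a function on the sphere. -/
lemma im_eq_of_sphereMap_eq (H : IsStripMap G h p {z : ℂ | (z : OnePoint ℂ) ∈ C.E₀ ∪ C.E₁})
    (htop : ∀ w : ℂ, w.im = h → (G w : OnePoint ℂ) ∈ C.E₁)
    (hbot : ∀ w : ℂ, w.im = -h → (G w : OnePoint ℂ) ∈ C.E₀)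
    {w w' : ℂ} (hw : w ∈ periodRect h) (hw' : w' ∈ periodRect h)
    (he : sphereMap G p w = sphereMap G p w') : w.im = w'.im := by
  rcases eq_or_ne w p with rfl | hne
  · rcases eq_or_ne w' w with rfl | hne'
    · rfl
    · rw [sphereMap_self, sphereMap_of_ne G hne'] at he
      exact absurd he (OnePoint.infty_ne_coe _)
  rcases eq_or_ne w' p with rfl | hne'
  · rw [sphereMap_self, sphereMap_of_ne G hne] at he
    exact absurd he (OnePoint.coe_ne_infty _)
  rw [sphereMap_of_ne G hne, sphereMap_of_ne G hne'] at he
  have he' := OnePoint.coe_injective he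
  have hs := H.sin_sub_pole_ne_zero (abs_re_lt_pi hw) hne
  have hs' := H.sin_sub_pole_ne_zero (abs_re_lt_pi hw') hne'
  have hi : |w.im| ≤ h := abs_le.2 hw.2
  have hi' : |w'.im| ≤ h := abs_le.2 hw'.2
  rcases hi.lt_or_eq with hi | hi
  · rcases hi'.lt_or_eq with hi' | hi'
    · obtain ⟨k, hk⟩ := sin_eq_zero_iff.1
        (H.sin_sub_eq_zero_of_map_eq ⟨hi, hs⟩ ⟨hi', hs'⟩ he' (H.map_notMem ⟨hi, hs⟩))
      have := congrArg im hk
      simp only [sub_im, mul_im, intCast_re, intCast_im, ofReal_re, ofReal_im, mul_zero, zero_mul,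
        add_zero] at this
      linarith
    · have := H.map_boundary w' hi'
      rw [← he'] at this
      exact absurd this (H.map_notMem ⟨hi, hs⟩)
  · rcases hi'.lt_or_eq with hi' | hi'
    · have := H.map_boundary w hi
      rw [he'] at this
      exact absurd this (H.map_notMem ⟨hi', hs'⟩)
    · rcases eq_or_eq_neg_of_abs_eq hi with hi | hi <;>
        rcases eq_or_eq_neg_of_abs_eq hi' with hi' | hi'
      · rw [hi, hi']
      · have h1 := hbot w' hi'
        rw [← he] at h1
        exact absurd (htop w hi) (Set.disjoint_left.1 C.disjoint h1)
      · have h1 := htop w' hi'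
        rw [← he] at h1
        exact absurd h1 (Set.disjoint_left.1 C.disjoint (hbot w hi))
      · rw [hi, hi']

/-- The potential function of the condenser. -/
lemma exists_potential (H : IsStripMap G h p {z : ℂ | (z : OnePoint ℂ) ∈ C.E₀ ∪ C.E₁})
    (htop : ∀ w : ℂ, w.im = h → (G w : OnePoint ℂ) ∈ C.E₁)
    (hbot : ∀ w : ℂ, w.im = -h → (G w : OnePoint ℂ) ∈ C.E₀) :
    ∃ u : OnePoint ℂ → ℝ, Continuous u ∧
      ∀ w ∈ periodRect h, u (sphereMap G p w) = (w.im + h) / (2 * h) := by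
  choose s hs hsz using H.surjOn_sphereMap
  have hu : ∀ w ∈ periodRect h,
      ((s (sphereMap G p w)).im + h) / (2 * h) = (w.im + h) / (2 * h) := fun w hw => by
    rw [H.im_eq_of_sphereMap_eq htop hbot (hs _) hw (hsz _)]
  refine ⟨fun z => ((s z).im + h) / (2 * h), continuous_iff_isClosed.2 fun A hA => ?_, hu⟩
  -- The potential descends along a map of a compact rectangle onto a Hausdorff space: the preimage
  -- of a closed set is the image of a compact one.
  have hpre : (fun z => ((s z).im + h) / (2 * h)) ⁻¹' A
      = sphereMap G p '' (periodRect h ∩ (fun w : ℂ => (w.im + h) / (2 * h)) ⁻¹' A) := by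
    ext z
    constructor
    · intro hz
      exact ⟨s z, ⟨hs z, hz⟩, hsz z⟩
    · rintro ⟨w, ⟨hw, hwA⟩, rfl⟩
      rw [Set.mem_preimage, hu w hw]
      exact hwA
  rw [hpre]
  have hcl : IsClosed ((fun w : ℂ => (w.im + h) / (2 * h)) ⁻¹' A) := hA.preimage (by fun_prop)
  exact (((isCompact_periodRect h).inter_right hcl).image_of_continuousOn
    (H.continuousOn_sphereMap.mono Set.inter_subset_left)).isClosed

lemma volume_fundStrip_le (h : ℝ) (p : ℂ) (hh : 0 < h) :
    volume (fundStrip h p) ≤ ENNReal.ofReal (Real.pi * (2 * h)) := by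
  have hsub : fundStrip h p ⊆ periodRect h := fun w hw => ⟨⟨hw.2.1, hw.2.2.le⟩, abs_le.1 hw.1.1.le⟩
  refine (measure_mono hsub).trans (le_of_eq ?_)
  rw [← setLIntegral_one, periodRect,
    setLIntegral_reProdIm measurableSet_Icc measurableSet_Icc measurable_const]
  simp only [setLIntegral_one, Real.volume_Icc, setLIntegral_const]
  rw [← ENNReal.ofReal_mul (by linarith), mul_comm]
  congr 1
  ring

/-- The test function is (Im w + h)/(2h) carried to the sphere. Its gradient has norm 1/(2h), over a
fundamental domain of area at most 2πh. -/
lemma capacity_le (H : IsStripMap G h p {z : ℂ | (z : OnePoint ℂ) ∈ C.E₀ ∪ C.E₁})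
    (hinf : OnePoint.infty ∉ C.E₀ ∪ C.E₁)
    (htop : ∀ w : ℂ, w.im = h → (G w : OnePoint ℂ) ∈ C.E₁)
    (hbot : ∀ w : ℂ, w.im = -h → (G w : OnePoint ℂ) ∈ C.E₀)
    (hvol : volume {z : ℂ | (z : OnePoint ℂ) ∈ C.E₀ ∪ C.E₁} = 0) :
    C.capacity ≤ ENNReal.ofReal (Real.pi / (2 * h)) := by
  have hh := H.height_pos
  obtain ⟨u, hu, hval⟩ := H.exists_potential htop hbot
  have hvalG : ∀ w : ℂ, |w.im| ≤ h → sin (w - p) ≠ 0 → u (G w) = (w.im + h) / (2 * h) := by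
    intro w hw hs
    obtain ⟨w', h1, h2, h3⟩ := H.exists_mem_periodRect hw hs
    rw [← h3, hval w' h1, h2]
  have hplate : ∀ z ∈ C.E₀ ∪ C.E₁, ∃ w : ℂ, |w.im| = h ∧ (G w : OnePoint ℂ) = z := by
    intro z hz
    induction z using OnePoint.rec with
    | infty => exact absurd hz hinf
    | coe z =>
      obtain ⟨w, h1, h2⟩ := H.boundary_surj z hz
      exact ⟨w, h1, by rw [h2]⟩
  have hadm : C.Admissible u := by
    refine ⟨hu, fun z hz => ?_, fun z hz => ?_, ∅, fun z hz _ => ?_⟩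
    · obtain ⟨w, hw, rfl⟩ := hplate z (Or.inl hz)
      rcases eq_or_eq_neg_of_abs_eq hw with hw' | hw'
      · exact absurd (htop w hw') (Set.disjoint_left.1 C.disjoint hz)
      · rw [hvalG w hw.le (H.sin_ne_zero_of_abs_im_eq hw), hw']; simp
    · obtain ⟨w, hw, rfl⟩ := hplate z (Or.inr hz)
      rcases eq_or_eq_neg_of_abs_eq hw with hw' | hw'
      · rw [hvalG w hw.le (H.sin_ne_zero_of_abs_im_eq hw), hw']
        field_simp
        ring
      · exact absurd hz (Set.disjoint_left.1 C.disjoint (hbot w hw'))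
    · have : z ∈ G '' puncturedStrip h p := by rw [H.image_eq]; exact hz
      obtain ⟨w, hw, rfl⟩ := this
      obtain ⟨g, hg, -, hev⟩ := H.exists_inverse hw
      obtain ⟨c, t, ht, hl⟩ := lipschitzNear_im h g hg
      refine ⟨c, _, Filter.inter_mem ht hev, ?_⟩
      have heq : ∀ z, g z ∈ puncturedStrip h p ∧ G (g z) = z →
          u z = ((g z).im + h) / (2 * h) := fun z hz => by
        rw [← hvalG _ hz.1.1.le hz.1.2, hz.2]
      intro y hy z hz
      simp only [heq y hy.2, heq z hz.2]
      exact hl hy.1 hz.1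
  refine (iInf₂_le u hadm).trans ?_
  rw [Condenser.dirichletIntegral, H.lintegral_fderiv_sq hvol]
  calc ∫⁻ w in fundStrip h p, ‖fderiv ℝ ((fun w : ℂ => u w) ∘ G) w‖ₑ ^ 2
      = ∫⁻ _ in fundStrip h p, ENNReal.ofReal (1 / (2 * h)) ^ 2 := by
        refine setLIntegral_congr_fun (measurableSet_fundStrip h p) fun w hw => ?_
        have hev : (fun w : ℂ => u w) ∘ G =ᶠ[𝓝 w] fun w => (w.im + h) / (2 * h) := by
          filter_upwards [(isOpen_puncturedStrip h p).mem_nhds hw.1] with y hy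
          exact hvalG y hy.1.le hy.2
        simp only [hev.fderiv_eq]
        rw [← ofReal_norm, norm_fderiv_im_add_div h w hh]
    _ ≤ ENNReal.ofReal (1 / (2 * h)) ^ 2 * ENNReal.ofReal (Real.pi * (2 * h)) := by
        rw [setLIntegral_const]
        gcongr
        exact volume_fundStrip_le h p hh
    _ = ENNReal.ofReal (Real.pi / (2 * h)) := by
        rw [← ENNReal.ofReal_pow (by positivity), ← ENNReal.ofReal_mul (by positivity)]
        congr 1
        field_simp

/-- An admissible function, pulled back, climbs from 0 to 1 along almost every vertical segment, so
the rectangle estimate applies with width π. No extremal function is needed. -/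
lemma le_capacity (H : IsStripMap G h p {z : ℂ | (z : OnePoint ℂ) ∈ C.E₀ ∪ C.E₁})
    (htop : ∀ w : ℂ, w.im = h → (G w : OnePoint ℂ) ∈ C.E₁)
    (hbot : ∀ w : ℂ, w.im = -h → (G w : OnePoint ℂ) ∈ C.E₀)
    (hvol : volume {z : ℂ | (z : OnePoint ℂ) ∈ C.E₀ ∪ C.E₁} = 0) :
    ENNReal.ofReal (Real.pi / (2 * h)) ≤ C.capacity := by
  have hh := H.height_pos
  have hpi := Real.pi_pos
  refine le_iInf₂ fun u ⟨hu, hu0, hu1, S, hS⟩ => ?_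
  rw [Condenser.dirichletIntegral, H.lintegral_fderiv_sq hvol]
  set g : ℂ → ℝ := (fun w : ℂ => u w) ∘ G with hg
  -- Excluded abscissae: 0, above which the pole lies, and those of the preimages of the exceptional
  -- points, finitely many by injectivity of `G`.
  set N : Set ℝ := insert 0 (re '' (fundStrip h p ∩ G ⁻¹' S)) with hN
  have hNfin : N.Finite := by
    refine Set.Finite.insert _ (Set.Finite.image _ (Set.Finite.of_finite_image (f := G) ?_
      (H.injOn_fundStrip.mono Set.inter_subset_left)))
    exact S.finite_toSet.subset (by rintro _ ⟨w, hw, rfl⟩; exact hw.2)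
  have hline : ∀ x ∈ Set.Ioo (-(Real.pi / 2)) (Real.pi / 2) \ N, ∀ y : ℝ,
      sin ((x + y * I : ℂ) - p) ≠ 0 := by
    rintro x ⟨hx, hxN⟩ y
    refine H.sin_sub_pole_ne_zero ?_ fun he => hxN ?_
    · have : (x + y * I : ℂ).re = x := by simp
      rw [this, abs_lt]
      constructor <;> linarith [hx.1, hx.2]
    · have := congrArg re he
      rw [H.pole_re] at this
      simp at this
      exact Or.inl this
  have hlow := le_setLIntegral_fderiv_sq (g := g) (b := Real.pi / 2) hh hNfin ?_ ?_ ?_ ?_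
  · rw [show Real.pi / (2 * h) = Real.pi / 2 / h by ring]
    refine hlow.trans ?_
    set Q : Set ℂ := Set.Ioo (-(Real.pi / 2)) (Real.pi / 2) ×ℂ Set.Ioo (-h) h with hQ
    have hae : (Q \ {p} : Set ℂ) =ᵐ[volume] Q := sdiff_null_ae_eq_self (measure_singleton p)
    rw [← setLIntegral_congr hae]
    refine lintegral_mono_set ?_
    rintro w ⟨hw, hwp⟩
    have h1 := hw.1
    exact ⟨⟨abs_lt.2 hw.2, H.sin_sub_pole_ne_zero
      (abs_lt.2 ⟨by linarith [hw.1.1], by linarith [hw.1.2]⟩) hwp⟩, ⟨hw.1.1.le, hw.1.2⟩⟩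
  · intro x hx y hy
    refine ContinuousAt.continuousWithinAt ?_
    have h1 : ContinuousAt G (x + y * I) :=
      (H.differentiableAt _ (by simpa using abs_le.2 hy) (hline x hx y)).continuousAt
    have h2 : ContinuousAt (fun y : ℝ => (x + y * I : ℂ)) y := by fun_prop
    exact (hu.comp OnePoint.continuous_coe).continuousAt.comp
      (ContinuousAt.comp (g := G) (f := fun y : ℝ => (x + y * I : ℂ)) h1 h2)
  · exact fun x hx => hu0 _ (hbot _ (by simp))
  · exact fun x hx => hu1 _ (htop _ (by simp))
  · intro x hx y hy
    have hmem : (x + y * I : ℂ) ∈ puncturedStrip h p := ⟨by simpa using abs_lt.2 hy, hline x hx y⟩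
    have hfield : (G (x + y * I) : OnePoint ℂ) ∈ C.field := H.map_notMem hmem
    have hre : (x + y * I : ℂ).re = x := by simp
    obtain ⟨c, t, ht, hl⟩ := hS _ hfield fun hmS => hx.2 (Or.inr ⟨x + y * I, ⟨⟨hmem, by
      rw [Set.mem_ofPred_eq, hre]; exact ⟨hx.1.1.le, hx.1.2⟩⟩, hmS⟩, hre⟩)
    have hGd : HasStrictFDerivAt G ((ContinuousLinearMap.toSpanSingleton ℂ
        (deriv G (x + y * I))).restrictScalars ℝ) (x + y * I) :=
      (H.hasStrictDerivAt hmem).hasStrictFDerivAt.restrictScalars ℝ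
    obtain ⟨c', t', ht', hl'⟩ := hGd.exists_lipschitzOnWith
    exact ⟨c * c', _, Filter.inter_mem ht' (hGd.continuousAt ht),
      hl.comp (hl'.mono Set.inter_subset_left) fun z hz => hz.2⟩

/-- The capacity of a condenser whose field is uniformized by a strip map. -/
theorem capacity_eq (H : IsStripMap G h p {z : ℂ | (z : OnePoint ℂ) ∈ C.E₀ ∪ C.E₁})
    (hinf : OnePoint.infty ∉ C.E₀ ∪ C.E₁)
    (htop : ∀ w : ℂ, w.im = h → (G w : OnePoint ℂ) ∈ C.E₁)
    (hbot : ∀ w : ℂ, w.im = -h → (G w : OnePoint ℂ) ∈ C.E₀)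
    (hvol : volume {z : ℂ | (z : OnePoint ℂ) ∈ C.E₀ ∪ C.E₁} = 0) :
    C.capacity = ENNReal.ofReal (Real.pi / (2 * h)) :=
  (H.capacity_le hinf htop hbot hvol).antisymm (H.le_capacity htop hbot hvol)

end IsStripMap

lemma setOf_coe_mem_arcCondenser {R γ : ℝ} (hR : 1 < R) (hγ : 0 < γ) :
    {z : ℂ | (z : OnePoint ℂ) ∈ (arcCondenser R γ hR hγ).E₀ ∪ (arcCondenser R γ hR hγ).E₁}
      = planePlates R γ := by
  ext z
  change (z : OnePoint ℂ) ∈ circArc (1 / R) γ ∪ circArc R γ ↔ z ∈ planeArc (1 / R) γ ∪ planeArc R γ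
  rw [Set.mem_union, Set.mem_union, coe_mem_circArc, coe_mem_circArc]

/-- The capacity of the condenser, in terms of the nome `exp (-T)`. -/
theorem capacity_arcCondenser {T a γ x₀ : ℝ} (ha : 0 < a) (haT : a < T / 2) (hγ : 0 < γ)
    (hγπ : γ < Real.pi) (hx₀ : x₀ ∈ Set.Ioo 0 (Real.pi / 2))
    (h₀ : boundaryPhase (Real.exp (2 * a)) (Real.exp (-T)) x₀ = γ)
    (hmax : ∀ x ∈ Set.Icc 0 (Real.pi / 2), boundaryPhase (Real.exp (2 * a)) (Real.exp (-T)) x ≤ γ)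
    (hR : 1 < Real.exp (2 * a)) :
    (arcCondenser (Real.exp (2 * a)) γ hR hγ).capacity = ENNReal.ofReal (Real.pi / T) := by
  have H := isStripMap_condenserMap ha haT hγ hγπ hx₀ h₀ hmax
  have hR0 : 0 < Real.exp (2 * a) := Real.exp_pos _
  have hIT : (I * (T : ℂ) / 2) = ((T / 2 : ℝ) : ℂ) * I := by push_cast; ring
  have hinf : ∀ r : ℝ, OnePoint.infty ∉ circArc r γ := by
    rintro r ⟨φ, -, hφ⟩
    exact OnePoint.coe_ne_infty _ hφ
  have hne : Real.exp (2 * a) ≠ 1 / Real.exp (2 * a) := by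
    intro h
    have h1 : 1 / Real.exp (2 * a) < 1 := (div_lt_one hR0).2 hR
    linarith
  have hvol := volume_planePlates (γ := γ) hR0
  rw [← setOf_coe_mem_arcCondenser hR hγ] at H hvol
  rw [H.capacity_eq (fun h => h.elim (hinf _) (hinf _)) ?_ ?_ hvol]
  · congr 2; ring
  · intro w hw
    have e : w = (w.re : ℂ) + I * T / 2 := by
      rw [hIT]
      apply Complex.ext
      · simp
      · simp [hw]
    -- The boundary value is known to lie on one of the plates; its modulus decides which.
    have hn : ‖condenserMap T a w‖ = Real.exp (2 * a) := by
      rw [e, condenserMap_top ha haT, norm_mul, mul_comm I, norm_exp_ofReal_mul_I, norm_real,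
        Real.norm_of_nonneg hR0.le, mul_one]
    have hb : condenserMap T a w ∈ planePlates (Real.exp (2 * a)) γ := by
      rw [← setOf_coe_mem_arcCondenser hR hγ]
      exact H.map_boundary w (by rw [hw, abs_of_pos H.height_pos])
    rcases hb with hb | hb
    · exact absurd (hn.symm.trans (norm_of_mem_planeArc (by positivity) hb)) hne
    · exact coe_mem_circArc.2 hb
  · intro w hw
    have e : w = (w.re : ℂ) - I * T / 2 := by
      rw [hIT]
      apply Complex.ext
      · simp
      · simp [hw]
    have hn : ‖condenserMap T a w‖ = 1 / Real.exp (2 * a) := by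
      rw [e, condenserMap_bottom ha haT, norm_mul, mul_comm I, norm_exp_ofReal_mul_I, norm_real,
        Real.norm_of_nonneg (by positivity), mul_one]
    have hb : condenserMap T a w ∈ planePlates (Real.exp (2 * a)) γ := by
      rw [← setOf_coe_mem_arcCondenser hR hγ]
      exact H.map_boundary w (by rw [hw, abs_neg, abs_of_pos H.height_pos])
    rcases hb with hb | hb
    · exact coe_mem_circArc.2 hb
    · exact absurd ((norm_of_mem_planeArc hR0 hb).symm.trans hn) hne

/-! ### The Jacobi functions in the variable of the theta functions -/

/-- `sn` as a function of the argument of the theta functions. -/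
def thetaSn (T : ℝ) (w : ℂ) : ℂ := vth3 T 0 / vth2 T 0 * (vth1 T w / vth4 T w)

/-- `cn` as a function of the argument of the theta functions. -/
def thetaCn (T : ℝ) (w : ℂ) : ℂ := vth4 T 0 / vth2 T 0 * (vth2 T w / vth4 T w)

/-- `dn` as a function of the argument of the theta functions. -/
def thetaDn (T : ℝ) (w : ℂ) : ℂ := vth4 T 0 / vth3 T 0 * (vth3 T w / vth4 T w)

section

variable {T : ℝ}

lemma ofReal_thetaNull2 (hT : 0 < T) : (thetaNull2 (Real.exp (-T)) : ℂ) = vth2 T 0 := by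
  rw [← theta2_zero, theta2_exp_neg hT]

lemma ofReal_thetaNull3 (hT : 0 < T) : (thetaNull3 (Real.exp (-T)) : ℂ) = vth3 T 0 := by
  rw [← theta3_zero, theta3_exp_neg hT]

lemma thetaNull3_ne_zero (hT : 0 < T) : thetaNull3 (Real.exp (-T)) ≠ 0 := by
  have h := vth3_zero_ne_zero hT
  rw [← ofReal_thetaNull3 hT] at h
  exact_mod_cast h

lemma ofReal_modulus (hT : 0 < T) :
    (modulus (Real.exp (-T)) : ℂ) = vth2 T 0 ^ 2 / vth3 T 0 ^ 2 := by
  rw [modulus, ← ofReal_thetaNull2 hT, ← ofReal_thetaNull3 hT]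
  push_cast
  rfl

/-- As 2K = πϑ₃(0)², the variable u = ϑ₃(0)²w has πu/2K = w. The Jacobi functions are handled below
in the variable w. -/
lemma pi_mul_div_ellipticK (hT : 0 < T) (w : ℂ) :
    (Real.pi : ℂ) * w / (2 * ellipticK (Real.exp (-T))) = w / vth3 T 0 ^ 2 := by
  have hpi : (Real.pi : ℂ) ≠ 0 := ofReal_ne_zero.2 Real.pi_ne_zero
  have h3 := vth3_zero_ne_zero hT
  rw [ellipticK]
  push_cast
  rw [ofReal_thetaNull3 hT]
  field_simp

lemma pi_mul_sq_mul_div_ellipticK (hT : 0 < T) (w : ℂ) :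
    (Real.pi : ℂ) * (vth3 T 0 ^ 2 * w) / (2 * ellipticK (Real.exp (-T))) = w := by
  rw [pi_mul_div_ellipticK hT, mul_div_cancel_left₀ _ (pow_ne_zero 2 (vth3_zero_ne_zero hT))]

lemma jacobiSn_eq (hT : 0 < T) (w : ℂ) :
    jacobiSn (Real.exp (-T)) (vth3 T 0 ^ 2 * w) = thetaSn T w := by
  rw [jacobiSn, pi_mul_sq_mul_div_ellipticK hT, thetaSn, theta1_exp_neg hT, theta2_exp_neg hT,
    theta3_exp_neg hT, theta4_exp_neg hT]

lemma jacobiCn_eq (hT : 0 < T) (w : ℂ) :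
    jacobiCn (Real.exp (-T)) (vth3 T 0 ^ 2 * w) = thetaCn T w := by
  rw [jacobiCn, pi_mul_sq_mul_div_ellipticK hT, thetaCn, theta2_exp_neg hT, theta2_exp_neg hT,
    theta4_exp_neg hT, theta4_exp_neg hT]

lemma jacobiDn_eq (hT : 0 < T) (w : ℂ) :
    jacobiDn (Real.exp (-T)) (vth3 T 0 ^ 2 * w) = thetaDn T w := by
  rw [jacobiDn, pi_mul_sq_mul_div_ellipticK hT, thetaDn, theta3_exp_neg hT, theta3_exp_neg hT,
    theta4_exp_neg hT, theta4_exp_neg hT]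

lemma jacobiZ_eq (hT : 0 < T) (w : ℂ) :
    jacobiZ (Real.exp (-T)) (vth3 T 0 ^ 2 * w)
      = deriv (vth4 T) w / vth4 T w / vth3 T 0 ^ 2 := by
  have h3 := vth3_zero_ne_zero hT
  have hf : (fun w : ℂ => theta4 (Real.exp (-T))
      (Real.pi * w / (2 * ellipticK (Real.exp (-T))))) = fun w => vth4 T (w / vth3 T 0 ^ 2) := by
    funext u
    rw [pi_mul_div_ellipticK hT, theta4_exp_neg hT]
  have e : vth3 T 0 ^ 2 * w / vth3 T 0 ^ 2 = w := mul_div_cancel_left₀ _ (pow_ne_zero 2 h3)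
  have hd : HasDerivAt (fun w => vth4 T (w / vth3 T 0 ^ 2))
      (deriv (vth4 T) (vth3 T 0 ^ 2 * w / vth3 T 0 ^ 2) * (1 / vth3 T 0 ^ 2)) (vth3 T 0 ^ 2 * w) :=
    (differentiable_vth4 hT _).hasDerivAt.comp _ ((hasDerivAt_id _).div_const _)
  rw [jacobiZ, hf, logDeriv_apply, hd.deriv, e]
  ring

lemma thetaSn_sq_add_thetaCn_sq (hT : 0 < T) {w : ℂ} (hw : vth4 T w ≠ 0) :
    thetaSn T w ^ 2 + thetaCn T w ^ 2 = 1 := by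
  have h2 := vth2_zero_ne_zero hT
  have h := vth3_sq_mul_vth1_sq hT w
  rw [thetaSn, thetaCn]
  field_simp
  exact h

lemma thetaDn_sq_add (hT : 0 < T) {w : ℂ} (hw : vth4 T w ≠ 0) :
    thetaDn T w ^ 2 + (vth2 T 0 ^ 2 / vth3 T 0 ^ 2) ^ 2 * thetaSn T w ^ 2 = 1 := by
  have h2 := vth2_zero_ne_zero hT
  have h3 := vth3_zero_ne_zero hT
  have h := vth4_sq_mul_vth3_sq hT w
  rw [thetaSn, thetaDn]
  field_simp
  exact h

/-- This is the Wronskian of ϑ₁ and ϑ₄; the factor ϑ₃(0)² is du/dw. -/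
lemma hasDerivAt_thetaSn (hT : 0 < T) {w : ℂ} (hw : vth4 T w ≠ 0) :
    HasDerivAt (thetaSn T) (vth3 T 0 ^ 2 * (thetaCn T w * thetaDn T w)) w := by
  have h2 := vth2_zero_ne_zero hT
  have h3 := vth3_zero_ne_zero hT
  have h := ((differentiable_vth1 hT w).hasDerivAt.div (differentiable_vth4 hT w).hasDerivAt
    hw).const_mul (vth3 T 0 / vth2 T 0)
  rw [vth1_vth4_wronskian hT] at h
  convert! h using 1
  rw [thetaCn, thetaDn]
  field_simp

lemma vth4_ofReal_ne_zero (hT : 0 < T) (x : ℝ) : vth4 T x ≠ 0 :=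
  vth4_ne_zero hT (by simpa using hT)

lemma vth_zero_real (T : ℝ) : starRingEnd ℂ (vth2 T 0) = vth2 T 0 ∧
    starRingEnd ℂ (vth3 T 0) = vth3 T 0 ∧ starRingEnd ℂ (vth4 T 0) = vth4 T 0 := by
  refine ⟨?_, ?_, ?_⟩
  · rw [← vth2_conj, map_zero]
  · rw [← vth3_conj, map_zero]
  · rw [← vth4_conj, map_zero]

lemma ofReal_re_thetaSn (T x : ℝ) : ((thetaSn T x).re : ℂ) = thetaSn T x := by
  obtain ⟨h2, h3, -⟩ := vth_zero_real T
  refine conj_eq_iff_re.1 ?_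
  rw [thetaSn, map_mul, map_div₀, map_div₀, ← vth1_conj, ← vth4_conj, conj_ofReal, h2, h3]

lemma ofReal_re_thetaCn (T x : ℝ) : ((thetaCn T x).re : ℂ) = thetaCn T x := by
  obtain ⟨h2, -, h4⟩ := vth_zero_real T
  refine conj_eq_iff_re.1 ?_
  rw [thetaCn, map_mul, map_div₀, map_div₀, h2, h4, ← vth2_conj, ← vth4_conj, conj_ofReal]

lemma ofReal_re_thetaDn (T x : ℝ) : ((thetaDn T x).re : ℂ) = thetaDn T x := by
  obtain ⟨-, h3, h4⟩ := vth_zero_real T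
  refine conj_eq_iff_re.1 ?_
  rw [thetaDn, map_mul, map_div₀, map_div₀, h3, h4, ← vth3_conj, ← vth4_conj, conj_ofReal]

lemma continuous_thetaCn (hT : 0 < T) : Continuous fun x : ℝ => (thetaCn T x).re :=
  continuous_re.comp (((((differentiable_vth2 hT).continuous.comp continuous_ofReal).div
    ((differentiable_vth4 hT).continuous.comp continuous_ofReal)
    (vth4_ofReal_ne_zero hT))).const_mul _)

lemma continuous_thetaDn (hT : 0 < T) : Continuous fun x : ℝ => (thetaDn T x).re :=
  continuous_re.comp (((((differentiable_vth3 hT).continuous.comp continuous_ofReal).div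
    ((differentiable_vth4 hT).continuous.comp continuous_ofReal)
    (vth4_ofReal_ne_zero hT))).const_mul _)

lemma pos_of_continuousOn_of_ne_zero {f : ℝ → ℝ} {b : ℝ} (hf : Continuous f) (h0 : 0 < f 0)
    (hne : ∀ x ∈ Set.Icc 0 b, f x ≠ 0) : ∀ x ∈ Set.Icc 0 b, 0 < f x := by
  intro x hx
  by_contra! hc
  obtain ⟨y, hy, hy0⟩ := intermediate_value_Icc' hx.1 hf.continuousOn ⟨hc, h0.le⟩
  exact hne y ⟨hy.1, hy.2.trans hx.2⟩ hy0

lemma thetaCn_pos (hT : 0 < T) {b : ℝ} (hb : b < Real.pi / 2) :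
    ∀ x ∈ Set.Icc 0 b, 0 < (thetaCn T x).re := by
  refine pos_of_continuousOn_of_ne_zero (continuous_thetaCn hT) ?_ fun x hx h => ?_
  · have h2 := vth2_zero_ne_zero hT
    have h4 := vth4_zero_ne_zero hT
    have : thetaCn T (0 : ℝ) = 1 := by rw [thetaCn, ofReal_zero]; field_simp
    rw [this]; norm_num
  · have h' : thetaCn T x = 0 := by rw [← ofReal_re_thetaCn, h, ofReal_zero]
    have hv2 : vth2 T x ≠ 0 := vth2_ne_zero hT (by simpa using hT) (by
      rw [ofReal_re, abs_of_nonneg hx.1]; exact hx.2.trans_lt hb)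
    exact mul_ne_zero (div_ne_zero (vth4_zero_ne_zero hT) (vth2_zero_ne_zero hT))
      (div_ne_zero hv2 (vth4_ofReal_ne_zero hT x)) h'

lemma thetaDn_pos (hT : 0 < T) (b : ℝ) : ∀ x ∈ Set.Icc 0 b, 0 < (thetaDn T x).re := by
  refine pos_of_continuousOn_of_ne_zero (continuous_thetaDn hT) ?_ fun x hx h => ?_
  · have h3 := vth3_zero_ne_zero hT
    have h4 := vth4_zero_ne_zero hT
    have : thetaDn T (0 : ℝ) = 1 := by rw [thetaDn, ofReal_zero]; field_simp
    rw [this]; norm_num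
  · have h' : thetaDn T x = 0 := by rw [← ofReal_re_thetaDn, h, ofReal_zero]
    have hv3 : vth3 T x ≠ 0 := vth3_ne_zero hT (by simpa using hT)
    exact mul_ne_zero (div_ne_zero (vth4_zero_ne_zero hT) (vth3_zero_ne_zero hT))
      (div_ne_zero hv3 (vth4_ofReal_ne_zero hT x)) h'

lemma hasDerivAt_re_thetaSn (hT : 0 < T) (x : ℝ) :
    HasDerivAt (fun x : ℝ => (thetaSn T x).re)
      (thetaNull3 (Real.exp (-T)) ^ 2 * ((thetaCn T x).re * (thetaDn T x).re)) x := by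
  have h := (hasDerivAt_thetaSn hT (vth4_ofReal_ne_zero hT x)).real_of_complex
  convert! h using 1
  rw [← ofReal_thetaNull3 hT, ← ofReal_re_thetaCn, ← ofReal_re_thetaDn]
  norm_cast

lemma thetaSn_zero (T : ℝ) : thetaSn T (0 : ℝ) = 0 := by
  rw [thetaSn, ofReal_zero, vth1_zero]; simp

lemma re_thetaSn_sq_add (hT : 0 < T) (x : ℝ) :
    (thetaSn T x).re ^ 2 + (thetaCn T x).re ^ 2 = 1 := by
  have h := thetaSn_sq_add_thetaCn_sq hT (vth4_ofReal_ne_zero hT x)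
  rw [← ofReal_re_thetaSn, ← ofReal_re_thetaCn] at h
  exact_mod_cast h

lemma re_thetaDn_sq_add (hT : 0 < T) (x : ℝ) :
    (thetaDn T x).re ^ 2 + modulus (Real.exp (-T)) ^ 2 * (thetaSn T x).re ^ 2 = 1 := by
  have h := thetaDn_sq_add hT (vth4_ofReal_ne_zero hT x)
  rw [← ofReal_re_thetaSn, ← ofReal_re_thetaDn, ← ofReal_modulus hT] at h
  exact_mod_cast h

lemma sqrt_eq_thetaCn_mul_thetaDn (hT : 0 < T) {x : ℝ} (hx : x ∈ Set.Ico 0 (Real.pi / 2)) :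
    Real.sqrt ((1 - (thetaSn T x).re ^ 2) *
      (1 - modulus (Real.exp (-T)) ^ 2 * (thetaSn T x).re ^ 2))
      = (thetaCn T x).re * (thetaDn T x).re := by
  have hc := thetaCn_pos hT hx.2 x ⟨hx.1, le_rfl⟩
  have hd := thetaDn_pos hT x x ⟨hx.1, le_rfl⟩
  rw [sub_eq_of_eq_add' (re_thetaSn_sq_add hT x).symm, sub_eq_of_eq_add (re_thetaDn_sq_add hT x).symm,
    ← mul_pow, Real.sqrt_sq (by positivity)]

/-- The point π/2 corresponds to u = K. Before it cn and dn are positive, so sn increases from 0,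
and sn² = 1 − cn² < 1. -/
lemma thetaSn_mem_Ioo (hT : 0 < T) {x : ℝ} (hx : x ∈ Set.Ioo 0 (Real.pi / 2)) :
    (thetaSn T x).re ∈ Set.Ioo 0 1 := by
  have hc := thetaCn_pos hT hx.2 x ⟨hx.1.le, le_rfl⟩
  have hmono : StrictMonoOn (fun x : ℝ => (thetaSn T x).re) (Set.Icc 0 x) := by
    refine strictMonoOn_of_deriv_pos (convex_Icc 0 x)
      (fun y _ => (hasDerivAt_re_thetaSn hT y).continuousAt.continuousWithinAt) fun y hy => ?_
    rw [interior_Icc] at hy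
    rw [(hasDerivAt_re_thetaSn hT y).deriv]
    have h1 := thetaCn_pos hT hx.2 y ⟨hy.1.le, hy.2.le⟩
    have h2 := thetaDn_pos hT x y ⟨hy.1.le, hy.2.le⟩
    have h3 := thetaNull3_ne_zero hT
    positivity
  have hpos : 0 < (thetaSn T x).re := by
    have := hmono ⟨le_rfl, hx.1.le⟩ ⟨hx.1.le, le_rfl⟩ hx.1
    simpa only [thetaSn_zero T, zero_re] using this
  refine ⟨hpos, ?_⟩
  have := re_thetaSn_sq_add hT x
  nlinarith

/-! ### Elliptic integrals at `x = sn` -/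

/-- Substitution `t = sn` in the elliptic integrals. -/
lemma integral_thetaSn (hT : 0 < T) {x₀ : ℝ} (hx₀ : x₀ ∈ Set.Ico 0 (Real.pi / 2)) {g : ℝ → ℂ}
    (hg : ∀ x ∈ Set.Icc 0 x₀, ContinuousAt g (thetaSn T x).re) :
    ∫ t in (0 : ℝ)..(thetaSn T x₀).re, g t *
        (Real.sqrt ((1 - t ^ 2) * (1 - modulus (Real.exp (-T)) ^ 2 * t ^ 2)) : ℂ)⁻¹
      = ∫ x in (0 : ℝ)..x₀, (thetaNull3 (Real.exp (-T)) : ℂ) ^ 2 * g (thetaSn T x).re := by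
  set k := modulus (Real.exp (-T)) with hk
  have hmem : ∀ x ∈ Set.uIcc 0 x₀, x ∈ Set.Icc 0 x₀ := fun x hx => by
    rwa [Set.uIcc_of_le hx₀.1] at hx
  have hpos : ∀ x ∈ Set.Icc 0 x₀, 0 < (thetaCn T x).re * (thetaDn T x).re := fun x hx =>
    mul_pos (thetaCn_pos hT hx₀.2 x hx) (thetaDn_pos hT x₀ x hx)
  have hsqrt : ∀ x ∈ Set.Icc 0 x₀, Real.sqrt ((1 - (thetaSn T x).re ^ 2) *
      (1 - k ^ 2 * (thetaSn T x).re ^ 2)) = (thetaCn T x).re * (thetaDn T x).re :=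
    fun x hx => sqrt_eq_thetaCn_mul_thetaDn hT ⟨hx.1, hx.2.trans_lt hx₀.2⟩
  have h := intervalIntegral.integral_deriv_smul_comp' (a := 0) (b := x₀)
    (f := fun x : ℝ => (thetaSn T x).re)
    (g := fun t => g t * (Real.sqrt ((1 - t ^ 2) * (1 - k ^ 2 * t ^ 2)) : ℂ)⁻¹)
    (fun x _ => hasDerivAt_re_thetaSn hT x)
    ((continuous_thetaCn hT).mul (continuous_thetaDn hT) |>.const_mul _ |>.continuousOn) ?_
  · rw [thetaSn_zero T, zero_re] at h
    rw [← h]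
    refine intervalIntegral.integral_congr fun x hx => ?_
    have hx' := hmem x hx
    have hne : (((thetaCn T x).re * (thetaDn T x).re : ℝ) : ℂ) ≠ 0 :=
      ofReal_ne_zero.2 (hpos x hx').ne'
    simp only [Function.comp_apply]
    rw [hsqrt x hx', real_smul, ofReal_mul (thetaNull3 (Real.exp (-T)) ^ 2), ofReal_pow]
    field_simp
  · rintro _ ⟨x, hx, rfl⟩
    have hx' := hmem x hx
    refine ((hg x hx').mul (ContinuousAt.inv₀ (by fun_prop) ?_)).continuousWithinAt
    rw [hsqrt x hx']
    exact ofReal_ne_zero.2 (hpos x hx').ne'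

lemma ellipticF_thetaSn (hT : 0 < T) {x₀ : ℝ} (hx₀ : x₀ ∈ Set.Ico 0 (Real.pi / 2)) :
    (ellipticF (thetaSn T x₀).re (modulus (Real.exp (-T))) : ℂ)
      = (thetaNull3 (Real.exp (-T)) : ℂ) ^ 2 * x₀ := by
  have h := integral_thetaSn hT hx₀ (g := fun _ => 1) fun _ _ => continuousAt_const
  rw [intervalIntegral.integral_const] at h
  rw [ellipticF, ← intervalIntegral.integral_ofReal]
  simp only [one_div, ofReal_inv]
  simp only [one_mul, sub_zero, mul_one] at h
  rw [h, real_smul, mul_comm]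

lemma ellipticPi_thetaSn (hT : 0 < T) {x₀ : ℝ} (hx₀ : x₀ ∈ Set.Ico 0 (Real.pi / 2)) {ν : ℂ}
    (hν : ∀ x ∈ Set.Icc 0 x₀, 1 + ν * thetaSn T x ^ 2 ≠ 0) :
    ellipticPi (thetaSn T x₀).re ν (modulus (Real.exp (-T)))
      = ∫ x in (0 : ℝ)..x₀, (thetaNull3 (Real.exp (-T)) : ℂ) ^ 2 / (1 + ν * thetaSn T x ^ 2) := by
  have h := integral_thetaSn hT hx₀ (g := fun t => (1 + ν * (t : ℂ) ^ 2)⁻¹) fun x hx =>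
    ContinuousAt.inv₀ (by fun_prop) (by rw [ofReal_re_thetaSn]; exact hν x hx)
  rw [ellipticPi]
  simp only [one_div, mul_inv]
  rw [h]
  simp only [ofReal_re_thetaSn, div_eq_mul_inv]

end

/-! ### The transcendental equation -/

section

variable {T a : ℝ}

/-- The zeta function in the variable of the theta functions. -/
def thetaZ (T : ℝ) (w : ℂ) : ℂ := deriv (vth4 T) w / vth4 T w / vth3 T 0 ^ 2

lemma thetaCn_mul_thetaDn_add (hT : 0 < T) {w : ℂ} (hw : vth4 T w ≠ 0) :
    thetaCn T w * thetaDn T w + thetaSn T w * thetaZ T w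
      = deriv (vth1 T) w / (vth2 T 0 * vth3 T 0 * vth4 T w) := by
  have h2 := vth2_zero_ne_zero hT
  have h3 := vth3_zero_ne_zero hT
  have h := vth1_vth4_wronskian hT w
  rw [thetaCn, thetaDn, thetaSn, thetaZ]
  field_simp
  linear_combination -h

/-- The critical point of the boundary phase. -/
lemma thetaSn_sq_eq_of_quotDerivNum_eq_zero (ha : 0 < a) (haT : a < T / 2) {x₀ : ℝ}
    (hcrit : quotDerivNum T a x₀ = 0) :
    thetaSn T x₀ ^ 2 = thetaZ T (I * a) / ((vth2 T 0 ^ 2 / vth3 T 0 ^ 2) ^ 2 * thetaSn T (I * a) *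
      (thetaCn T (I * a) * thetaDn T (I * a) + thetaSn T (I * a) * thetaZ T (I * a))) := by
  have hT : 0 < T := by linarith
  have h2 := vth2_zero_ne_zero hT
  have h3 := vth3_zero_ne_zero hT
  have h4 := vth4_zero_ne_zero hT
  have hx := vth4_ofReal_ne_zero hT x₀
  have n1 := vth1_I_mul_ne_zero ha (show a < T by linarith)
  have n2 := vth2_I_mul_ne_zero ha (show a < T by linarith)
  have n3 := vth3_I_mul_ne_zero ha haT
  have n4 := vth4_I_mul_ne_zero ha haT
  have e := vth4_addition_deriv hT x₀ (I * a)
  rw [show deriv (vth4 T) (x₀ + I * a) * vth4 T (x₀ - I * a)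
    - vth4 T (x₀ + I * a) * deriv (vth4 T) (x₀ - I * a) = 0 from hcrit, zero_mul, eq_comm,
    mul_eq_zero, or_iff_right two_ne_zero, sub_eq_zero] at e
  have hw := vth1_vth4_wronskian hT (I * a)
  -- The denominator cn dn + sn Z is a multiple of ϑ₁'(ia). If that vanished, the critical equation
  -- would make ϑ₄'(ia) vanish too, against the Wronskian.
  have hd : deriv (vth1 T) (I * a) ≠ 0 := by
    intro h
    rw [h, mul_zero, mul_zero, mul_eq_zero, or_iff_right (pow_ne_zero 2 hx), mul_eq_zero,
      or_iff_right n4] at e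
    rw [h, e, zero_mul, mul_zero, sub_zero] at hw
    exact mul_ne_zero (pow_ne_zero 2 h4) (mul_ne_zero n2 n3) hw.symm
  rw [thetaCn_mul_thetaDn_add hT n4, thetaSn, thetaSn, thetaZ]
  field_simp
  linear_combination -e

/-- Up to non-zero factors, the addition theorem identifies this expression with ϑ₄(x+ia)ϑ₄(x−ia),
so the integrand of Π has no pole. -/
lemma one_sub_ne_zero (ha : 0 < a) (haT : a < T / 2) (x : ℝ) :
    1 + -(vth2 T 0 ^ 2 / vth3 T 0 ^ 2) ^ 2 * thetaSn T (I * a) ^ 2 * thetaSn T x ^ 2 ≠ 0 := by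
  have hT : 0 < T := by linarith
  have h2 := vth2_zero_ne_zero hT
  have h3 := vth3_zero_ne_zero hT
  have hx := vth4_ofReal_ne_zero hT x
  have n4 := vth4_I_mul_ne_zero ha haT
  have h := vth4_addition hT x (I * a)
  have hne := mul_ne_zero (mul_ne_zero (vth4_real_add_ne_zero ha haT x)
    (vth4_real_sub_ne_zero ha haT x)) (pow_ne_zero 2 (vth4_zero_ne_zero hT))
  rw [h] at hne
  intro h0
  apply hne
  rw [thetaSn, thetaSn] at h0
  field_simp at h0
  linear_combination h0

/-- The differentiated addition theorem divided by the addition theorem itself expresses the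
logarithmic derivative of the theta quotient, which is i times that of the phase, rationally in sn²
x. -/
lemma hasDerivAt_ofReal_boundaryPhase (ha : 0 < a) (haT : a < T / 2) (x : ℝ) :
    HasDerivAt (fun x : ℝ => (boundaryPhase (Real.exp (2 * a)) (Real.exp (-T)) x : ℂ))
      (2 * I * (thetaCn T (I * a) * thetaDn T (I * a) / thetaSn T (I * a)) *
        (vth3 T 0 ^ 2 / (1 + -(vth2 T 0 ^ 2 / vth3 T 0 ^ 2) ^ 2 * thetaSn T (I * a) ^ 2
          * thetaSn T x ^ 2) - vth3 T 0 ^ 2) - 2 * I * vth3 T 0 ^ 2 * thetaZ T (I * a)) x := by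
  have hT : 0 < T := by linarith
  have h2 := vth2_zero_ne_zero hT
  have h3 := vth3_zero_ne_zero hT
  have h4 := vth4_zero_ne_zero hT
  have hx := vth4_ofReal_ne_zero hT x
  have n1 := vth1_I_mul_ne_zero ha (show a < T by linarith)
  have n4 := vth4_I_mul_ne_zero ha haT
  have hsn : thetaSn T (I * a) ≠ 0 := mul_ne_zero (div_ne_zero h3 h2) (div_ne_zero n1 n4)
  obtain ⟨d, hd, he⟩ := exists_hasDerivAt_boundaryPhase ha haT x
  have hM := one_sub_ne_zero ha haT x
  convert! hd.ofReal_comp using 1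
  have e1 := vth4_addition_deriv hT x (I * a)
  have e2 := vth4_addition hT x (I * a)
  have e3 := thetaCn_mul_thetaDn_add hT n4
  rw [show deriv (vth4 T) (x + I * a) * vth4 T (x - I * a)
    - vth4 T (x + I * a) * deriv (vth4 T) (x - I * a) = _ from he, mul_assoc, e2] at e1
  set c := vth2 T 0 ^ 2 / vth3 T 0 ^ 2 with hc
  set S := thetaSn T (I * a) with hS
  set s := thetaSn T x with hs
  set Z := thetaZ T (I * a) with hZ
  set P := thetaCn T (I * a) * thetaDn T (I * a) with hP
  have r1 : vth1 T x = vth2 T 0 / vth3 T 0 * s * vth4 T x := by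
    rw [hs, thetaSn]; field_simp
  have r2 : vth1 T (I * a) = vth2 T 0 / vth3 T 0 * S * vth4 T (I * a) := by
    rw [hS, thetaSn]; field_simp
  have r3 : deriv (vth1 T) (I * a) = (P + S * Z) * (vth2 T 0 * vth3 T 0 * vth4 T (I * a)) := by
    rw [e3]; field_simp
  have r4 : deriv (vth4 T) (I * a) = Z * vth3 T 0 ^ 2 * vth4 T (I * a) := by
    rw [hZ, thetaZ]; field_simp
  rw [r1, r2, r3, r4] at e1
  have e4 : I * d * (1 + -c ^ 2 * S ^ 2 * s ^ 2)
      = 2 * vth3 T 0 ^ 2 * (Z - c ^ 2 * s ^ 2 * S * (P + S * Z)) := by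
    apply mul_right_cancel₀ (mul_ne_zero (pow_ne_zero 2 hx) (pow_ne_zero 2 n4))
    rw [hc]
    field_simp
    field_simp at e1
    linear_combination e1
  have hI : I * I = -1 := I_mul_I
  have e5 : (d : ℂ) * (1 + -c ^ 2 * S ^ 2 * s ^ 2)
      = -I * (2 * vth3 T 0 ^ 2 * (Z - c ^ 2 * s ^ 2 * S * (P + S * Z))) := by
    rw [← e4]; linear_combination ((d : ℂ) * (1 + -c ^ 2 * S ^ 2 * s ^ 2)) * hI
  apply mul_right_cancel₀ hM
  rw [e5]
  -- With M = 1 − k²S²s² one has k²s²SP = (P/S)(1 − M). Division by M then separates the integrand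
  -- of Π, a multiple of 1/M, from the constants that integrate to F.
  obtain ⟨M, hm⟩ : ∃ M, M = 1 + -c ^ 2 * S ^ 2 * s ^ 2 := ⟨_, rfl⟩
  rw [← hm] at hM ⊢
  have e6 : P / S * (1 - M) = c ^ 2 * s ^ 2 * S * P := by
    rw [hm]; field_simp; ring
  have e7 : vth3 T 0 ^ 2 / M * M = vth3 T 0 ^ 2 := div_mul_cancel₀ _ hM
  linear_combination (2 * I * (P / S)) * e7 + (2 * I * vth3 T 0 ^ 2) * e6
    - (2 * I * vth3 T 0 ^ 2 * Z) * hm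

/-- The angle in terms of elliptic integrals. -/
lemma ofReal_boundaryPhase_eq (ha : 0 < a) (haT : a < T / 2) {x₀ : ℝ}
    (hx₀ : x₀ ∈ Set.Ico 0 (Real.pi / 2)) :
    (boundaryPhase (Real.exp (2 * a)) (Real.exp (-T)) x₀ : ℂ)
      = 2 * I * (thetaCn T (I * a) * thetaDn T (I * a) / thetaSn T (I * a)) *
          (ellipticPi (thetaSn T x₀).re (-(modulus (Real.exp (-T)) : ℂ) ^ 2 * thetaSn T (I * a) ^ 2)
            (modulus (Real.exp (-T)))
            - (ellipticF (thetaSn T x₀).re (modulus (Real.exp (-T))) : ℂ))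
        - 2 * I * (ellipticF (thetaSn T x₀).re (modulus (Real.exp (-T))) : ℂ) * thetaZ T (I * a) := by
  have hT : 0 < T := by linarith
  have hM := one_sub_ne_zero ha haT
  rw [ellipticF_thetaSn hT hx₀, ofReal_modulus hT, ellipticPi_thetaSn hT hx₀ fun x _ => hM x,
    ofReal_thetaNull3 hT]
  have hs : Continuous fun x : ℝ => thetaSn T x :=
    continuous_iff_continuousAt.2 fun x => ContinuousAt.comp (f := fun x : ℝ => (x : ℂ))
      (hasDerivAt_thetaSn hT (vth4_ofReal_ne_zero hT x)).continuousAt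
      continuous_ofReal.continuousAt
  have hQ : Continuous fun x : ℝ => vth3 T 0 ^ 2 / (1 + -(vth2 T 0 ^ 2 / vth3 T 0 ^ 2) ^ 2 *
      thetaSn T (I * a) ^ 2 * thetaSn T x ^ 2) :=
    continuous_const.div (by fun_prop) hM
  have hQ' := (hQ.sub (continuous_const (y := vth3 T 0 ^ 2))).const_mul
    (2 * I * (thetaCn T (I * a) * thetaDn T (I * a) / thetaSn T (I * a)))
  simp only [Pi.sub_apply] at hQ'
  have hint := intervalIntegral.integral_eq_sub_of_hasDerivAt (a := 0) (b := x₀)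
    (fun x _ => hasDerivAt_ofReal_boundaryPhase ha haT x)
    ((hQ'.sub continuous_const).intervalIntegrable _ _)
  have hR : 1 < Real.exp (2 * a) := Real.one_lt_exp_iff.2 (by linarith)
  have hqR : Real.exp (-T) * Real.exp (2 * a) < 1 := by
    rw [← Real.exp_add, Real.exp_lt_one_iff]; linarith
  rw [boundaryPhase_zero hR (Real.exp_pos _).le hqR, ofReal_zero, sub_zero] at hint
  rw [← hint, intervalIntegral.integral_sub
    (hQ'.intervalIntegrable _ _)
    (continuous_const.intervalIntegrable _ _), intervalIntegral.integral_const_mul,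
    intervalIntegral.integral_sub (hQ.intervalIntegrable _ _)
    (continuous_const.intervalIntegrable _ _), intervalIntegral.integral_const,
    intervalIntegral.integral_const]
  simp only [sub_zero, real_smul]
  ring

end

end

/-! ### Assembly -/

theorem theorem2 (R γ : ℝ) (hR : 1 < R) (hγ : 0 < γ) (hγπ : γ < Real.pi) :
    0 < (arcCondenser R γ hR hγ).capacity ∧ (arcCondenser R γ hR hγ).capacity < ⊤ ∧
    let q : ℝ := Real.exp (-Real.pi / (arcCondenser R γ hR hγ).capacity.toReal)
    let k : ℝ := modulus q
    let α : ℝ := 1 / Real.pi * ellipticK q * Real.log R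
    let sn : ℂ := jacobiSn q (Complex.I * α)
    let cn : ℂ := jacobiCn q (Complex.I * α)
    let dn : ℂ := jacobiDn q (Complex.I * α)
    let Z : ℂ := jacobiZ q (Complex.I * α)
    ∃ l : ℝ, 0 < l ∧ l < 1 ∧
      (l : ℂ) ^ 2 = Z / ((k : ℂ) ^ 2 * sn * (cn * dn + sn * Z)) ∧
      (γ : ℂ) = 2 * Complex.I * (cn * dn / sn) *
            (ellipticPi l (-(k : ℂ) ^ 2 * sn ^ 2) k - (ellipticF l k : ℂ))
          - 2 * Complex.I * (ellipticF l k : ℂ) * Z := by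
  obtain ⟨q, hq, hqR, x₀, hx₀, h₀, hmax⟩ := exists_nome_of_angle hR hγ hγπ
  have hR0 : 0 < R := by linarith
  -- The parameters of the map: a = (ln R)/2 and T = −ln q. The condition qR < 1 becomes a < T/2,
  -- which keeps the pole and the zero inside the strip.
  obtain ⟨a, rfl⟩ : ∃ a, Real.exp (2 * a) = R :=
    ⟨Real.log R / 2, by rw [mul_div_cancel₀ _ two_ne_zero, Real.exp_log hR0]⟩
  obtain ⟨T, rfl⟩ : ∃ T, Real.exp (-T) = q := ⟨-Real.log q, by rw [neg_neg, Real.exp_log hq]⟩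
  have ha : 0 < a := by linarith [Real.one_lt_exp_iff.1 hR]
  have haT : a < T / 2 := by
    rw [← Real.exp_add, Real.exp_lt_one_iff] at hqR
    linarith
  have hT : 0 < T := by linarith
  have hpi := Real.pi_pos
  have hcap := capacity_arcCondenser ha haT hγ hγπ hx₀ h₀ hmax hR
  -- The capacity is π/T, so the nome prescribed in the statement is the one with which the map was
  -- built.
  have hnome : Real.exp (-Real.pi / (arcCondenser (Real.exp (2 * a)) γ hR hγ).capacity.toReal)
      = Real.exp (-T) := by
    rw [hcap, ENNReal.toReal_ofReal (by positivity)]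
    congr 1
    field_simp
  refine ⟨by rw [hcap]; exact ENNReal.ofReal_pos.2 (by positivity),
    by rw [hcap]; exact ENNReal.ofReal_lt_top, ?_⟩
  rw [hnome]
  have hα : Complex.I * ((1 / Real.pi * ellipticK (Real.exp (-T)) *
      Real.log (Real.exp (2 * a)) : ℝ) : ℂ) = vth3 T 0 ^ 2 * (Complex.I * a) := by
    rw [Real.log_exp, ← ofReal_thetaNull3 hT, ellipticK]
    rw [show 1 / Real.pi * (Real.pi / 2 * thetaNull3 (Real.exp (-T)) ^ 2) * (2 * a)
      = thetaNull3 (Real.exp (-T)) ^ 2 * a by field_simp]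
    push_cast
    ring
  simp only [hα, jacobiSn_eq hT, jacobiCn_eq hT, jacobiDn_eq hT, jacobiZ_eq hT]
  obtain ⟨h1, h2⟩ := thetaSn_mem_Ioo hT hx₀
  -- The modulus λ is sn at the point x₀ where the phase attains its maximum γ.
  refine ⟨_, h1, h2, ?_, ?_⟩
  · rw [ofReal_re_thetaSn, ofReal_modulus hT]
    exact thetaSn_sq_eq_of_quotDerivNum_eq_zero ha haT
      (image_boundaryPhase ha haT hγ hx₀ h₀ hmax).1
  · have h := ofReal_boundaryPhase_eq ha haT ⟨hx₀.1.le, hx₀.2⟩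
    rw [h₀] at h
    exact h
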